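/- Let $d\ge 1$ and $n\ge 2$ be integers, and let $\mathbb{T}^d=\mathbb{R}^d/\mathbb{Z}^d$. For a finite Borel measure $\mu$ on $\mathbb{T}^d$ and $\xi\in\mathbb{Z}^d$ let $\widehat\mu(\xi)=\int e^{-2\pi i\xi\cdot x}\,d\mu(x)$ and $\|\mu\|_{M(\lambda)}=\sup_{\xi\in\mathbb{Z}^d}|\widehat\mu(\xi)|\,|\xi|^{\lambda/2}$. The Fourier dimension of $\mu$ is the supremum of all $s\in[0,d]$ with $\|\mu\|_{M(s)}<\infty$; the Fourier dimension of a Borel set $E\subset\mathbb{T}^d$ is the supremum of the Fourier dimensions of the Borel probability measures $\mu$ with $\mathrm{supp}(\mu)\subset E$; and $E$ is a Salem set if its Fourier dimension equals its Hausdorff dimension. The lower Minkowski dimension of a compact set $K\subset\mathbb{T}^d$ is $\liminf_{r\to0^+}\,(d-\log_r|K_r|)$, where $|K_r|$ is the Lebesgue measure of the $r$-neighbourhood of $K$. For $\beta\in(0,d]$ let $\mathcal{X}_\beta$ be the space of all pairs $(E,\mu)$, where $E\subset\mathbb{T}^d$ is compact and $\mu$ is a Borel probability measure with $\mathrm{supp}(\mu)\subset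 E$ and $\|\mu\|_{M(\lambda)}<\infty$ for all $\lambda\in[0,\beta)$, with the product of the topology of the Hausdorff distance on the sets $E$ and the topology on the measures $\mu$ given by the seminorms $\|\cdot\|_{M(\lambda)}$, $\lambda\in[0,\beta)$. A property is generic in $\mathcal{X}_\beta$ if it holds on a comeager subset of $\mathcal{X}_\beta$. Theorem. Let $S\subset\mathbb{T}^d$ be a countable union of compact sets of lower Minkowski dimension zero. Then there is a compact Salem set $E\subset\mathbb{T}^d$ of Hausdorff dimension $d/(n-1)$ such that $$m_1x_1+\dots+m_nx_n\ne s$$ for all $s\in S$, all distinct $x_1,\dots,x_n\in E$ and all integers $m_1,\dots,m_n$ that are not all zero. Moreover, for every $\beta$ with $0<\beta\le d/(n-1)$, for generic $(E,\mu)\in\mathcal{X}_\beta$ the set $E$ is a Salem set of Hausdorff dimension $\beta$ with the same avoidance property. -/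

import Mathlib

open MeasureTheory Filter Topology Set TopologicalSpace
open scoped ENNReal NNReal UniformConvergence

/-- The torus `𝕋^d = ℝ^d / ℤ^d`. It carries the sup metric of the quotient metrics on `ℝ / ℤ`,
which is bi-Lipschitz equivalent to the Euclidean quotient metric: the Borel sets, the Hausdorff
and lower Minkowski dimensions and the topology of the Hausdorff distance are the same. -/
abbrev Torus (d : ℕ) : Type := UnitAddTorus (Fin d)

/-- Lower Minkowski dimension of `E ⊆ 𝕋^d`: the lower limit of `d - log_r |E_r|` as `r → 0⁺`, where
`|E_r|` is the Lebesgue measure of the open `r`-thickening of `E`. The logarithm takes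
values in the extended reals (`log 0 = -∞`), so the empty set has dimension `-∞`. -/
noncomputable def lowerMinkowskiDim {d : ℕ} (E : Set (Torus d)) : EReal :=
  liminf (fun r : ℝ => (d : EReal) -
    ENNReal.log (volume (Metric.thickening r E)) / ((Real.log r : ℝ) : EReal)) (𝓝[>] (0 : ℝ))

/-- The Euclidean length `|ξ|` of a frequency `ξ ∈ ℤ^d`. -/
noncomputable def freqNorm {d : ℕ} (ξ : Fin d → ℤ) : ℝ :=
  Real.sqrt (∑ i, (ξ i : ℝ) ^ 2)

/-- The Fourier coefficient `∫ exp (-2πi ξ · x) dμ(x)` of a measure on the torus. -/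
noncomputable def fourierMeasure {d : ℕ} (μ : Measure (Torus d)) (ξ : Fin d → ℤ) : ℂ :=
  ∫ x, UnitAddTorus.mFourier (-ξ) x ∂μ

/-- The weighted coefficient `|ξ|^(t/2) μ̂(ξ)`; the supremum over `ξ` of its modulus is the
seminorm `‖μ‖_{M(t)}`. -/
noncomputable def weightedFourier {d : ℕ} (t : ℝ) (μ : Measure (Torus d)) (ξ : Fin d → ℤ) : ℂ :=
  ((freqNorm ξ ^ (t / 2) : ℝ) : ℂ) * fourierMeasure μ ξ

/-- `‖μ‖_{M(t)} < ∞`. -/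
def HasFourierDecay {d : ℕ} (t : ℝ) (μ : Measure (Torus d)) : Prop :=
  BddAbove (range fun ξ : Fin d → ℤ => ‖weightedFourier t μ ξ‖)

/-- Fourier dimension of a finite Borel measure: the supremum of the `s ∈ [0, d]` with
`sup_ξ |μ̂(ξ)| |ξ|^(s/2) < ∞`. -/
noncomputable def fourierDimMeasure {d : ℕ} (μ : Measure (Torus d)) : ℝ≥0∞ :=
  ⨆ (s : ℝ≥0) (_ : (s : ℝ) ≤ d) (_ : HasFourierDecay (s : ℝ) μ), (s : ℝ≥0∞)

/-- Fourier dimension of a Borel set: the supremum of the Fourier dimensions of the Borel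
probability measures whose support is contained in the set. -/
noncomputable def fourierDim {d : ℕ} (E : Set (Torus d)) : ℝ≥0∞ :=
  ⨆ (μ : ProbabilityMeasure (Torus d)) (_ : (μ : Measure (Torus d)).support ⊆ E),
    fourierDimMeasure (μ : Measure (Torus d))

/-- A Salem set: the Fourier dimension agrees with the Hausdorff dimension. -/
def IsSalem {d : ℕ} (E : Set (Torus d)) : Prop :=
  fourierDim E = dimH E

/-- The space `𝒳_β` of pairs `(E, μ)`: `E` is a compact subset of `𝕋^d`, `μ` is a Borel probability
measure with `supp μ ⊆ E` (so that `E` is automatically nonempty), and `‖μ‖_{M(t)} < ∞` for every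
`t ∈ [0, β)`. -/
structure SupportPair (d : ℕ) (β : ℝ) where
  set : NonemptyCompacts (Torus d)
  measure : ProbabilityMeasure (Torus d)
  support_subset : (measure : Measure (Torus d)).support ⊆ (set : Set (Torus d))
  decay : ∀ t ∈ Ico (0 : ℝ) β, HasFourierDecay t (measure : Measure (Torus d))

/-- The topology of `𝒳_β`: the Hausdorff metric topology on the first component and the topology
of the seminorms `‖·‖_{M(t)}`, `t ∈ [0, β)`, on the second. Since `‖μ - ν‖_{M(t)}` is the sup
distance of the functions `ξ ↦ |ξ|^(t/2) μ̂(ξ)` and `ξ ↦ |ξ|^(t/2) ν̂(ξ)`, the latter is the topology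
of uniform convergence of these functions for each such `t`. -/
noncomputable instance (d : ℕ) (β : ℝ) : TopologicalSpace (SupportPair d β) :=
  TopologicalSpace.induced
    (fun p : SupportPair d β => ((p.set, fun t : Ico (0 : ℝ) β =>
      UniformFun.ofFun (weightedFourier (t : ℝ) (p.measure : Measure (Torus d)))) :
      NonemptyCompacts (Torus d) × (Ico (0 : ℝ) β → ((Fin d → ℤ) →ᵤ ℂ))))
    inferInstance

/-- `E` contains no distinct points `x₁, …, xₙ` with `m₁ x₁ + ⋯ + mₙ xₙ ∈ S` for some integers
`m₁, …, mₙ` that are not all zero. -/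
def AvoidsLinear {d : ℕ} (n : ℕ) (S E : Set (Torus d)) : Prop :=
  ∀ s ∈ S, ∀ x : Fin n → Torus d, Function.Injective x → (∀ i, x i ∈ E) →
    ∀ m : Fin n → ℤ, m ≠ 0 → ∑ i, m i • x i ≠ s

/-! The argument is by Baire category. `𝒳_β` is a Baire space (`SupportPair.baireSpace`): countably
many of its seminorms determine the topology, and the resulting embedding into a complete space has
closed range. Both properties of `E` follow from countably many conditions of the form "`E` lies in
some member of a family `𝒰` of open sets". Such a condition is open for the Hausdorff distance, so
only its density needs proof.

Density reduces to `FourierApproximable` (`SupportPair.dense_of_fourierApproximable`). After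
smoothing, `μ` has a bounded density `f`. Suppose a measure `ν` agrees with `f` up to `r^(l/2)`, `l
> t`, at frequencies `|ξ| ≤ r⁻³`, and the `2r`-thickening of its carrier lies in `𝒰`. Convolving `ν`
with a mollifier of scale `r` whose coefficients are at most `(C/(r|ξ|))^d` and normalising gives a
measure close to `μ` in `M(t)`, still supported in a member of `𝒰`.

The measures `ν` are random. Write `N = n - 1`, take `t < l < u < β`, and fix a ball `Q`. Outside
`Q`, `f` is replaced by about `r^(-u)` independent uniform points weighted by `f`. McDiarmid's
inequality makes the error smaller than `r^(l/2)` at polynomially many frequencies simultaneously.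
Inside `Q` the density is kept, but points `x` for which `a x + ∑ wⱼ X_{κ j}` comes within a
multiple of `r` of the compact set `K` are deleted. The deleted volume is at most about `r^(-N u)
r^(d - ε)`, which is small because `N β ≤ d`. Only `n - 1` of the `n` variables are discretised,
hence the threshold `d/(n - 1)`.

Deletion must not bias the Fourier transform (`exists_weight`). If `∑ wⱼ ≠ 0`, translating all
sample points shows that each `x` is deleted with the same probability, so rescaling by a constant
removes the bias exactly. If `w = 0`, the deleted set is deterministic, with volume only about `r^(d
- ε)`. Some index to single out always gives one of these two cases
(`exists_ne_zero_sum_succAbove`).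

For the Salem property, an energy estimate gives Fourier dimension at most Hausdorff dimension, so
`dim E ≥ β`. Taking `Q = ∅` makes coverings by about `r^(-u)` balls of radius `2r` generic, so `dim
E ≤ β`. -/

instance torus_volume_isProbabilityMeasure (d : ℕ) :
    IsProbabilityMeasure (volume : Measure (Torus d)) := by
  have : IsProbabilityMeasure (volume : Measure UnitAddCircle) :=
    ⟨by rw [UnitAddCircle.measure_univ]⟩
  exact inferInstanceAs (IsProbabilityMeasure (Measure.pi fun _ : Fin d => (volume : Measure UnitAddCircle)))

theorem torus_volume_closedBall {d : ℕ} (x : Torus d) {r : ℝ} (h0 : 0 ≤ r) (h1 : r ≤ 1 / 2) :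
    volume (Metric.closedBall x r) = ENNReal.ofReal ((2 * r) ^ d) := by
  rw [volume_pi, Measure.pi_closedBall _ _ h0]
  simp only [AddCircle.volume_closedBall]
  rw [min_eq_right (by linarith), Finset.prod_const, Finset.card_univ, Fintype.card_fin,
    ENNReal.ofReal_pow (by linarith)]

/-! ### Characters and Fourier coefficients of measures -/

section Characters

variable {d : ℕ}

theorem mFourier_apply_add (ξ : Fin d → ℤ) (x y : Torus d) :
    UnitAddTorus.mFourier ξ (x + y) = UnitAddTorus.mFourier ξ x * UnitAddTorus.mFourier ξ y := by
  simp only [UnitAddTorus.mFourier, ContinuousMap.coe_mk, Pi.add_apply, fourier_apply, smul_add,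
    AddCircle.toCircle_add, Circle.coe_mul, Finset.prod_mul_distrib]

theorem norm_mFourier_apply (ξ : Fin d → ℤ) (x : Torus d) :
    ‖UnitAddTorus.mFourier ξ x‖ = 1 := by
  simp only [UnitAddTorus.mFourier, ContinuousMap.coe_mk, fourier_apply, norm_prod,
    Circle.norm_coe, Finset.prod_const_one]

theorem integrable_mFourier (ξ : Fin d → ℤ) (μ : Measure (Torus d)) [IsFiniteMeasure μ] :
    Integrable (fun x => UnitAddTorus.mFourier ξ x) μ :=
  Integrable.of_bound (UnitAddTorus.mFourier ξ).continuous.aestronglyMeasurable 1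
    (ae_of_all _ fun x => (norm_mFourier_apply ξ x).le)

theorem norm_fourierMeasure_le (μ : Measure (Torus d)) (ξ : Fin d → ℤ) :
    ‖fourierMeasure μ ξ‖ ≤ μ.real univ := by
  refine (norm_integral_le_integral_norm _).trans ?_
  simp [norm_mFourier_apply]

theorem norm_fourierMeasure_le_one (μ : Measure (Torus d)) [IsProbabilityMeasure μ]
    (ξ : Fin d → ℤ) : ‖fourierMeasure μ ξ‖ ≤ 1 := by
  simpa using norm_fourierMeasure_le μ ξ

theorem fourierMeasure_zero_freq (μ : Measure (Torus d)) [IsFiniteMeasure μ] :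
    fourierMeasure μ 0 = (μ.real univ : ℂ) := by
  simp [fourierMeasure, UnitAddTorus.mFourier_zero]

theorem fourierMeasure_conv (μ ν : Measure (Torus d)) [IsFiniteMeasure μ] [IsFiniteMeasure ν]
    (ξ : Fin d → ℤ) :
    fourierMeasure (μ ∗ ν) ξ = fourierMeasure μ ξ * fourierMeasure ν ξ := by
  unfold fourierMeasure
  rw [integral_conv (integrable_mFourier _ _)]
  simp only [mFourier_apply_add, integral_const_mul, integral_mul_const]

theorem fourierMeasure_add (μ ν : Measure (Torus d)) [IsFiniteMeasure μ] [IsFiniteMeasure ν]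
    (ξ : Fin d → ℤ) :
    fourierMeasure (μ + ν) ξ = fourierMeasure μ ξ + fourierMeasure ν ξ :=
  integral_add_measure (integrable_mFourier _ _) (integrable_mFourier _ _)

theorem fourierMeasure_smul (c : ℝ≥0∞) (μ : Measure (Torus d)) (ξ : Fin d → ℤ) :
    fourierMeasure (c • μ) ξ = (c.toReal : ℂ) * fourierMeasure μ ξ := by
  unfold fourierMeasure
  rw [integral_smul_measure, Complex.real_smul]

end Characters

/-! ### Euclidean length of frequencies -/

section FreqNorm

variable {d : ℕ}

theorem freqNorm_nonneg (ξ : Fin d → ℤ) : 0 ≤ freqNorm ξ := Real.sqrt_nonneg _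

theorem freqNorm_zero : freqNorm (0 : Fin d → ℤ) = 0 := by simp [freqNorm]

theorem abs_le_freqNorm (ξ : Fin d → ℤ) (i : Fin d) : |(ξ i : ℝ)| ≤ freqNorm ξ := by
  rw [← Real.sqrt_sq_eq_abs]
  exact Real.sqrt_le_sqrt
    (Finset.single_le_sum (f := fun i => (ξ i : ℝ) ^ 2) (fun _ _ => sq_nonneg _) (Finset.mem_univ i))

theorem one_le_freqNorm {ξ : Fin d → ℤ} (h : ξ ≠ 0) : 1 ≤ freqNorm ξ := by
  obtain ⟨i, hi⟩ := Function.ne_iff.mp h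
  refine le_trans ?_ (abs_le_freqNorm ξ i)
  exact_mod_cast Int.one_le_abs hi

/-- The largest coordinate works. It is the direction in which the character oscillates fastest. -/
theorem exists_freqNorm_le_mul_abs {ξ : Fin d → ℤ} (h : ξ ≠ 0) :
    ∃ i, ξ i ≠ 0 ∧ freqNorm ξ ≤ d * |(ξ i : ℝ)| := by
  obtain ⟨j, hj⟩ := Function.ne_iff.mp h
  obtain ⟨i, -, hi⟩ := Finset.exists_max_image Finset.univ (fun i => |(ξ i : ℝ)|) ⟨j, Finset.mem_univ j⟩
  have hd : (1 : ℝ) ≤ d := by exact_mod_cast Fin.pos j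
  refine ⟨i, ?_, ?_⟩
  · intro h0
    have := hi j (Finset.mem_univ _)
    simp only [h0, Int.cast_zero, abs_zero] at this
    exact hj (by exact_mod_cast abs_nonpos_iff.mp this)
  · refine Real.sqrt_le_iff.mpr ⟨by positivity, ?_⟩
    calc ∑ k, (ξ k : ℝ) ^ 2 ≤ ∑ _k : Fin d, |(ξ i : ℝ)| ^ 2 :=
          Finset.sum_le_sum fun k _ => by
            rw [← sq_abs]; exact pow_le_pow_left₀ (abs_nonneg _) (hi k (Finset.mem_univ _)) 2
      _ = d * |(ξ i : ℝ)| ^ 2 := by simp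
      _ ≤ (d * |(ξ i : ℝ)|) ^ 2 := by
          rw [mul_pow]; gcongr; nlinarith

/-- The box of frequencies containing all `ξ` with `freqNorm ξ ≤ N`. -/
noncomputable def freqBox (d N : ℕ) : Finset (Fin d → ℤ) :=
  Fintype.piFinset fun _ => Finset.Icc (-(N : ℤ)) N

theorem mem_freqBox {N : ℕ} {ξ : Fin d → ℤ} (h : freqNorm ξ ≤ N) : ξ ∈ freqBox d N := by
  simp only [freqBox, Fintype.mem_piFinset, Finset.mem_Icc]
  intro i
  have := (abs_le_freqNorm ξ i).trans h
  exact abs_le.mp (by exact_mod_cast this)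

theorem card_freqBox (d N : ℕ) : (freqBox d N).card = (2 * N + 1) ^ d := by
  simp only [freqBox, Fintype.card_piFinset, Int.card_Icc, Finset.prod_const, Finset.card_univ,
    Fintype.card_fin]
  congr 1
  omega

end FreqNorm

/-! ### Mollifiers with polynomial Fourier decay -/

section Kernel

variable {d : ℕ}

/-- The uniform probability measure on the closed ball of radius `δ` around `0`. -/
noncomputable def uniformBall (d : ℕ) (δ : ℝ) : Measure (Torus d) :=
  ProbabilityTheory.cond volume (Metric.closedBall 0 δ)

theorem volume_closedBall_pos (x : Torus d) {δ : ℝ} (hδ : 0 < δ) :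
    volume (Metric.closedBall x δ) ≠ 0 :=
  (Metric.measure_closedBall_pos volume x hδ).ne'

theorem uniformBall_isProbabilityMeasure {δ : ℝ} (hδ : 0 < δ) :
    IsProbabilityMeasure (uniformBall d δ) :=
  ProbabilityTheory.cond_isProbabilityMeasure (volume_closedBall_pos 0 hδ)

theorem uniformBall_compl (δ : ℝ) : uniformBall d δ (Metric.closedBall 0 δ)ᶜ = 0 := by
  rw [uniformBall, ProbabilityTheory.cond_apply Metric.isClosed_closedBall.measurableSet]
  simp

theorem uniformBall_le (δ : ℝ) :
    uniformBall d δ ≤ (volume (Metric.closedBall (0 : Torus d) δ))⁻¹ • volume := by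
  unfold uniformBall ProbabilityTheory.cond
  gcongr
  exact Measure.restrict_le_self

/-- The translation is half a period of the character in direction `i`. -/
theorem exists_translate_mFourier_eq_neg_one {ξ : Fin d → ℤ} {i : Fin d} (hi : ξ i ≠ 0) :
    ∃ v : Torus d, ‖v‖ ≤ 1 / (2 * |(ξ i : ℝ)|) ∧ UnitAddTorus.mFourier (-ξ) v = -1 := by
  have hi' : (ξ i : ℝ) ≠ 0 := by exact_mod_cast hi
  refine ⟨Pi.single i ((1 / (2 * (ξ i : ℝ)) : ℝ) : UnitAddCircle), ?_, ?_⟩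
  · refine (pi_norm_le_iff_of_nonneg (by positivity)).mpr fun j => ?_
    by_cases h : j = i
    · subst h
      rw [Pi.single_eq_same]
      refine (UnitAddCircle.norm_eq).le.trans ?_
      refine (round_le _ 0).trans ?_
      simp [abs_mul]
    · rw [Pi.single_eq_of_ne h]; simp
  · simp only [UnitAddTorus.mFourier, ContinuousMap.coe_mk]
    rw [Finset.prod_eq_single i]
    · rw [Pi.single_eq_same, fourier_coe_apply]
      rw [← Complex.exp_neg_pi_mul_I] 
      congr 1
      have : (ξ i : ℂ) ≠ 0 := by exact_mod_cast hi
      simp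
      field_simp
    · intro j _ hj
      rw [Pi.single_eq_of_ne hj]; simp
    · simp

/-- Translation by `v` flips the sign of the character. Twice the integral over the ball is
therefore the integral of the character against the difference of the indicators of the ball and of
its translate. That difference vanishes off the shell of radii `δ - w` and `δ + w`. -/
theorem norm_setIntegral_closedBall_mFourier_le {δ w : ℝ} (hδ : 0 < δ) (hδ' : δ ≤ 1 / 4)
    (hw : w ≤ δ) (ξ : Fin d → ℤ) {v : Torus d} (hv : ‖v‖ ≤ w)
    (hv1 : UnitAddTorus.mFourier (-ξ) v = -1) :
    2 * ‖∫ x in Metric.closedBall (0 : Torus d) δ, UnitAddTorus.mFourier (-ξ) x‖ ≤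
      (2 * (δ + w)) ^ d - (2 * (δ - w)) ^ d := by
  have hw0 : 0 ≤ w := (norm_nonneg _).trans hv
  set B := Metric.closedBall (0 : Torus d) δ
  set A := Metric.closedBall (0 : Torus d) (δ + w) \ Metric.closedBall 0 (δ - w)
  have hB : MeasurableSet B := Metric.isClosed_closedBall.measurableSet
  have hA : MeasurableSet A :=
    Metric.isClosed_closedBall.measurableSet.diff Metric.isClosed_closedBall.measurableSet
  set e := fun x : Torus d => UnitAddTorus.mFourier (-ξ) x
  have he : Integrable e volume := integrable_mFourier _ _
  have hmeas : Measurable fun x : Torus d => x - v := measurable_sub_const' v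
  have h2 : ∫ x in B, e x = - ∫ x, (B.indicator (1 : Torus d → ℂ) (x - v)) * e x := by
    rw [← integral_add_right_eq_self (fun x => B.indicator (1 : Torus d → ℂ) (x - v) * e x) v,
      ← integral_neg, ← integral_indicator hB]
    congr 1
    ext x
    have hx : e (x + v) = - e x := by
      simp only [e]; rw [mFourier_apply_add, hv1]; ring
    rw [add_sub_cancel_right, hx]
    by_cases hm : x ∈ B <;> simp [hm, e]
  have h3 : ∫ x in B, e x = ∫ x, (B.indicator (1 : Torus d → ℂ) x) * e x := by
    rw [← integral_indicator hB]
    congr 1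
    ext x
    by_cases hm : x ∈ B <;> simp [hm]
  have hint (s : Torus d → ℂ) (hs : Measurable s) (hb : ∀ x, ‖s x‖ ≤ 1) :
      Integrable (fun x => s x * e x) volume := by
    refine Integrable.of_bound (hs.aestronglyMeasurable.mul he.aestronglyMeasurable) 1
      (ae_of_all _ fun x => ?_)
    rw [norm_mul, norm_mFourier_apply, mul_one]
    exact hb x
  have hind (x : Torus d) : ‖B.indicator (1 : Torus d → ℂ) x‖ ≤ 1 := by
    by_cases hm : x ∈ B <;> simp [hm]
  have hBm : Measurable (B.indicator (1 : Torus d → ℂ)) := measurable_one.indicator hB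
  have h4 : 2 * ∫ x in B, e x = ∫ x, (B.indicator (1 : Torus d → ℂ) x * e x -
      B.indicator (1 : Torus d → ℂ) (x - v) * e x) := by
    rw [integral_sub (hint _ hBm hind)
      (hint (fun x => B.indicator 1 (x - v)) (hBm.comp hmeas) fun x => hind _), ← h3]
    linear_combination h2
  have h5 : ‖2 * ∫ x in B, e x‖ ≤ ∫ x, A.indicator (1 : Torus d → ℝ) x := by
    rw [h4]
    refine norm_integral_le_of_norm_le ((integrable_const (1 : ℝ)).indicator hA)
      (ae_of_all _ fun x => ?_)
    rw [← sub_mul, norm_mul, norm_mFourier_apply, mul_one]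
    by_cases hxA : x ∈ A
    · by_cases h1 : x ∈ B <;> by_cases h2 : x - v ∈ B <;> simp [h1, h2, hxA]
    · have hn : ‖x‖ ≤ ‖x - v‖ + ‖v‖ := by simpa using norm_add_le (x - v) v
      have hn' : ‖x - v‖ ≤ ‖x‖ + ‖v‖ := norm_sub_le _ _
      simp only [A, Set.mem_sdiff, mem_closedBall_zero_iff, not_and, not_not] at hxA
      by_cases hc : ‖x‖ ≤ δ + w
      · have := hxA hc
        have h1 : x ∈ B := by simp only [B, mem_closedBall_zero_iff]; linarith
        have h2 : x - v ∈ B := by simp only [B, mem_closedBall_zero_iff]; linarith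
        simp [h1, h2, indicator_nonneg]
      · have h1 : x ∉ B := by simp only [B, mem_closedBall_zero_iff]; linarith
        have h2 : x - v ∉ B := by simp only [B, mem_closedBall_zero_iff]; linarith
        simp [h1, h2, indicator_nonneg]
  rw [norm_mul, Complex.norm_ofNat] at h5
  refine h5.trans (le_of_eq ?_)
  rw [integral_indicator_one hA, Measure.real, measure_sdiff (Metric.closedBall_subset_closedBall (by linarith))
    Metric.isClosed_closedBall.measurableSet.nullMeasurableSet (measure_ne_top _ _),
    torus_volume_closedBall _ (by linarith) (by linarith),
    torus_volume_closedBall _ (by linarith) (by linarith),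
    ENNReal.toReal_sub_of_le (ENNReal.ofReal_le_ofReal (by gcongr <;> linarith)) ENNReal.ofReal_ne_top,
    ENNReal.toReal_ofReal (by positivity), ENNReal.toReal_ofReal (pow_nonneg (by linarith) _)]

theorem norm_fourierMeasure_uniformBall_le {δ : ℝ} (hδ : 0 < δ) (hδ' : δ ≤ 1 / 4) {ξ : Fin d → ℤ}
    (hξ : ξ ≠ 0) :
    ‖fourierMeasure (uniformBall d δ) ξ‖ ≤ ((d : ℝ) ^ 2 * 2 ^ d) / (δ * freqNorm ξ) := by
  obtain ⟨i, hi, hle⟩ := exists_freqNorm_le_mul_abs hξ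
  obtain ⟨v, hv, hv1⟩ := exists_translate_mFourier_eq_neg_one hi
  have := uniformBall_isProbabilityMeasure (d := d) hδ
  have hd : (1 : ℝ) ≤ d := by exact_mod_cast Fin.pos i
  have hN := one_le_freqNorm hξ
  have hi' : (1 : ℝ) ≤ |(ξ i : ℝ)| := by exact_mod_cast Int.one_le_abs hi
  set w := 1 / (2 * |(ξ i : ℝ)|) with hwdef
  have hw0 : 0 < w := by positivity
  have hwle : w ≤ d / (2 * freqNorm ξ) := by
    rw [hwdef, div_le_div_iff₀ (by positivity) (by positivity)]; nlinarith
  have hgoal : d * 2 ^ d * (w / δ) ≤ ((d : ℝ) ^ 2 * 2 ^ d) / (δ * freqNorm ξ) := by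
    calc d * 2 ^ d * (w / δ) ≤ d * 2 ^ d * (d / (2 * freqNorm ξ) / δ) := by gcongr
      _ = (d : ℝ) ^ 2 * 2 ^ d / (δ * freqNorm ξ) / 2 := by field_simp
      _ ≤ _ := half_le_self (by positivity)
  refine le_trans ?_ hgoal
  -- When the shift is at least the radius, the claimed bound is at least `1` and nothing has to be
  -- shown.
  rcases le_total w δ with h | h
  · have hmain := norm_setIntegral_closedBall_mFourier_le hδ hδ' h ξ hv hv1
    have hvol : (volume (Metric.closedBall (0 : Torus d) δ))⁻¹.toReal = ((2 * δ) ^ d)⁻¹ := by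
      rw [torus_volume_closedBall _ hδ.le (by linarith), ENNReal.toReal_inv,
        ENNReal.toReal_ofReal (by positivity)]
    have heq : fourierMeasure (uniformBall d δ) ξ = (((2 * δ) ^ d)⁻¹ : ℝ) *
        ∫ x in Metric.closedBall (0 : Torus d) δ, UnitAddTorus.mFourier (-ξ) x := by
      rw [uniformBall, ProbabilityTheory.cond, fourierMeasure_smul, hvol]; rfl
    rw [heq, norm_mul, Complex.norm_real, Real.norm_of_nonneg (by positivity),
      inv_mul_le_iff₀ (by positivity)]
    have hpow : (2 * (δ + w)) ^ d - (2 * (δ - w)) ^ d ≤ 4 * w * d * (4 * δ) ^ (d - 1) := by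
      refine (le_abs_self _).trans ((abs_pow_sub_pow_le _ _ _).trans ?_)
      have e1 : |2 * (δ + w) - 2 * (δ - w)| = 4 * w := by
        rw [show 2 * (δ + w) - 2 * (δ - w) = 4 * w by ring, abs_of_pos (by positivity)]
      rw [e1]
      gcongr
      rw [abs_of_nonneg (by positivity), abs_of_nonneg (by linarith)]
      exact max_le (by linarith) (by linarith)
    have hd1 : d - 1 + 1 = d := by have := Fin.pos i; omega
    have hfin : 4 * w * d * (4 * δ) ^ (d - 1) = 2 * ((2 * δ) ^ d * (d * 2 ^ d * (w / δ))) / 2 := by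
      rw [← hd1, pow_succ, pow_succ, mul_pow, mul_pow, Nat.add_sub_cancel,
        show (4 : ℝ) = 2 * 2 by norm_num, mul_pow]
      field_simp
    have : 0 ≤ (2 * δ) ^ d * (d * 2 ^ d * (w / δ)) := by positivity
    linarith
  · refine (norm_fourierMeasure_le_one _ _).trans ?_
    have h1 : 1 ≤ w / δ := (one_le_div hδ).mpr h
    have h2 : (1 : ℝ) ≤ 2 ^ d := one_le_pow₀ (by norm_num)
    calc (1 : ℝ) = 1 * 1 * 1 := by ring
      _ ≤ _ := by gcongr

theorem conv_apply_eq_lintegral (μ ν : Measure (Torus d)) [SFinite ν] {A : Set (Torus d)}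
    (hA : MeasurableSet A) : (μ ∗ ν) A = ∫⁻ x, ν {y | x + y ∈ A} ∂μ := by
  rw [← lintegral_indicator_one hA, Measure.lintegral_conv (measurable_one.indicator hA)]
  congr 1
  ext x
  have : MeasurableSet {y | x + y ∈ A} := measurable_const_add x hA
  rw [← lintegral_indicator_one this]
  rfl

theorem conv_apply_compl_eq_zero {μ ν : Measure (Torus d)} [SFinite ν] {G F Z : Set (Torus d)}
    (hZ : MeasurableSet Z) (hG : μ Gᶜ = 0) (hF : ν Fᶜ = 0) (h : ∀ x ∈ G, ∀ y ∈ F, x + y ∈ Z) :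
    (μ ∗ ν) Zᶜ = 0 := by
  rw [conv_apply_eq_lintegral _ _ hZ.compl]
  refine (lintegral_congr_ae ?_).trans lintegral_zero
  have hG' : ∀ᵐ x ∂μ, x ∈ G := hG
  filter_upwards [hG'] with x hx
  exact measure_mono_null (fun y hy hyF => hy (h x hx y hyF)) hF

theorem le_conv_apply {μ ν : Measure (Torus d)} [IsProbabilityMeasure ν] {G F Z : Set (Torus d)}
    (hZ : MeasurableSet Z) (hG : MeasurableSet G) (hF : ν Fᶜ = 0)
    (h : ∀ x ∈ G, ∀ y ∈ F, x + y ∈ Z) : μ G ≤ (μ ∗ ν) Z := by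
  rw [conv_apply_eq_lintegral _ _ hZ, ← lintegral_indicator_one hG]
  refine lintegral_mono fun x => ?_
  by_cases hx : x ∈ G
  · have hF' : ∀ᵐ y ∂ν, y ∈ F := hF
    have : ν {y | x + y ∈ Z} = 1 :=
      (prob_compl_eq_zero_iff (measurable_const_add x hZ)).mp
        (measure_mono_null (fun y hy hyF => hy (h x hx y hyF)) hF)
    simp [hx, this]
  · simp [hx]

theorem conv_le_smul_volume (μ ν : Measure (Torus d)) [IsProbabilityMeasure μ] [SFinite ν]
    {c : ℝ≥0∞} (h : ν ≤ c • volume) : μ ∗ ν ≤ c • volume := by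
  refine Measure.le_iff.mpr fun A hA => ?_
  rw [conv_apply_eq_lintegral _ _ hA]
  calc ∫⁻ x, ν {y | x + y ∈ A} ∂μ ≤ ∫⁻ _x, (c • volume) A ∂μ := by
        refine lintegral_mono fun x => (h _).trans (le_of_eq ?_)
        simp only [Measure.smul_apply]
        congr 1
        exact measure_preimage_add volume x A
    _ = _ := by simp

/-- The `k`-fold convolution of the uniform measure on the closed ball of radius `δ`. -/
noncomputable def uniformBallPow (d : ℕ) (δ : ℝ) : ℕ → Measure (Torus d)
  | 0 => Measure.dirac 0
  | k + 1 => uniformBallPow d δ k ∗ uniformBall d δ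

theorem uniformBallPow_isProbabilityMeasure {δ : ℝ} (hδ : 0 < δ) (k : ℕ) :
    IsProbabilityMeasure (uniformBallPow d δ k) := by
  have := uniformBall_isProbabilityMeasure (d := d) hδ
  induction k with
  | zero => exact Measure.dirac.isProbabilityMeasure
  | succ k ih => exact inferInstanceAs (IsProbabilityMeasure (uniformBallPow d δ k ∗ uniformBall d δ))

theorem uniformBallPow_compl {δ : ℝ} (hδ : 0 < δ) (k : ℕ) :
    uniformBallPow d δ k (Metric.closedBall 0 (k * δ))ᶜ = 0 := by
  have := uniformBall_isProbabilityMeasure (d := d) hδ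
  induction k with
  | zero =>
    rw [uniformBallPow, Measure.dirac_apply' _ Metric.isClosed_closedBall.measurableSet.compl]
    simp
  | succ k ih =>
    refine conv_apply_compl_eq_zero Metric.isClosed_closedBall.measurableSet ih
      (uniformBall_compl δ) fun x hx y hy => ?_
    rw [mem_closedBall_zero_iff] at *
    refine (norm_add_le x y).trans ?_
    push_cast
    linarith

theorem norm_fourierMeasure_uniformBallPow_le {δ : ℝ} (hδ : 0 < δ) (hδ' : δ ≤ 1 / 4)
    {ξ : Fin d → ℤ} (hξ : ξ ≠ 0) (k : ℕ) :
    ‖fourierMeasure (uniformBallPow d δ k) ξ‖ ≤ (((d : ℝ) ^ 2 * 2 ^ d) / (δ * freqNorm ξ)) ^ k := by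
  have := uniformBall_isProbabilityMeasure (d := d) hδ
  induction k with
  | zero =>
    have := uniformBallPow_isProbabilityMeasure (d := d) hδ 0
    simpa using norm_fourierMeasure_le_one (uniformBallPow d δ 0) ξ
  | succ k ih =>
    have := uniformBallPow_isProbabilityMeasure (d := d) hδ k
    rw [uniformBallPow, fourierMeasure_conv, norm_mul, pow_succ]
    exact mul_le_mul ih (norm_fourierMeasure_uniformBall_le hδ hδ' hξ) (norm_nonneg _)
      ((norm_nonneg _).trans ih)

/-- Mollifiers on the torus whose Fourier coefficients decay like `|ξ|^{-d}`. -/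
theorem exists_mollifier (hd : 1 ≤ d) : ∃ C : ℝ, 0 < C ∧ ∀ r : ℝ, 0 < r → r ≤ 1 / 4 →
    ∃ φ : ProbabilityMeasure (Torus d), (φ : Measure (Torus d)) (Metric.closedBall 0 r)ᶜ = 0 ∧
      (∃ L : ℝ≥0, (φ : Measure (Torus d)) ≤ (L : ℝ≥0∞) • volume) ∧
      ∀ ξ : Fin d → ℤ, ξ ≠ 0 →
        ‖fourierMeasure (φ : Measure (Torus d)) ξ‖ ≤ (C / (r * freqNorm ξ)) ^ d := by
  have hd' : (1 : ℝ) ≤ d := by exact_mod_cast hd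
  -- The mollifier is the `d`-fold convolution of the uniform measure on a ball of radius `r / d`:
  -- the radii add up to `r` and the decay factors multiply. The last factor `d` compensates for the
  -- radius `r / d`.
  refine ⟨(d : ℝ) ^ 2 * 2 ^ d * d, by positivity, fun r hr hr' => ?_⟩
  have hδ : 0 < r / d := by positivity
  have hδ' : r / d ≤ 1 / 4 := (div_le_self hr.le hd').trans hr'
  have := uniformBall_isProbabilityMeasure (d := d) hδ
  refine ⟨⟨uniformBallPow d (r / d) d, uniformBallPow_isProbabilityMeasure hδ d⟩, ?_, ?_, ?_⟩
  · have := uniformBallPow_compl (d := d) hδ d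
    rwa [mul_div_cancel₀ r (by positivity : (d : ℝ) ≠ 0)] at this
  · refine ⟨(volume (Metric.closedBall (0 : Torus d) (r / d)))⁻¹.toNNReal, ?_⟩
    rw [ENNReal.coe_toNNReal (ENNReal.inv_ne_top.mpr (volume_closedBall_pos 0 hδ))]
    obtain ⟨k, rfl⟩ := Nat.exists_eq_add_of_le' hd
    have := uniformBallPow_isProbabilityMeasure (d := k + 1) hδ k
    exact conv_le_smul_volume _ _ (uniformBall_le _)
  · intro ξ hξ
    refine (norm_fourierMeasure_uniformBallPow_le hδ hδ' hξ d).trans (le_of_eq ?_)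
    have := one_le_freqNorm hξ
    congr 1
    field_simp

end Kernel

/-! ### Lipschitz bounds for characters -/

section CharacterBound

variable {d : ℕ}

theorem norm_fourier_sub_one_le (n : ℤ) (x : UnitAddCircle) :
    ‖(fourier n x : ℂ) - 1‖ ≤ 2 * Real.pi * |(n : ℝ)| * ‖x‖ := by
  obtain ⟨a, rfl⟩ := QuotientAddGroup.mk_surjective x
  change ‖(fourier n (a : UnitAddCircle) : ℂ) - 1‖ ≤ 2 * Real.pi * |(n : ℝ)| * ‖(a : UnitAddCircle)‖
  -- The representative `a - round a` has absolute value equal to the norm in the circle.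
  have h : ((a - round a : ℝ) : UnitAddCircle) = (a : UnitAddCircle) := by
    rw [AddCircle.coe_sub, sub_eq_self, AddCircle.coe_eq_zero_iff]
    exact ⟨round a, by simp⟩
  rw [UnitAddCircle.norm_eq, ← h, fourier_coe_apply]
  have := Real.norm_exp_I_mul_ofReal_sub_one_le (x := 2 * Real.pi * n * (a - round a))
  rw [Real.norm_eq_abs, abs_mul, abs_mul, abs_of_pos (by positivity : 0 < 2 * Real.pi)] at this
  convert this using 4
  push_cast
  ring

theorem norm_prod_sub_one_le {ι : Type*} (s : Finset ι) (z : ι → ℂ) (hz : ∀ i, ‖z i‖ = 1) :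
    ‖∏ i ∈ s, z i - 1‖ ≤ ∑ i ∈ s, ‖z i - 1‖ := by
  classical
  induction s using Finset.induction_on with
  | empty => simp
  | insert i s hi ih =>
    rw [Finset.prod_insert hi, Finset.sum_insert hi]
    calc ‖z i * ∏ j ∈ s, z j - 1‖ = ‖(z i - 1) + z i * (∏ j ∈ s, z j - 1)‖ := by ring_nf
      _ ≤ ‖z i - 1‖ + ‖z i * (∏ j ∈ s, z j - 1)‖ := norm_add_le _ _
      _ ≤ _ := by rw [norm_mul, hz, one_mul]; gcongr

theorem norm_mFourier_sub_one_le (ξ : Fin d → ℤ) (x : Torus d) :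
    ‖UnitAddTorus.mFourier ξ x - 1‖ ≤ 2 * Real.pi * (∑ i, |(ξ i : ℝ)|) * ‖x‖ := by
  simp only [UnitAddTorus.mFourier, ContinuousMap.coe_mk]
  refine (norm_prod_sub_one_le _ _ fun i => by rw [fourier_apply, Circle.norm_coe]).trans ?_
  rw [Finset.mul_sum, Finset.sum_mul]
  exact Finset.sum_le_sum fun i _ => (norm_fourier_sub_one_le _ _).trans
    (by gcongr; exact norm_le_pi_norm x i)

end CharacterBound

/-! ### Power sums over the integer lattice -/

section PowerSums

/-- A discrete form of comparison with the integral of `x^(-a)`, making the sum telescope. It is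
Bernoulli's inequality for the exponent `1 - a` at `-1/(N+1)`. -/
theorem rpow_neg_le_sub {a : ℝ} (h0 : 0 < a) (h1 : a < 1) (N : ℕ) :
    ((N : ℝ) + 1) ^ (-a) ≤ (1 - a)⁻¹ * (((N : ℝ) + 1) ^ (1 - a) - (N : ℝ) ^ (1 - a)) := by
  have hN : (0 : ℝ) < N + 1 := by positivity
  have hb := rpow_one_add_le_one_add_mul_self (s := -1 / ((N : ℝ) + 1)) (p := 1 - a)
    (by rw [le_div_iff₀ hN]; linarith [(Nat.cast_nonneg N : (0 : ℝ) ≤ N)]) (by linarith) (by linarith)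
  have e1 : 1 + -1 / ((N : ℝ) + 1) = N / (N + 1) := by field_simp; ring
  rw [e1, Real.div_rpow (Nat.cast_nonneg _) hN.le, div_le_iff₀ (by positivity)] at hb
  have e2 : ((N : ℝ) + 1) ^ (1 - a) = (N + 1) * ((N : ℝ) + 1) ^ (-a) := by
    rw [sub_eq_add_neg, Real.rpow_add hN, Real.rpow_one]
  rw [inv_mul_eq_div, le_div_iff₀ (by linarith)]
  have e3 : (1 + (1 - a) * (-1 / ((N : ℝ) + 1))) * ((N : ℝ) + 1) ^ (1 - a) =
      ((N : ℝ) + 1) ^ (1 - a) - (1 - a) * ((N : ℝ) + 1) ^ (-a) := by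
    rw [e2]; field_simp; ring
  rw [e3] at hb
  linarith

/-- The weight `max(1, |j|)^{-a}`. -/
noncomputable def latticeWeight (a : ℝ) (j : ℤ) : ℝ := (max 1 |(j : ℝ)|) ^ (-a)

theorem latticeWeight_nonneg (a : ℝ) (j : ℤ) : 0 ≤ latticeWeight a j := by
  unfold latticeWeight; positivity

theorem latticeWeight_neg (a : ℝ) (j : ℤ) : latticeWeight a (-j) = latticeWeight a j := by
  simp [latticeWeight]

/-- The constant `3` pays for the terms `-1, 0, 1`. Each further pair `±(N+2)` costs two telescoping
differences. -/
theorem sum_latticeWeight_le {a : ℝ} (h0 : 0 < a) (h1 : a < 1) (N : ℕ) :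
    ∑ j ∈ Finset.Icc (-((N + 1 : ℕ) : ℤ)) (N + 1 : ℕ), latticeWeight a j ≤
      3 * (1 - a)⁻¹ * ((N : ℝ) + 1) ^ (1 - a) := by
  have hinv : 1 ≤ (1 - a)⁻¹ := (one_le_inv₀ (by linarith)).mpr (by linarith)
  induction N with
  | zero =>
    have : Finset.Icc (-((0 + 1 : ℕ) : ℤ)) (0 + 1 : ℕ) = {-1, 0, 1} := by decide
    rw [this]
    simp [latticeWeight]
    linarith
  | succ N ih =>
    have hset : Finset.Icc (-((N + 1 + 1 : ℕ) : ℤ)) (N + 1 + 1 : ℕ) =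
        insert (-((N + 2 : ℕ) : ℤ)) (insert ((N + 2 : ℕ) : ℤ)
          (Finset.Icc (-((N + 1 : ℕ) : ℤ)) (N + 1 : ℕ))) := by
      ext j; simp only [Finset.mem_insert, Finset.mem_Icc]; push_cast; omega
    rw [hset, Finset.sum_insert, Finset.sum_insert, latticeWeight_neg]
    · have hw : latticeWeight a ((N + 2 : ℕ) : ℤ) = (((N + 1 : ℕ) : ℝ) + 1) ^ (-a) := by
        unfold latticeWeight
        congr 1
        push_cast
        rw [max_eq_right, abs_of_nonneg] <;> [ring; positivity; (rw [abs_of_nonneg] <;> [linarith [(Nat.cast_nonneg N : (0 : ℝ) ≤ N)]; positivity])]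
      have := rpow_neg_le_sub h0 h1 (N + 1)
      rw [hw]
      push_cast at *
      have hpos : 0 ≤ ((N : ℝ) + 1 + 1) ^ (-a) := by positivity
      nlinarith
    · simp only [Finset.mem_Icc]; push_cast; omega
    · simp only [Finset.mem_insert, Finset.mem_Icc]; push_cast; omega

theorem sum_freqBox_prod_latticeWeight_le {d : ℕ} {a : ℝ} (h0 : 0 < a) (h1 : a < 1) (N : ℕ) :
    ∑ ξ ∈ freqBox d (N + 1), ∏ i, latticeWeight a (ξ i) ≤
      (3 * (1 - a)⁻¹ * ((N : ℝ) + 1) ^ (1 - a)) ^ d := by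
  rw [freqBox, ← Finset.prod_univ_sum, Finset.prod_const, Finset.card_univ, Fintype.card_fin]
  exact pow_le_pow_left₀ (Finset.sum_nonneg fun _ _ => latticeWeight_nonneg _ _)
    (sum_latticeWeight_le h0 h1 N) d

end PowerSums

/-! ### Energy sums of the Fourier coefficients -/

section Energy

variable {d : ℕ}

theorem HasFourierDecay.exists_bound {s : ℝ} {μ : Measure (Torus d)} (h : HasFourierDecay s μ) :
    ∃ A : ℝ, 0 ≤ A ∧ ∀ ξ, freqNorm ξ ^ (s / 2) * ‖fourierMeasure μ ξ‖ ≤ A := by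
  obtain ⟨A, hA⟩ := h
  have h' (ξ : Fin d → ℤ) : freqNorm ξ ^ (s / 2) * ‖fourierMeasure μ ξ‖ ≤ A := by
    have := hA ⟨ξ, rfl⟩
    simpa only [weightedFourier, norm_mul, Complex.norm_real,
      Real.norm_of_nonneg (Real.rpow_nonneg (freqNorm_nonneg ξ) _)] using this
  exact ⟨A, (mul_nonneg (Real.rpow_nonneg (freqNorm_nonneg 0) _) (norm_nonneg _)).trans (h' 0), h'⟩

/-- Distributing the power evenly over the coordinates makes lattice sums factorise. The
one-dimensional exponent `t / d` is below `1` when `t < d`. -/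
theorem freqNorm_rpow_neg_le {t : ℝ} (ht : 0 ≤ t) (hd : 1 ≤ d) {ξ : Fin d → ℤ} (hξ : ξ ≠ 0) :
    freqNorm ξ ^ (-t) ≤ ∏ i, latticeWeight (t / d) (ξ i) := by
  have hN := one_le_freqNorm hξ
  have hd' : (0 : ℝ) < d := by exact_mod_cast hd
  calc freqNorm ξ ^ (-t) = ∏ _i : Fin d, freqNorm ξ ^ (-(t / d)) := by
        rw [Finset.prod_const, Finset.card_univ, Fintype.card_fin, ← Real.rpow_natCast,
          ← Real.rpow_mul (by linarith)]
        congr 1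
        field_simp
    _ ≤ _ := Finset.prod_le_prod (fun _ _ => by positivity) fun i _ =>
        Real.rpow_le_rpow_of_nonpos (by positivity) (max_le hN (abs_le_freqNorm ξ i))
          (by rw [neg_nonpos]; positivity)

theorem HasFourierDecay.exists_norm_mul_norm_le {s t : ℝ} {μ : Measure (Torus d)} [IsProbabilityMeasure μ]
    (h : HasFourierDecay s μ) (ht : 0 < t) (hts : t ≤ s) (hd : 1 ≤ d) :
    ∃ A : ℝ, 0 ≤ A ∧ ∀ ξ, ‖fourierMeasure μ (-ξ)‖ * ‖fourierMeasure μ ξ‖ ≤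
      A * ∏ i, latticeWeight (t / d) (ξ i) := by
  obtain ⟨A, hA0, hA⟩ := h.exists_bound
  -- The `1` covers frequency zero, where the decay hypothesis says nothing; `A ^ 2` covers the
  -- others.
  refine ⟨max 1 (A ^ 2), by positivity, fun ξ => ?_⟩
  by_cases hξ : ξ = 0
  · subst hξ
    have : ∏ i : Fin d, latticeWeight (t / d) ((0 : Fin d → ℤ) i) = 1 := by
      simp [latticeWeight]
    rw [this, mul_one]
    calc _ ≤ (1 : ℝ) * 1 := by gcongr <;> exact norm_fourierMeasure_le_one _ _
      _ ≤ _ := by simp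
  · have hN := one_le_freqNorm hξ
    have hneg : freqNorm (-ξ) = freqNorm ξ := by simp [freqNorm]
    have e : freqNorm ξ ^ (s / 2) * freqNorm ξ ^ (s / 2) = freqNorm ξ ^ s := by
      rw [← Real.rpow_add (by linarith)]; ring_nf
    have h1 := hA ξ
    have h2 := hA (-ξ)
    rw [hneg] at h2
    have hpos : 0 < freqNorm ξ ^ s := by positivity
    have h3 : freqNorm ξ ^ s * (‖fourierMeasure μ (-ξ)‖ * ‖fourierMeasure μ ξ‖) ≤ A ^ 2 := by
      calc _ = (freqNorm ξ ^ (s / 2) * ‖fourierMeasure μ (-ξ)‖) *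
            (freqNorm ξ ^ (s / 2) * ‖fourierMeasure μ ξ‖) := by rw [← e]; ring
        _ ≤ A * A := by gcongr
        _ = A ^ 2 := by ring
    calc _ ≤ A ^ 2 * freqNorm ξ ^ (-s) := by
          rw [Real.rpow_neg (by linarith), ← div_eq_mul_inv, le_div_iff₀' hpos]; exact h3
      _ ≤ max 1 (A ^ 2) * freqNorm ξ ^ (-t) := by
          gcongr
          exact le_max_right _ _
      _ ≤ _ := by gcongr; exact freqNorm_rpow_neg_le ht.le hd hξ

/-- The frequencies in the cube `[0, N)^d`. -/
noncomputable def freqCube (d N : ℕ) : Finset (Fin d → ℤ) :=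
  Fintype.piFinset fun _ => Finset.Ico (0 : ℤ) N

theorem card_freqCube (d N : ℕ) : (freqCube d N).card = N ^ d := by
  simp [freqCube, Fintype.card_piFinset]

/-- For fixed `k` the differences `k - l` are distinct and lie in a box of side about `2N`, where
the weights sum to at most a multiple of `N^(d-t)`. There are `N^d` choices of `k`. -/
theorem sum_freqCube_le {s t : ℝ} {μ : Measure (Torus d)} [IsProbabilityMeasure μ]
    (h : HasFourierDecay s μ) (ht : 0 < t) (hts : t ≤ s) (htd : t < d) :
    ∃ A : ℝ, 0 ≤ A ∧ ∀ N : ℕ, 1 ≤ N → ∑ k ∈ freqCube d N, ∑ l ∈ freqCube d N,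
      ‖fourierMeasure μ (-(k - l))‖ * ‖fourierMeasure μ (k - l)‖ ≤ A * (N : ℝ) ^ (2 * d - t) := by
  have hd' : (0 : ℝ) < d := ht.trans htd
  have hd : 1 ≤ d := by exact_mod_cast hd'
  obtain ⟨A, hA0, hA⟩ := h.exists_norm_mul_norm_le ht hts hd
  have ha0 : 0 < t / d := by positivity
  have ha1 : t / d < 1 := (div_lt_one hd').mpr htd
  have hpos : 0 < 1 - t / d := by linarith
  refine ⟨A * (3 * (1 - t / d)⁻¹) ^ d, by positivity, fun N hN => ?_⟩
  obtain ⟨n, rfl⟩ := Nat.exists_eq_add_of_le' hN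
  have hN0 : (0 : ℝ) < n + 1 := by positivity
  have inner (k) (hk : k ∈ freqCube d (n + 1)) : ∑ l ∈ freqCube d (n + 1),
      ‖fourierMeasure μ (-(k - l))‖ * ‖fourierMeasure μ (k - l)‖ ≤
        A * (3 * (1 - t / d)⁻¹ * ((n : ℝ) + 1) ^ (1 - t / d)) ^ d := by
    calc _ ≤ ∑ l ∈ freqCube d (n + 1), A * ∏ i, latticeWeight (t / d) ((k - l) i) :=
          Finset.sum_le_sum fun l _ => hA _
      _ = ∑ ξ ∈ (freqCube d (n + 1)).image (fun l => k - l),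
            A * ∏ i, latticeWeight (t / d) (ξ i) := by
          rw [Finset.sum_image]
          intro x _ y _ hxy
          exact sub_right_injective hxy
      _ ≤ ∑ ξ ∈ freqBox d (n + 1), A * ∏ i, latticeWeight (t / d) (ξ i) := by
          refine Finset.sum_le_sum_of_subset_of_nonneg ?_ fun _ _ _ =>
            mul_nonneg hA0 (Finset.prod_nonneg fun _ _ => latticeWeight_nonneg _ _)
          intro ξ hξ
          obtain ⟨l, hl, rfl⟩ := Finset.mem_image.mp hξ
          simp only [freqCube, freqBox, Fintype.mem_piFinset, Finset.mem_Ico, Finset.mem_Icc,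
            Pi.sub_apply] at *
          intro i
          have := hk i
          have := hl i
          omega
      _ ≤ _ := by
          rw [← Finset.mul_sum]
          gcongr
          exact sum_freqBox_prod_latticeWeight_le ha0 ha1 n
  refine (Finset.sum_le_card_nsmul _ _ _ inner).trans (le_of_eq ?_)
  rw [card_freqCube, nsmul_eq_mul, mul_pow _ (((n : ℝ) + 1) ^ (1 - t / d)), ← Real.rpow_natCast (((n : ℝ) + 1) ^ (1 - t / d)),
    ← Real.rpow_mul hN0.le]
  have e1 : (1 - t / d) * (d : ℝ) = d - t := by field_simp
  have e2 : (2 * (d : ℝ) - t) = d + (d - t) := by ring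
  rw [e1, e2]
  push_cast
  rw [Real.rpow_add hN0, Real.rpow_natCast]
  ring

/-- So close to the origin every character of the cube is within `1/2` of `1`: the exponent is at
most `2π · dN · ‖z‖`, and `π ≤ 4` explains the `16`. Hence the sum has real part at least `N^d / 2`.
-/
theorem quarter_le_normSq_sum_mFourier {N : ℕ} (hN : 1 ≤ N) (hd : 1 ≤ d) {z : Torus d}
    (hz : ‖z‖ ≤ 1 / (16 * d * N)) :
    (N : ℝ) ^ (2 * d) / 4 ≤ Complex.normSq (∑ k ∈ freqCube d N, UnitAddTorus.mFourier k z) := by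
  have hN' : (1 : ℝ) ≤ N := by exact_mod_cast hN
  have hd' : (1 : ℝ) ≤ d := by exact_mod_cast hd
  have h1 (k) (hk : k ∈ freqCube d N) : ‖UnitAddTorus.mFourier k z - 1‖ ≤ 1 / 2 := by
    have hsum : ∑ i, |(k i : ℝ)| ≤ d * N := by
      calc ∑ i, |(k i : ℝ)| ≤ ∑ _i : Fin d, (N : ℝ) := Finset.sum_le_sum fun i _ => by
            simp only [freqCube, Fintype.mem_piFinset, Finset.mem_Ico] at hk
            rw [abs_of_nonneg (by exact_mod_cast (hk i).1)]
            exact_mod_cast (hk i).2.le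
        _ = d * N := by simp
    calc _ ≤ 2 * Real.pi * (∑ i, |(k i : ℝ)|) * ‖z‖ := norm_mFourier_sub_one_le k z
      _ ≤ 2 * 4 * (d * N) * (1 / (16 * d * N)) := by
          gcongr
          exact Real.pi_le_four
      _ = 1 / 2 := by field_simp; norm_num
  have h2 (k) (hk : k ∈ freqCube d N) : 1 / 2 ≤ (UnitAddTorus.mFourier k z).re := by
    have := (Complex.abs_re_le_norm _).trans (h1 k hk)
    rw [Complex.sub_re, Complex.one_re] at this
    linarith [(abs_le.mp this).1]
  have h3 : (N : ℝ) ^ d / 2 ≤ (∑ k ∈ freqCube d N, UnitAddTorus.mFourier k z).re := by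
    rw [Complex.re_sum]
    have := Finset.card_nsmul_le_sum _ _ _ h2
    rw [card_freqCube, nsmul_eq_mul] at this
    push_cast at this
    linarith
  rw [Complex.normSq_apply]
  have h4 : 0 ≤ (N : ℝ) ^ d / 2 := by positivity
  have : (N : ℝ) ^ (2 * d) / 4 = ((N : ℝ) ^ d / 2) * ((N : ℝ) ^ d / 2) := by ring
  rw [this]
  nlinarith [mul_self_nonneg (∑ k ∈ freqCube d N, UnitAddTorus.mFourier k z).im]

end Energy

/-! ### Fourier dimension is at most Hausdorff dimension -/

section EnergyDimension

variable {d : ℕ}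

/-- The squared modulus of the exponential sum over a cube of frequencies dominates a multiple of
the indicator of a small ball. Its double integral against `μ` is exactly a sum of products of
Fourier coefficients, so no potential theory is needed. -/
theorem lintegral_measure_closedBall_le {s t : ℝ} {μ : Measure (Torus d)} [IsProbabilityMeasure μ]
    (h : HasFourierDecay s μ) (ht : 0 < t) (hts : t ≤ s) (htd : t < d) :
    ∃ A : ℝ, 0 ≤ A ∧ ∀ N : ℕ, 1 ≤ N →
      ∫⁻ x, μ (Metric.closedBall x (1 / (16 * d * N))) ∂μ ≤ ENNReal.ofReal (A * (N : ℝ) ^ (-t)) := by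
  have hd' : (0 : ℝ) < d := ht.trans htd
  have hd : 1 ≤ d := by exact_mod_cast hd'
  obtain ⟨A, hA0, hA⟩ := sum_freqCube_le h ht hts htd
  refine ⟨4 * A, by positivity, fun N hN => ?_⟩
  have hN0 : (0 : ℝ) < N := by exact_mod_cast hN
  set F : Torus d → ℝ := fun z =>
    Complex.normSq (∑ k ∈ freqCube d N, UnitAddTorus.mFourier k z) with hF
  have hFc : Continuous F := by fun_prop
  have hexp (x y : Torus d) : (F (x - y) : ℂ) = ∑ k ∈ freqCube d N, ∑ l ∈ freqCube d N,
      UnitAddTorus.mFourier (k - l) x * UnitAddTorus.mFourier (-(k - l)) y := by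
    rw [hF, Complex.normSq_eq_conj_mul_self, map_sum, Finset.sum_mul_sum, Finset.sum_comm]
    refine Finset.sum_congr rfl fun k _ => Finset.sum_congr rfl fun l _ => ?_
    have hneg : UnitAddTorus.mFourier (k - l) (-y) = UnitAddTorus.mFourier (-(k - l)) y := by
      simp only [UnitAddTorus.mFourier, ContinuousMap.coe_mk, Pi.neg_apply, fourier_apply, smul_neg,
        neg_smul]
    rw [← UnitAddTorus.mFourier_neg, ← UnitAddTorus.mFourier_add, neg_add_eq_sub, sub_eq_add_neg x y,
      mFourier_apply_add, hneg]
  have hF0 (z) : 0 ≤ F z := Complex.normSq_nonneg _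
  obtain ⟨B, hB⟩ : ∃ B, ∀ z, F z ≤ B := by
    obtain ⟨B, hB⟩ := (isCompact_range hFc).bddAbove
    exact ⟨B, fun z => hB ⟨z, rfl⟩⟩
  have hint (x : Torus d) : Integrable (fun y => F (x - y)) μ :=
    Integrable.of_bound (by fun_prop) B
      (ae_of_all _ fun y => by rw [Real.norm_of_nonneg (hF0 _)]; exact hB _)
  have hinner (x : Torus d) : ((∫ y, F (x - y) ∂μ : ℝ) : ℂ) =
      ∑ k ∈ freqCube d N, ∑ l ∈ freqCube d N,
        UnitAddTorus.mFourier (k - l) x * fourierMeasure μ (k - l) := by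
    rw [← integral_complex_ofReal]
    simp only [hexp]
    rw [integral_finsetSum _ fun k _ => integrable_finsetSum _ fun l _ =>
      (integrable_mFourier _ _).const_mul _]
    refine Finset.sum_congr rfl fun k _ => ?_
    rw [integral_finsetSum _ fun l _ => (integrable_mFourier _ _).const_mul _]
    refine Finset.sum_congr rfl fun l _ => ?_
    rw [integral_const_mul]; rfl
  have houter : ((∫ x, ∫ y, F (x - y) ∂μ ∂μ : ℝ) : ℂ) =
      ∑ k ∈ freqCube d N, ∑ l ∈ freqCube d N,
        fourierMeasure μ (-(k - l)) * fourierMeasure μ (k - l) := by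
    rw [← integral_complex_ofReal]
    simp only [hinner]
    rw [integral_finsetSum _ fun k _ => integrable_finsetSum _ fun l _ =>
      (integrable_mFourier _ _).mul_const _]
    refine Finset.sum_congr rfl fun k _ => ?_
    rw [integral_finsetSum _ fun l _ => (integrable_mFourier _ _).mul_const _]
    refine Finset.sum_congr rfl fun l _ => ?_
    rw [integral_mul_const]; simp only [fourierMeasure, neg_neg]
  have hle : ∫ x, ∫ y, F (x - y) ∂μ ∂μ ≤ A * (N : ℝ) ^ (2 * d - t) := by
    refine le_trans ?_ (hA N hN)
    rw [← Complex.ofReal_re (∫ x, ∫ y, F (x - y) ∂μ ∂μ), houter]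
    refine (Complex.re_le_norm _).trans ((norm_sum_le _ _).trans ?_)
    refine Finset.sum_le_sum fun k _ => (norm_sum_le _ _).trans ?_
    exact Finset.sum_le_sum fun l _ => (norm_mul _ _).le
  have hmeas2 : AEStronglyMeasurable (fun x => ∫ y, F (x - y) ∂μ) μ := by
    have : StronglyMeasurable (Function.uncurry fun x y : Torus d => F (x - y)) := by
      refine Continuous.stronglyMeasurable ?_
      fun_prop
    exact this.integral_prod_right.aestronglyMeasurable
  have hint2 : Integrable (fun x => ∫ y, F (x - y) ∂μ) μ := by
    refine Integrable.of_bound hmeas2 B (ae_of_all _ fun x => ?_)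
    rw [Real.norm_of_nonneg (integral_nonneg fun y => hF0 _)]
    calc _ ≤ ∫ _y, B ∂μ := integral_mono (hint x) (integrable_const _) fun y => hB _
      _ = B := by simp
  have hball (x : Torus d) : μ (Metric.closedBall x (1 / (16 * d * N))) ≤
      ENNReal.ofReal (4 / (N : ℝ) ^ (2 * d) * ∫ y, F (x - y) ∂μ) := by
    rw [← ofReal_measureReal]
    refine ENNReal.ofReal_le_ofReal ?_
    rw [← integral_indicator_one Metric.isClosed_closedBall.measurableSet, ← integral_const_mul]
    refine integral_mono ((integrable_const 1).indicator Metric.isClosed_closedBall.measurableSet)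
      ((hint x).const_mul _) fun y => ?_
    by_cases hy : y ∈ Metric.closedBall x (1 / (16 * d * N))
    · have hz : ‖x - y‖ ≤ 1 / (16 * d * N) := by
        rw [← dist_eq_norm, dist_comm]; exact hy
      have := quarter_le_normSq_sum_mFourier hN hd hz
      simp only [hy, indicator_of_mem, Pi.one_apply]
      rw [div_mul_eq_mul_div, le_div_iff₀ (by positivity)]
      simp only [hF]
      linarith
    · simp only [hy, not_false_eq_true, indicator_of_notMem]
      exact mul_nonneg (by positivity) (hF0 _)
  refine (lintegral_mono hball).trans ?_
  rw [← ofReal_integral_eq_lintegral_ofReal (hint2.const_mul _)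
    (ae_of_all _ fun x => mul_nonneg (by positivity) (integral_nonneg fun y => hF0 _)),
    integral_const_mul]
  refine ENNReal.ofReal_le_ofReal ?_
  calc _ ≤ 4 / (N : ℝ) ^ (2 * d) * (A * (N : ℝ) ^ (2 * d - t)) := by gcongr
    _ = _ := by
      have e : (2 * (d : ℝ) - t) = ((2 * d : ℕ) : ℝ) + (-t) := by push_cast; ring
      rw [e, Real.rpow_add hN0, Real.rpow_natCast]
      field_simp

theorem measurable_measure_closedBall (μ : Measure (Torus d)) [SFinite μ] (r : ℝ) :
    Measurable fun x => μ (Metric.closedBall x r) := by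
  have : MeasurableSet {p : Torus d × Torus d | dist p.2 p.1 ≤ r} :=
    measurableSet_le (by fun_prop) measurable_const
  exact measurable_measure_prodMk_left this

/-- A mass distribution principle: local dimension bounds on average imply dimension bounds. -/
theorem le_dimH_of_lintegral_closedBall_le {t t' A ρ : ℝ} (ht' : 0 < t') (htt : t' < t) (hρ : 0 < ρ)
    {μ : Measure (Torus d)} [IsProbabilityMeasure μ] {E : Set (Torus d)}
    (hE : μ Eᶜ = 0)
    (h : ∀ N : ℕ, 1 ≤ N → ∫⁻ x, μ (Metric.closedBall x (ρ / N)) ∂μ ≤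
      ENNReal.ofReal (A * (N : ℝ) ^ (-t))) :
    ENNReal.ofReal t' ≤ dimH E := by
  -- Weighted ball masses over dyadic scales. The integral of the sum is dominated by a geometric
  -- series of ratio `2^(t'-t) < 1`, so `g` is finite almost everywhere. On a sublevel set of
  -- positive measure `μ` then satisfies a Frostman condition of exponent `t'`.
  set g : Torus d → ℝ≥0∞ := fun x => ∑' k : ℕ,
    ENNReal.ofReal ((2 : ℝ) ^ (k * t')) * μ (Metric.closedBall x (ρ / (2 ^ k : ℕ))) with hg
  have hgm : Measurable g := Measurable.tsum fun k =>
    (measurable_measure_closedBall μ _).const_mul _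
  have hgint : ∫⁻ x, g x ∂μ ≠ ∞ := by
    rw [hg, lintegral_tsum fun k => ((measurable_measure_closedBall μ _).const_mul _).aemeasurable]
    have hterm (k : ℕ) : ∫⁻ x, ENNReal.ofReal ((2 : ℝ) ^ (k * t')) *
        μ (Metric.closedBall x (ρ / (2 ^ k : ℕ))) ∂μ ≤
          ENNReal.ofReal A * ENNReal.ofReal ((2 : ℝ) ^ (t' - t)) ^ k := by
      rw [lintegral_const_mul _ (measurable_measure_closedBall μ _)]
      refine (mul_le_mul_right (h (2 ^ k) Nat.one_le_two_pow) _).trans (le_of_eq ?_)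
      rw [ENNReal.ofReal_mul' (by positivity), mul_left_comm, ← ENNReal.ofReal_mul (by positivity),
        ← ENNReal.ofReal_pow (by positivity)]
      congr 2
      push_cast
      rw [← Real.rpow_natCast 2 k, ← Real.rpow_mul (by norm_num), ← Real.rpow_add (by norm_num),
        ← Real.rpow_mul_natCast (by norm_num)]
      ring_nf
    refine ne_top_of_le_ne_top ?_ (ENNReal.tsum_le_tsum hterm)
    rw [ENNReal.tsum_mul_left]
    refine ENNReal.mul_ne_top ENNReal.ofReal_ne_top ?_
    rw [ENNReal.tsum_geometric, ENNReal.inv_ne_top, Ne, tsub_eq_zero_iff_le, not_le, ← ENNReal.ofReal_one]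
    exact (ENNReal.ofReal_lt_ofReal_iff one_pos).mpr
      (Real.rpow_lt_one_of_one_lt_of_neg (by norm_num) (by linarith))
  have hae : ∀ᵐ x ∂μ, g x < ∞ := ae_lt_top hgm hgint
  obtain ⟨M, hM⟩ : ∃ M : ℕ, μ {x | g x ≤ M} ≠ 0 := by
    by_contra! hcon
    have hU : μ (⋃ M : ℕ, {x | g x ≤ M}) = 0 := measure_iUnion_null hcon
    have : ∀ᵐ x ∂μ, x ∈ ⋃ M : ℕ, {x | g x ≤ M} := by
      filter_upwards [hae] with x hx
      obtain ⟨M, hM⟩ := ENNReal.exists_nat_gt hx.ne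
      exact mem_iUnion.mpr ⟨M, hM.le⟩
    have h1 := prob_compl_eq_zero_iff₀ ((MeasurableSet.iUnion fun M : ℕ =>
      measurableSet_le hgm measurable_const).nullMeasurableSet) |>.mp this
    rw [hU] at h1
    exact zero_ne_one h1
  set G := {x | g x ≤ M}
  have hGm : MeasurableSet G := measurableSet_le hgm measurable_const
  have hball (x : Torus d) (hx : x ∈ G) (k : ℕ) :
      μ (Metric.closedBall x (ρ / (2 ^ k : ℕ))) ≤ M * ENNReal.ofReal ((2 : ℝ) ^ (-(k * t'))) := by
    have h1 : ENNReal.ofReal ((2 : ℝ) ^ (k * t')) * μ (Metric.closedBall x (ρ / (2 ^ k : ℕ))) ≤ M :=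
      (ENNReal.le_tsum k).trans hx
    have hpos : (0 : ℝ) < 2 ^ (k * t') := by positivity
    rw [Real.rpow_neg (by norm_num), ENNReal.ofReal_inv_of_pos hpos, ← div_eq_mul_inv]
    rw [ENNReal.le_div_iff_mul_le (Or.inl (by simpa using hpos)) (Or.inl ENNReal.ofReal_ne_top)]
    rwa [mul_comm]
  -- A set of diameter `D` is compared with the dyadic radius in `[D, 2D)`; this is where `2 / ρ`
  -- comes from.
  set C : ℝ≥0∞ := M * ENNReal.ofReal ((2 / ρ) ^ t') with hC
  have hCtop : C ≠ ∞ := ENNReal.mul_ne_top (ENNReal.natCast_ne_top _) ENNReal.ofReal_ne_top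
  have key (s : Set (Torus d)) (hs : Metric.ediam s ≤ ENNReal.ofReal (ρ / 2)) :
      μ.restrict G s ≤ C * Metric.ediam s ^ t' := by
    rw [Measure.restrict_apply' hGm]
    rcases (s ∩ G).eq_empty_or_nonempty with h0 | ⟨x, hxs, hxG⟩
    · simp [h0]
    have hfin : Metric.ediam s ≠ ∞ := ne_top_of_le_ne_top ENNReal.ofReal_ne_top hs
    set D := (Metric.ediam s).toReal with hD
    have hD' : Metric.ediam s = ENNReal.ofReal D := (ENNReal.ofReal_toReal hfin).symm
    have hD0 : 0 ≤ D := ENNReal.toReal_nonneg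
    have hDρ : D ≤ ρ / 2 := by
      rw [hD'] at hs; exact (ENNReal.ofReal_le_ofReal_iff (by positivity)).mp hs
    have hk (k : ℕ) (hk : D ≤ ρ / 2 ^ k) : μ (s ∩ G) ≤ M * ENNReal.ofReal ((2 : ℝ) ^ (-(k * t'))) := by
      refine (measure_mono fun y hy => ?_).trans (hball x hxG k)
      rw [Metric.mem_closedBall]
      push_cast
      refine le_trans ?_ hk
      rw [hD, dist_edist]
      exact ENNReal.toReal_mono hfin (Metric.edist_le_ediam_of_mem hy.1 hxs)
    -- Diameter zero has no comparable dyadic scale. Letting `k` tend to infinity shows that such a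
    -- set is null.
    rcases hD0.eq_or_lt with h0 | h0
    · have : μ (s ∩ G) ≤ 0 := by
        refine ge_of_tendsto' (x := atTop)
          (f := fun k : ℕ => (M : ℝ≥0∞) * ENNReal.ofReal ((2 : ℝ) ^ (-(k * t')))) ?_
          fun k => hk k (by rw [← h0]; positivity)
        rw [show (0 : ℝ≥0∞) = M * ENNReal.ofReal 0 by simp]
        refine ENNReal.Tendsto.const_mul (ENNReal.tendsto_ofReal ?_) (Or.inr (ENNReal.natCast_ne_top _))
        have : Tendsto (fun k : ℕ => ((2 : ℝ) ^ (-t')) ^ k) atTop (𝓝 0) :=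
          tendsto_pow_atTop_nhds_zero_of_lt_one (by positivity)
            (Real.rpow_lt_one_of_one_lt_of_neg (by norm_num) (by linarith))
        refine this.congr fun k => ?_
        rw [← Real.rpow_mul_natCast (by norm_num)]
        ring_nf
      exact this.trans bot_le
    · obtain ⟨k, hk1, hk2⟩ := exists_nat_pow_near_of_lt_one (y := (1 / 2 : ℝ)) (x := D / ρ) (by positivity)
        (by rw [div_le_one hρ]; linarith) (by norm_num) (by norm_num)
      rw [div_le_iff₀ hρ] at hk2
      refine (hk k (hk2.trans (le_of_eq (by rw [one_div, inv_pow]; field_simp)))).trans ?_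
      rw [hC, hD', ENNReal.ofReal_rpow_of_pos h0, mul_assoc, ← ENNReal.ofReal_mul (by positivity)]
      gcongr
      rw [← Real.mul_rpow (by positivity) h0.le, ← neg_mul, Real.rpow_mul (by norm_num)]
      refine Real.rpow_le_rpow (by positivity) ?_ ht'.le
      rw [Real.rpow_neg (by norm_num), Real.rpow_natCast]
      rw [pow_succ, one_div, inv_pow] at hk1
      calc ((2 : ℝ) ^ k)⁻¹ = 2 * (((2 : ℝ) ^ k)⁻¹ * 2⁻¹) := by ring
        _ ≤ 2 * (D / ρ) := by gcongr
        _ = 2 / ρ * D := by ring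
  have hfinal : C⁻¹ • μ.restrict G ≤ μH[t'] := by
    refine Measure.le_hausdorffMeasure t' _ (ENNReal.ofReal (ρ / 2)) (by simpa using hρ) fun s hs => ?_
    rw [Measure.smul_apply, smul_eq_mul]
    calc C⁻¹ * μ.restrict G s ≤ C⁻¹ * (C * Metric.ediam s ^ t') := by gcongr; exact key s hs
      _ = (C⁻¹ * C) * Metric.ediam s ^ t' := by ring
      _ ≤ 1 * Metric.ediam s ^ t' := by gcongr; exact ENNReal.inv_mul_le_one C
      _ = _ := one_mul _
  refine le_dimH_of_hausdorffMeasure_ne_zero (d := t'.toNNReal) ?_ |>.trans' (le_of_eq rfl)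
  rw [Real.coe_toNNReal _ ht'.le]
  have hGE : (C⁻¹ • μ.restrict G) E ≤ μH[t'] E := hfinal E
  intro h0
  rw [h0, Measure.smul_apply, Measure.restrict_apply' hGm, smul_eq_mul, nonpos_iff_eq_zero, mul_eq_zero, inter_comm,
    measure_inter_conull hE] at hGE
  rcases hGE with h1 | h1
  · exact hCtop (ENNReal.inv_eq_zero.mp h1)
  · exact hM h1

/-- Two intermediate exponents `t' < t < s` are used: `t < d` keeps the lattice sums of power type,
and `t' < t` makes the dyadic sum converge. -/
theorem le_dimH_of_hasFourierDecay {s : ℝ} (hsd : s ≤ d)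
    {μ : Measure (Torus d)} [IsProbabilityMeasure μ] (h : HasFourierDecay s μ) {E : Set (Torus d)}
    (hE : μ Eᶜ = 0) : ENNReal.ofReal s ≤ dimH E := by
  refine le_of_forall_lt fun c hc => ?_
  lift c to ℝ≥0 using hc.ne_top
  have hcs : (c : ℝ) < s := by
    rw [← ENNReal.ofReal_coe_nnreal] at hc
    exact (ENNReal.ofReal_lt_ofReal_iff_of_nonneg c.2).mp hc
  obtain ⟨t', h1, h2⟩ := exists_between hcs
  obtain ⟨t, h3, h4⟩ := exists_between h2
  have ht' : 0 < t' := c.2.trans_lt h1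
  have hd : (0 : ℝ) < d := by linarith
  obtain ⟨A, -, hA⟩ := lintegral_measure_closedBall_le h (ht'.trans h3) h4.le (h4.trans_le hsd)
  refine lt_of_lt_of_le ?_ (le_dimH_of_lintegral_closedBall_le (A := A) (ρ := 1 / (16 * d)) ht' h3
    (by positivity) hE fun N hN => ?_)
  · rw [← ENNReal.ofReal_coe_nnreal]
    exact (ENNReal.ofReal_lt_ofReal_iff ht').mpr h1
  · rw [div_div]; exact hA N hN

theorem fourierDim_le_dimH (E : Set (Torus d)) : fourierDim E ≤ dimH E := by
  refine iSup₂_le fun μ hμ => iSup_le fun s => iSup₂_le fun hs h => ?_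
  rw [← ENNReal.ofReal_coe_nnreal]
  exact le_dimH_of_hasFourierDecay hs h
    (measure_mono_null (compl_subset_compl.mpr hμ) Measure.measure_compl_support)

theorem le_fourierDim {β : ℝ} (hβ : β ≤ d) {E : Set (Torus d)} (μ : ProbabilityMeasure (Torus d))
    (hμ : (μ : Measure (Torus d)).support ⊆ E)
    (h : ∀ t ∈ Ico (0 : ℝ) β, HasFourierDecay t (μ : Measure (Torus d))) :
    ENNReal.ofReal β ≤ fourierDim E := by
  refine le_of_forall_lt fun c hc => ?_
  obtain ⟨s, h1, h2⟩ := exists_between hc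
  lift s to ℝ≥0 using h2.ne_top
  have hcs : (s : ℝ) < β := by
    rw [← ENNReal.ofReal_coe_nnreal] at h2
    exact (ENNReal.ofReal_lt_ofReal_iff_of_nonneg s.2).mp h2
  refine h1.trans_le ?_
  refine le_trans ?_ (le_iSup₂_of_le μ hμ le_rfl)
  exact le_iSup_of_le s (le_iSup₂_of_le (hcs.le.trans hβ) (h s ⟨s.2, hcs⟩) le_rfl)

end EnergyDimension

/-! ### McDiarmid's inequality -/

section BoundedDifferences

variable {Ω : Type*} [MeasurableSpace Ω]

/-- `G` changes by at most `c` when a single coordinate is changed. -/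
def BoundedDifferences {M : ℕ} (c : ℝ) (G : (Fin M → Ω) → ℝ) : Prop :=
  ∀ (X X' : Fin M → Ω) (k : Fin M), (∀ j, j ≠ k → X j = X' j) → |G X - G X'| ≤ c

/-- Hoeffding's lemma on the interval of length `2c` centred at one value of `g`. Centring costs a
factor in the exponent but avoids extrema of `g`. -/
theorem integral_exp_sub_integral_le (P : Measure Ω) [IsProbabilityMeasure P] {c : ℝ} {g : Ω → ℝ}
    (hg : Measurable g) (h : ∀ x x', |g x - g x'| ≤ c) (s : ℝ) :
    ∫ x, Real.exp (s * (g x - ∫ y, g y ∂P)) ∂P ≤ Real.exp (s ^ 2 * c ^ 2 / 2) := by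
  have : Nonempty Ω := nonempty_of_isProbabilityMeasure P
  obtain ⟨x₀⟩ := this
  have hsub := ProbabilityTheory.hasSubgaussianMGF_of_mem_Icc (μ := P) (X := g) (a := g x₀ - c)
    (b := g x₀ + c) hg.aemeasurable (ae_of_all _ fun x => by
      have := abs_le.mp (h x x₀)
      constructor <;> linarith)
  have := hsub.mgf_le s
  rw [ProbabilityTheory.mgf] at this
  refine this.trans (Real.exp_le_exp.mpr (le_of_eq ?_))
  push_cast
  rw [Real.norm_eq_abs, div_pow, sq_abs]
  ring

theorem integrable_of_bounded (P : Measure Ω) [IsFiniteMeasure P] {g : Ω → ℝ} (hg : Measurable g)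
    {B : ℝ} (h : ∀ x, |g x| ≤ B) : Integrable g P :=
  Integrable.of_bound hg.aestronglyMeasurable B (ae_of_all _ fun x => h x)

theorem abs_integral_le_of_bounded (P : Measure Ω) [IsProbabilityMeasure P] {g : Ω → ℝ} {B : ℝ}
    (h : ∀ x, |g x| ≤ B) : |∫ x, g x ∂P| ≤ B := by
  have := norm_integral_le_of_norm_le_const (μ := P) (f := g) (C := B) (ae_of_all _ fun x => h x)
  simpa using this

theorem abs_exp_mul_sub_le {s u v B : ℝ} (hu : |u| ≤ B) (hv : |v| ≤ B) :
    |Real.exp (s * (u - v))| ≤ Real.exp (|s| * (2 * B)) := by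
  rw [Real.abs_exp]
  refine Real.exp_le_exp.mpr ((le_abs_self _).trans ?_)
  rw [abs_mul]
  gcongr
  exact (abs_sub _ _).trans (by linarith)

/-- McDiarmid's inequality for the moment generating function. -/
theorem integral_exp_le_of_boundedDifferences (P : Measure Ω) [IsProbabilityMeasure P] {c : ℝ}
    (s : ℝ) (M : ℕ) : ∀ (G : (Fin M → Ω) → ℝ), Measurable G → ∀ B : ℝ, (∀ X, |G X| ≤ B) →
      BoundedDifferences c G →
      ∫ X, Real.exp (s * (G X - ∫ Y, G Y ∂Measure.pi fun _ => P)) ∂(Measure.pi fun _ => P) ≤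
        Real.exp (M * (s ^ 2 * c ^ 2 / 2)) := by
  induction M with
  | zero =>
    intro G hG B hB hc
    have hconst (X : Fin 0 → Ω) : G X = G default := by rw [Subsingleton.elim X default]
    simp only [hconst]
    simp
  | succ M ih =>
    intro G hG B hB hc
    set π := Measure.pi fun _ : Fin M => P
    have hmp := (measurePreserving_piFinSuccAbove (fun _ : Fin (M + 1) => P) 0).symm
    set e := (MeasurableEquiv.piFinSuccAbove (fun _ : Fin (M + 1) => Ω) 0).symm
    have hcons (x : Ω) (y : Fin M → Ω) : e (x, y) = Fin.cons x y :=
      Fin.insertNth_zero' x y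
    have htrans (H : (Fin (M + 1) → Ω) → ℝ) :
        ∫ X, H X ∂(Measure.pi fun _ => P) = ∫ p, H (e p) ∂(P.prod π) :=
      (hmp.integral_comp' H).symm
    -- Averaging over the first coordinate leaves a function `Φ` of the others that again has
    -- bounded differences. Hoeffding's lemma in the first coordinate bounds the deviation from `Φ`,
    -- and induction bounds the deviation of `Φ` from its mean.
    set Φ : (Fin M → Ω) → ℝ := fun y => ∫ x, G (e (x, y)) ∂P with hΦ
    have hGe : Measurable fun p : Ω × (Fin M → Ω) => G (e p) := hG.comp e.measurable
    have hΦm : Measurable Φ :=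
      (hGe.stronglyMeasurable.integral_prod_left (μ := P)).measurable
    have hΦB (y) : |Φ y| ≤ B := abs_integral_le_of_bounded P fun x => hB _
    have hΦc : BoundedDifferences c Φ := by
      intro y y' k hk
      have hi (y : Fin M → Ω) : Integrable (fun x => G (e (x, y))) P :=
        integrable_of_bounded P (hGe.comp measurable_prodMk_right) fun x => hB _
      simp only [hΦ]
      rw [← integral_sub (hi y) (hi y')]
      refine abs_integral_le_of_bounded P fun x => hc _ _ k.succ fun j hj => ?_
      rw [hcons, hcons]
      refine Fin.cases (fun _ => rfl) (fun j hj => ?_) j hj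
      exact hk j fun h => hj (by rw [h])
    have hE : ∫ X, G X ∂(Measure.pi fun _ => P) = ∫ y, Φ y ∂π := by
      rw [htrans, integral_prod_symm _ (integrable_of_bounded _ hGe fun _ => hB _)]
    rw [htrans, hE]
    set E := ∫ y, Φ y ∂π
    have hEB : |E| ≤ B := abs_integral_le_of_bounded π hΦB
    have hm : Measurable fun p : Ω × (Fin M → Ω) => Real.exp (s * (G (e p) - E)) :=
      Real.measurable_exp.comp ((hGe.sub_const _).const_mul _)
    rw [integral_prod_symm _ (integrable_of_bounded _ hm fun p => abs_exp_mul_sub_le (hB _) hEB)]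
    have hinner (y : Fin M → Ω) : ∫ x, Real.exp (s * (G (e (x, y)) - E)) ∂P ≤
        Real.exp (s ^ 2 * c ^ 2 / 2) * Real.exp (s * (Φ y - E)) := by
      have h1 := integral_exp_sub_integral_le P (c := c) (g := fun x => G (e (x, y)))
        (hGe.comp measurable_prodMk_right)
        (fun x x' => hc _ _ 0 fun j hj => by
          rw [hcons, hcons]
          obtain ⟨j, rfl⟩ := Fin.exists_succ_eq.mpr hj
          rfl) s
      calc _ = ∫ x, Real.exp (s * (G (e (x, y)) - Φ y)) * Real.exp (s * (Φ y - E)) ∂P := by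
            congr 1; ext x; rw [← Real.exp_add]; ring_nf
        _ ≤ _ := by
            rw [integral_mul_const]
            exact mul_le_mul_of_nonneg_right h1 (Real.exp_nonneg _)
    have hm' : Measurable fun y => Real.exp (s * (Φ y - E)) :=
      Real.measurable_exp.comp ((hΦm.sub_const _).const_mul _)
    calc _ ≤ ∫ y, Real.exp (s ^ 2 * c ^ 2 / 2) * Real.exp (s * (Φ y - E)) ∂π := by
          refine integral_mono ?_ ((integrable_of_bounded π hm' fun y =>
            abs_exp_mul_sub_le (hΦB _) hEB).const_mul _) hinner
          exact integrable_of_bounded π (hm.stronglyMeasurable.integral_prod_left (μ := P)).measurable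
            fun y => abs_integral_le_of_bounded P fun x => abs_exp_mul_sub_le (hB _) hEB
      _ ≤ Real.exp (s ^ 2 * c ^ 2 / 2) * Real.exp (M * (s ^ 2 * c ^ 2 / 2)) := by
          rw [integral_const_mul]
          exact mul_le_mul_of_nonneg_left (ih Φ hΦm B hΦB hΦc) (Real.exp_nonneg _)
      _ = _ := by
          rw [← Real.exp_add]
          push_cast
          ring_nf

/-- A union bound without probabilities: some `X` makes the sum of all exponentials of `± s` times
the deviations at most its mean, hence at most `exp (s a)`. Each summand, being positive, obeys the
same bound. -/
theorem exists_forall_abs_sub_integral_le (P : Measure Ω) [IsProbabilityMeasure P] {c s a B : ℝ}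
    (hs : 0 < s) {M : ℕ} {ι : Type*} [Fintype ι] (G : ι → (Fin M → Ω) → ℝ)
    (hG : ∀ i, Measurable (G i)) (hB : ∀ i X, |G i X| ≤ B) (hc : ∀ i, BoundedDifferences c (G i))
    (ha : 2 * Fintype.card ι * Real.exp (M * (s ^ 2 * c ^ 2 / 2)) ≤ Real.exp (s * a)) :
    ∃ X, ∀ i, |G i X - ∫ Y, G i Y ∂(Measure.pi fun _ => P)| ≤ a := by
  set π := Measure.pi fun _ : Fin M => P
  have hEB (i) : |∫ Y, G i Y ∂π| ≤ B := abs_integral_le_of_bounded π (hB i)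
  have hm (σ : ℝ) (i) : Measurable fun X => Real.exp (σ * (G i X - ∫ Y, G i Y ∂π)) :=
    Real.measurable_exp.comp (((hG i).sub_const _).const_mul _)
  have hint (σ : ℝ) (i) : Integrable (fun X => Real.exp (σ * (G i X - ∫ Y, G i Y ∂π))) π :=
    integrable_of_bounded π (hm σ i) fun X => abs_exp_mul_sub_le (hB i X) (hEB i)
  obtain ⟨X, hX⟩ := exists_le_integral (μ := π) (f := fun X => ∑ i,
      (Real.exp (s * (G i X - ∫ Y, G i Y ∂π)) + Real.exp (-s * (G i X - ∫ Y, G i Y ∂π))))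
    (integrable_finsetSum _ fun i _ => (hint s i).add (hint (-s) i))
  refine ⟨X, fun i => ?_⟩
  rw [integral_finsetSum (f := fun i X => Real.exp (s * (G i X - ∫ Y, G i Y ∂π)) +
    Real.exp (-s * (G i X - ∫ Y, G i Y ∂π))) _ fun i _ => (hint s i).add (hint (-s) i)] at hX
  have hle (σ : ℝ) (hσ : σ ^ 2 = s ^ 2) (i) :
      ∫ X, Real.exp (σ * (G i X - ∫ Y, G i Y ∂π)) ∂π ≤ Real.exp (M * (s ^ 2 * c ^ 2 / 2)) := by
    rw [← hσ]
    exact integral_exp_le_of_boundedDifferences P σ M (G i) (hG i) B (hB i) (hc i)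
  have hsum : ∑ i, ∫ X, (Real.exp (s * (G i X - ∫ Y, G i Y ∂π)) +
      Real.exp (-s * (G i X - ∫ Y, G i Y ∂π))) ∂π ≤ Real.exp (s * a) := by
    refine le_trans ?_ ha
    calc _ ≤ ∑ _i : ι, (2 * Real.exp (M * (s ^ 2 * c ^ 2 / 2))) := by
          refine Finset.sum_le_sum fun i _ => ?_
          rw [integral_add (hint s i) (hint (-s) i)]
          linarith [hle s rfl i, hle (-s) (neg_sq s) i]
      _ = _ := by simp; ring
  have hXi := (Finset.single_le_sum (f := fun i => Real.exp (s * (G i X - ∫ Y, G i Y ∂π)) +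
    Real.exp (-s * (G i X - ∫ Y, G i Y ∂π))) (fun _ _ => by positivity) (Finset.mem_univ i)).trans
    (hX.trans hsum)
  have h1 : s * (G i X - ∫ Y, G i Y ∂π) ≤ s * a :=
    Real.exp_le_exp.mp (by linarith [Real.exp_pos (-s * (G i X - ∫ Y, G i Y ∂π))])
  have h2 : -s * (G i X - ∫ Y, G i Y ∂π) ≤ s * a :=
    Real.exp_le_exp.mp (by linarith [Real.exp_pos (s * (G i X - ∫ Y, G i Y ∂π))])
  rw [abs_le]
  constructor
  · have : s * (-a) ≤ s * (G i X - ∫ Y, G i Y ∂π) := by linarith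
    exact le_of_mul_le_mul_left this hs
  · exact le_of_mul_le_mul_left h1 hs

end BoundedDifferences

/-! ### Random discretisation outside `Q`, weighted density on `Q` -/

section RandomMeasure

variable {d : ℕ}

/-- The functional `h ↦ M⁻¹ ∑ₖ (f 1_{Qᶜ} h)(Xₖ) + ∫ f 1_Q q h`. -/
noncomputable def sampleFunctional {M : ℕ} (f : Torus d → ℝ) (Q : Set (Torus d))
    (q : (Fin M → Torus d) → Torus d → ℝ) (h : Torus d → ℝ) (X : Fin M → Torus d) : ℝ :=
  (M : ℝ)⁻¹ * ∑ k, Qᶜ.indicator f (X k) * h (X k) + ∫ x, Q.indicator f x * q X x * h x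

/-- The measure whose integrals are given by `sampleFunctional`. -/
noncomputable def sampleMeasure {M : ℕ} (f : Torus d → ℝ) (Q : Set (Torus d))
    (q : (Fin M → Torus d) → Torus d → ℝ) (X : Fin M → Torus d) : Measure (Torus d) :=
  ∑ k, ENNReal.ofReal ((M : ℝ)⁻¹ * Qᶜ.indicator f (X k)) • Measure.dirac (X k) +
    volume.withDensity fun x => ENNReal.ofReal (Q.indicator f x * q X x)

variable {M : ℕ} {f : Torus d → ℝ} {Q : Set (Torus d)} {q : (Fin M → Torus d) → Torus d → ℝ} {L : ℝ}

theorem indicator_nonneg_le (h0 : ∀ x, 0 ≤ f x) (hL : ∀ x, f x ≤ L) (Q : Set (Torus d)) (x : Torus d) :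
    0 ≤ Q.indicator f x ∧ Q.indicator f x ≤ L := by
  by_cases hx : x ∈ Q
  · simp [hx, h0, hL]
  · simp [hx, (h0 x).trans (hL x)]

theorem sampleMeasure_isFiniteMeasure (h0 : ∀ x, 0 ≤ f x) (hL : ∀ x, f x ≤ L)
    (hq0 : ∀ X x, 0 ≤ q X x) (hq2 : ∀ X x, q X x ≤ 2) (X : Fin M → Torus d) :
    IsFiniteMeasure (sampleMeasure f Q q X) := by
  have h1 : IsFiniteMeasure (volume.withDensity fun x => ENNReal.ofReal (Q.indicator f x * q X x)) := by
    refine isFiniteMeasure_withDensity (ne_top_of_le_ne_top ?_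
      (lintegral_mono (g := fun _ => ENNReal.ofReal (L * 2)) fun x => ENNReal.ofReal_le_ofReal ?_))
    · simp
    · obtain ⟨h3, h4⟩ := indicator_nonneg_le h0 hL Q x
      exact mul_le_mul h4 (hq2 X x) (hq0 X x) (h3.trans h4)
  have h2 (k : Fin M) : IsFiniteMeasure
      (ENNReal.ofReal ((M : ℝ)⁻¹ * Qᶜ.indicator f (X k)) • Measure.dirac (X k)) :=
    Measure.smul_finite _ ENNReal.ofReal_ne_top
  unfold sampleMeasure
  infer_instance

theorem integral_sampleMeasure (hf : Measurable f) (h0 : ∀ x, 0 ≤ f x) (hL : ∀ x, f x ≤ L)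
    (hQ : MeasurableSet Q) (hq : Measurable (Function.uncurry q)) (hq0 : ∀ X x, 0 ≤ q X x)
    (hq2 : ∀ X x, q X x ≤ 2) {h : Torus d → ℝ} (hh : Measurable h) (hh1 : ∀ x, |h x| ≤ 1)
    (X : Fin M → Torus d) :
    ∫ x, h x ∂(sampleMeasure f Q q X) = sampleFunctional f Q q h X := by
  have hfin := sampleMeasure_isFiniteMeasure (Q := Q) h0 hL hq0 hq2 X
  have hint := integrable_of_bounded (sampleMeasure f Q q X) hh hh1
  have hqX : Measurable (q X) := hq.comp measurable_prodMk_left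
  rw [sampleMeasure] at hint ⊢
  rw [integral_add_measure hint.left_of_add_measure hint.right_of_add_measure, sampleFunctional]
  congr 1
  · rw [integral_finsetSum_measure, Finset.mul_sum]
    · refine Finset.sum_congr rfl fun k _ => ?_
      rw [integral_smul_measure, integral_dirac, ENNReal.toReal_ofReal
        (mul_nonneg (by positivity) (indicator_nonneg_le h0 hL _ _).1), smul_eq_mul, mul_assoc]
    · intro k _
      exact (integrable_of_bounded _ hh hh1).smul_measure ENNReal.ofReal_ne_top
  · rw [integral_withDensity_eq_integral_toReal_smul]
    · refine integral_congr_ae (ae_of_all _ fun x => ?_)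
      simp only
      rw [ENNReal.toReal_ofReal (mul_nonneg (indicator_nonneg_le h0 hL _ _).1 (hq0 X x)), smul_eq_mul]
    · exact ENNReal.measurable_ofReal.comp ((hf.indicator hQ).mul hqX)
    · exact ae_of_all _ fun x => ENNReal.ofReal_lt_top

/-- The error splits into fluctuation, at most `a` by concentration, and bias, at most `L * b`. Only
the weight `q` causes bias, since sampling outside `Q` is unbiased. -/
theorem exists_sample (hM : 1 ≤ M) (hf : Measurable f) (h0 : ∀ x, 0 ≤ f x) (hL : ∀ x, f x ≤ L)
    (hQ : MeasurableSet Q) (hq : Measurable (Function.uncurry q)) (hq0 : ∀ X x, 0 ≤ q X x)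
    (hq2 : ∀ X x, q X x ≤ 2) {D b : ℝ}
    (hD : ∀ (X X' : Fin M → Torus d) (k : Fin M), (∀ j, j ≠ k → X j = X' j) →
      ∫ x, |q X x - q X' x| ≤ D / M)
    (hb : ∫ x, |∫ X, q X x ∂(Measure.pi fun _ => volume) - 1| ≤ b)
    {ι : Type*} [Fintype ι] (h : ι → Torus d → ℝ) (hh : ∀ i, Measurable (h i))
    (hh1 : ∀ i x, |h i x| ≤ 1) {a : ℝ}
    (ha : 2 * Fintype.card ι * Real.exp ((L * (2 + D)) ^ 2 / 2) ≤ Real.exp (Real.sqrt M * a)) :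
    ∃ X : Fin M → Torus d, ∀ i, |sampleFunctional f Q q (h i) X - ∫ x, f x * h i x| ≤ a + L * b := by
  have hM0 : (0 : ℝ) < M := by exact_mod_cast hM
  set π := Measure.pi fun _ : Fin M => (volume : Measure (Torus d))
  have hL0 : 0 ≤ L := (h0 0).trans (hL 0)
  have hI0 (x) := (indicator_nonneg_le h0 hL Q x).1
  have hIL (x) := (indicator_nonneg_le h0 hL Q x).2
  have hJ0 (x) := (indicator_nonneg_le h0 hL Qᶜ x).1
  have hJL (x) := (indicator_nonneg_le h0 hL Qᶜ x).2
  have hIm : Measurable (Q.indicator f) := hf.indicator hQ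
  have hJm : Measurable (Qᶜ.indicator f) := hf.indicator hQ.compl
  have hJB (i x) : |Qᶜ.indicator f x * h i x| ≤ L := by
    rw [abs_mul, abs_of_nonneg (hJ0 x)]
    calc _ ≤ L * 1 := by gcongr <;> [exact hJL x; exact hh1 i x]
      _ = L := mul_one L
  have hIB (i X x) : |Q.indicator f x * q X x * h i x| ≤ 2 * L := by
    rw [abs_mul, abs_mul, abs_of_nonneg (hI0 x), abs_of_nonneg (hq0 X x)]
    calc _ ≤ L * 2 * 1 := by gcongr <;> [exact hq0 X x; exact hIL x; exact hq2 X x; exact hh1 i x]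
      _ = 2 * L := by ring
  have hIIm (i) : Measurable fun p : (Fin M → Torus d) × Torus d =>
      Q.indicator f p.2 * q p.1 p.2 * h i p.2 :=
    ((hIm.comp measurable_snd).mul hq).mul ((hh i).comp measurable_snd)
  have hqX (X) : Measurable (q X) := hq.comp measurable_prodMk_left
  have hsumB (i) (X : Fin M → Torus d) : |∑ k, Qᶜ.indicator f (X k) * h i (X k)| ≤ M * L := by
    refine (Finset.abs_sum_le_sum_abs _ _).trans ((Finset.sum_le_card_nsmul _ _ L fun k _ =>
      hJB i (X k)).trans (le_of_eq ?_))
    simp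
  have hGm (i) : Measurable (sampleFunctional f Q q (h i)) := by
    refine (Measurable.const_mul (Finset.measurable_sum _ fun k _ =>
      (hJm.mul (hh i)).comp (measurable_pi_apply k)) _).add ?_
    exact ((hIIm i).stronglyMeasurable.integral_prod_right (ν := volume)).measurable
  have hGB (i X) : |sampleFunctional f Q q (h i) X| ≤ 3 * L := by
    refine (abs_add_le _ _).trans ?_
    have h1 : |(M : ℝ)⁻¹ * ∑ k, Qᶜ.indicator f (X k) * h i (X k)| ≤ L := by
      rw [abs_mul, abs_of_pos (by positivity), inv_mul_le_iff₀ hM0]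
      exact hsumB i X
    have h2 := abs_integral_le_of_bounded volume (hIB i X)
    linarith
  -- Replacing one sample point changes its own term by at most `2L / M` and the weight `q` by `D /
  -- M` in `L¹`.
  have hGc (i) : BoundedDifferences (L * (2 + D) / M) (sampleFunctional f Q q (h i)) := by
    intro X X' k hk
    have h1 : ∑ j, Qᶜ.indicator f (X j) * h i (X j) - ∑ j, Qᶜ.indicator f (X' j) * h i (X' j) =
        Qᶜ.indicator f (X k) * h i (X k) - Qᶜ.indicator f (X' k) * h i (X' k) := by
      rw [← Finset.sum_sub_distrib]
      refine Finset.sum_eq_single k (fun j _ hj => by rw [hk j hj, sub_self]) (by simp)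
    have h2 : |(∫ x, Q.indicator f x * q X x * h i x) - ∫ x, Q.indicator f x * q X' x * h i x| ≤
        L * (D / M) := by
      have hi (X : Fin M → Torus d) : Integrable (fun x => Q.indicator f x * q X x * h i x) volume :=
        integrable_of_bounded _ ((hIIm i).comp measurable_prodMk_left) (hIB i X)
      rw [← integral_sub (hi X) (hi X')]
      calc _ ≤ ∫ x, L * |q X x - q X' x| := by
            rw [← Real.norm_eq_abs]
            refine norm_integral_le_of_norm_le (Integrable.const_mul ?_ _) (ae_of_all _ fun x => ?_)
            · refine integrable_of_bounded (B := 4) _ ((hqX X).sub (hqX X')).abs fun x => ?_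
              rw [abs_abs, abs_le]
              constructor <;> linarith [hq0 X x, hq0 X' x, hq2 X x, hq2 X' x]
            · rw [← sub_mul, ← mul_sub, Real.norm_eq_abs, abs_mul, abs_mul, abs_of_nonneg (hI0 x)]
              calc _ ≤ L * |q X x - q X' x| * 1 := by gcongr <;> [exact hIL x; exact hh1 i x]
                _ = _ := mul_one _
        _ ≤ _ := by rw [integral_const_mul]; gcongr; exact hD X X' k hk
    have h3 : |Qᶜ.indicator f (X k) * h i (X k) - Qᶜ.indicator f (X' k) * h i (X' k)| ≤ 2 * L :=
      (abs_sub _ _).trans (by linarith [hJB i (X k), hJB i (X' k)])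
    have h4 : sampleFunctional f Q q (h i) X - sampleFunctional f Q q (h i) X' =
        (M : ℝ)⁻¹ * (Qᶜ.indicator f (X k) * h i (X k) - Qᶜ.indicator f (X' k) * h i (X' k)) +
        ((∫ x, Q.indicator f x * q X x * h i x) - ∫ x, Q.indicator f x * q X' x * h i x) := by
      rw [← h1]; simp only [sampleFunctional]; ring
    rw [h4]
    refine (abs_add_le _ _).trans ?_
    rw [abs_mul, abs_of_pos (by positivity : 0 < (M : ℝ)⁻¹)]
    calc _ ≤ (M : ℝ)⁻¹ * (2 * L) + L * (D / M) := by gcongr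
      _ = _ := by field_simp
  have hmean (i) : |∫ X, sampleFunctional f Q q (h i) X ∂π - ∫ x, f x * h i x| ≤ L * b := by
    have hi1 : Integrable (fun X : Fin M → Torus d => (M : ℝ)⁻¹ * ∑ k, Qᶜ.indicator f (X k) * h i (X k)) π := by
      refine Integrable.const_mul (integrable_of_bounded (B := M * L) _ (Finset.measurable_sum _
        fun k _ => (hJm.mul (hh i)).comp (measurable_pi_apply k)) (hsumB i)) _
    have hi2 : Integrable (fun X => ∫ x, Q.indicator f x * q X x * h i x) π :=
      integrable_of_bounded (B := 2 * L) _
        ((hIIm i).stronglyMeasurable.integral_prod_right (ν := volume)).measurable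
        fun X => abs_integral_le_of_bounded volume (hIB i X)
    have e1 : ∫ X, (M : ℝ)⁻¹ * ∑ k, Qᶜ.indicator f (X k) * h i (X k) ∂π =
        ∫ x, Qᶜ.indicator f x * h i x := by
      rw [integral_const_mul, integral_finsetSum (f := fun k (X : Fin M → Torus d) =>
        Qᶜ.indicator f (X k) * h i (X k)) _ fun k _ => integrable_of_bounded (B := L) _
        ((hJm.mul (hh i)).comp (measurable_pi_apply k)) fun X => hJB i (X k)]
      have (k : Fin M) : ∫ X, Qᶜ.indicator f (X k) * h i (X k) ∂π = ∫ x, Qᶜ.indicator f x * h i x := by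
        have hmp := measurePreserving_eval (fun _ : Fin M => (volume : Measure (Torus d))) k
        have := integral_map (μ := π) hmp.measurable.aemeasurable
          (f := fun x => Qᶜ.indicator f x * h i x) (hJm.mul (hh i)).aestronglyMeasurable
        rw [hmp.map_eq] at this
        exact this.symm
      simp only [this]
      simp
      field_simp
    have e2 : ∫ X, (∫ x, Q.indicator f x * q X x * h i x) ∂π =
        ∫ x, Q.indicator f x * (∫ X, q X x ∂π) * h i x := by
      rw [integral_integral_swap (f := fun X x => Q.indicator f x * q X x * h i x)
        (integrable_of_bounded (B := 2 * L) _ (hIIm i) fun p => hIB i p.1 p.2)]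
      congr 1
      ext x
      rw [integral_mul_const, integral_const_mul]
    have hEm : Measurable fun x => ∫ X, q X x ∂π :=
      (hq.stronglyMeasurable.integral_prod_left (μ := π)).measurable
    have hE0 (x) : 0 ≤ ∫ X, q X x ∂π := integral_nonneg fun X => hq0 X x
    have hE2 (x) : |∫ X, q X x ∂π| ≤ 2 := abs_integral_le_of_bounded π fun X => by
      rw [abs_of_nonneg (hq0 X x)]; exact hq2 X x
    have e3 : ∫ x, f x * h i x = (∫ x, Qᶜ.indicator f x * h i x) + ∫ x, Q.indicator f x * h i x := by
      rw [← integral_add (f := fun x => Qᶜ.indicator f x * h i x)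
        (integrable_of_bounded (B := L) _ (hJm.mul (hh i)) (hJB i))]
      · congr 1
        ext x
        rw [← add_mul, Set.indicator_compl_add_self_apply]
      · refine integrable_of_bounded (B := L) _ (hIm.mul (hh i)) fun x => ?_
        rw [abs_mul, abs_of_nonneg (hI0 x)]
        calc _ ≤ L * 1 := by gcongr <;> [exact hIL x; exact hh1 i x]
          _ = L := mul_one L
    have e4 : ∫ X, sampleFunctional f Q q (h i) X ∂π = (∫ x, Qᶜ.indicator f x * h i x) +
        ∫ x, Q.indicator f x * (∫ X, q X x ∂π) * h i x := by
      rw [← e1, ← e2, ← integral_add hi1 hi2]; rfl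
    rw [e4, e3, add_sub_add_left_eq_sub, ← integral_sub]
    · calc _ ≤ ∫ x, L * |∫ X, q X x ∂π - 1| := by
            rw [← Real.norm_eq_abs]
            refine norm_integral_le_of_norm_le (Integrable.const_mul ?_ _) (ae_of_all _ fun x => ?_)
            · refine integrable_of_bounded (B := 3) _ (hEm.sub_const 1).abs fun x => ?_
              rw [abs_abs]
              exact (abs_sub _ _).trans (by rw [abs_one]; linarith [hE2 x])
            · rw [← sub_mul, Real.norm_eq_abs, abs_mul, show Q.indicator f x * ∫ X, q X x ∂π = Q.indicator f x * (∫ X, q X x ∂π) from rfl,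
                ← mul_sub_one, abs_mul, abs_of_nonneg (hI0 x)]
              calc _ ≤ L * |∫ X, q X x ∂π - 1| * 1 := by gcongr <;> [exact hIL x; exact hh1 i x]
                _ = _ := mul_one _
        _ ≤ _ := by rw [integral_const_mul]; gcongr
    · refine integrable_of_bounded (B := 2 * L) _ ((hIm.mul hEm).mul (hh i)) fun x => ?_
      rw [abs_mul, abs_mul, abs_of_nonneg (hI0 x)]
      calc _ ≤ L * 2 * 1 := by gcongr <;> [exact hIL x; exact hE2 x; exact hh1 i x]
        _ = 2 * L := by ring
    · refine integrable_of_bounded (B := L) _ (hIm.mul (hh i)) fun x => ?_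
      rw [abs_mul, abs_of_nonneg (hI0 x)]
      calc _ ≤ L * 1 := by gcongr <;> [exact hIL x; exact hh1 i x]
        _ = L := mul_one L
  -- With `s = √M` and differences of order `1 / M`, the exponent in McDiarmid's bound does not
  -- depend on `M`.
  obtain ⟨X, hX⟩ := exists_forall_abs_sub_integral_le volume (s := Real.sqrt M) (a := a)
    (Real.sqrt_pos.mpr hM0) (fun i => sampleFunctional f Q q (h i)) hGm hGB hGc (by
      refine le_trans (le_of_eq ?_) ha
      congr 2
      rw [Real.sq_sqrt hM0.le]
      field_simp)
  refine ⟨X, fun i => ?_⟩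
  calc _ ≤ |sampleFunctional f Q q (h i) X - ∫ Y, sampleFunctional f Q q (h i) Y ∂π| +
        |∫ Y, sampleFunctional f Q q (h i) Y ∂π - ∫ x, f x * h i x| := abs_sub_le _ _ _
    _ ≤ _ := add_le_add (hX i) (hmean i)

end RandomMeasure

/-! ### Passing from finitely many frequencies to the norm `M(t)` -/

section FourierClose

variable {d : ℕ}

/-- `‖μ - ν‖_{M(t)} ≤ ε`. -/
def FourierClose (t ε : ℝ) (μ ν : Measure (Torus d)) : Prop :=
  ∀ ξ, freqNorm ξ ^ (t / 2) * ‖fourierMeasure μ ξ - fourierMeasure ν ξ‖ ≤ ε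

theorem FourierClose.trans {t ε ε' : ℝ} {μ ν ρ : Measure (Torus d)} (h : FourierClose t ε μ ν)
    (h' : FourierClose t ε' ν ρ) : FourierClose t (ε + ε') μ ρ := by
  intro ξ
  refine le_trans ?_ (add_le_add (h ξ) (h' ξ))
  rw [← mul_add]
  exact mul_le_mul_of_nonneg_left (norm_sub_le_norm_sub_add_norm_sub _ _ _)
    (Real.rpow_nonneg (freqNorm_nonneg ξ) _)

theorem norm_weightedFourier (t : ℝ) (μ : Measure (Torus d)) (ξ : Fin d → ℤ) :
    ‖weightedFourier t μ ξ‖ = freqNorm ξ ^ (t / 2) * ‖fourierMeasure μ ξ‖ := by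
  rw [weightedFourier, norm_mul, Complex.norm_real,
    Real.norm_of_nonneg (Real.rpow_nonneg (freqNorm_nonneg ξ) _)]

theorem norm_weightedFourier_sub (t : ℝ) (μ ν : Measure (Torus d)) (ξ : Fin d → ℤ) :
    ‖weightedFourier t μ ξ - weightedFourier t ν ξ‖ =
      freqNorm ξ ^ (t / 2) * ‖fourierMeasure μ ξ - fourierMeasure ν ξ‖ := by
  rw [weightedFourier, weightedFourier, ← mul_sub, norm_mul, Complex.norm_real,
    Real.norm_of_nonneg (Real.rpow_nonneg (freqNorm_nonneg ξ) _)]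

theorem hasFourierDecay_of_le {s A : ℝ} {μ : Measure (Torus d)}
    (h : ∀ ξ, freqNorm ξ ^ (s / 2) * ‖fourierMeasure μ ξ‖ ≤ A) : HasFourierDecay s μ := by
  refine ⟨A, ?_⟩
  rintro _ ⟨ξ, rfl⟩
  simp only [norm_weightedFourier]
  exact h ξ

theorem hasFourierDecay_of_norm_le_pow {s K : ℝ} (hs : 0 ≤ s) (hsd : s ≤ 2 * d) {μ : Measure (Torus d)}
    [IsProbabilityMeasure μ]
    (h : ∀ ξ ≠ 0, ‖fourierMeasure μ ξ‖ ≤ (K / freqNorm ξ) ^ d) : HasFourierDecay s μ := by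
  refine hasFourierDecay_of_le (A := max 1 (K ^ d)) fun ξ => ?_
  by_cases hξ : ξ = 0
  · subst hξ
    refine le_trans ?_ (le_max_left _ _)
    calc _ ≤ (1 : ℝ) * 1 := by
          gcongr
          · rw [freqNorm_zero]; exact Real.rpow_le_one le_rfl (by norm_num) (by positivity)
          · exact norm_fourierMeasure_le_one _ _
      _ = 1 := one_mul 1
  · have hN := one_le_freqNorm hξ
    refine le_trans ?_ (le_max_right _ _)
    calc _ ≤ freqNorm ξ ^ (d : ℝ) * (K / freqNorm ξ) ^ d := by
          gcongr
          · linarith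
          · exact h ξ hξ
      _ = K ^ d := by
          rw [Real.rpow_natCast, ← mul_pow, mul_div_cancel₀ _ (by positivity)]

theorem norm_fourierMeasure_sub_one_le {η : ℝ} (φ : Measure (Torus d))
    [IsProbabilityMeasure φ] (hφ : φ (Metric.closedBall 0 η)ᶜ = 0) (ξ : Fin d → ℤ) :
    ‖fourierMeasure φ ξ - 1‖ ≤ 2 * Real.pi * (d * freqNorm ξ) * η := by
  have h1 : fourierMeasure φ ξ - 1 = ∫ x, (UnitAddTorus.mFourier (-ξ) x - 1) ∂φ := by
    rw [integral_sub (integrable_mFourier _ _) (integrable_const _)]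
    simp [fourierMeasure]
  rw [h1]
  have hsum : ∑ i, |(((-ξ) i : ℤ) : ℝ)| ≤ d * freqNorm ξ := by
    calc _ ≤ ∑ _i : Fin d, freqNorm ξ := Finset.sum_le_sum fun i _ => by
          simpa using abs_le_freqNorm ξ i
      _ = _ := by simp
  have := norm_integral_le_of_norm_le_const (μ := φ)
    (f := fun x => UnitAddTorus.mFourier (-ξ) x - 1) (C := 2 * Real.pi * (d * freqNorm ξ) * η) (by
      have hφ' : ∀ᵐ x ∂φ, x ∈ Metric.closedBall 0 η := hφ
      filter_upwards [hφ'] with x hx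
      rw [mem_closedBall_zero_iff] at hx
      refine (norm_mFourier_sub_one_le _ _).trans ?_
      have := freqNorm_nonneg ξ
      gcongr)
  simpa using this

/-- Mollification converges in the seminorm `M(t)` on measures with finite `M(t')` seminorm. -/
theorem HasFourierDecay.exists_mollification_le {t t' : ℝ} (ht : 0 ≤ t) (htt : t < t')
    {μ : Measure (Torus d)} [IsProbabilityMeasure μ] (h : HasFourierDecay t' μ) {ε : ℝ} (hε : 0 < ε) :
    ∃ η₀ : ℝ, 0 < η₀ ∧ ∀ η, 0 < η → η ≤ η₀ → ∀ φ : Measure (Torus d), IsProbabilityMeasure φ →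
      φ (Metric.closedBall 0 η)ᶜ = 0 → ∀ ξ,
        freqNorm ξ ^ (t / 2) * (‖fourierMeasure μ ξ‖ * ‖fourierMeasure φ ξ - 1‖) ≤ ε := by
  obtain ⟨A, hA0, hA⟩ := h.exists_bound
  have htend : Tendsto (fun R : ℝ => 2 * A * R ^ (-((t' - t) / 2))) atTop (𝓝 (2 * A * 0)) :=
    (tendsto_rpow_neg_atTop (by linarith)).const_mul _
  rw [mul_zero] at htend
  -- Beyond `R` the surplus decay of `μ` suffices; below `R` the coefficients of `φ` are uniformly
  -- close to `1` once its support is small.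
  obtain ⟨R, hR, hR1⟩ := ((htend.eventually (ge_mem_nhds hε)).and (eventually_ge_atTop 1)).exists
  refine ⟨ε / (2 * Real.pi * (d * R) * R ^ (t / 2) + 1), by positivity, fun η hη hη' φ hφp hφ ξ => ?_⟩
  have hN0 := freqNorm_nonneg ξ
  rcases le_total (freqNorm ξ) R with hξ | hξ
  · rw [le_div_iff₀ (by positivity)] at hη'
    calc _ ≤ R ^ (t / 2) * (1 * (2 * Real.pi * (d * R) * η)) := by
          gcongr
          · exact norm_fourierMeasure_le_one _ _
          · refine (norm_fourierMeasure_sub_one_le φ hφ ξ).trans ?_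
            gcongr
      _ = η * (2 * Real.pi * (d * R) * R ^ (t / 2)) := by ring
      _ ≤ ε := by nlinarith
  · have hN : 0 < freqNorm ξ := by linarith
    have h1 : ‖fourierMeasure φ ξ - 1‖ ≤ 2 := by
      refine (norm_sub_le _ _).trans ?_
      have := norm_fourierMeasure_le_one φ ξ
      rw [norm_one]; linarith
    have h2 : freqNorm ξ ^ (t / 2) * ‖fourierMeasure μ ξ‖ ≤ A * freqNorm ξ ^ (-((t' - t) / 2)) := by
      have e : freqNorm ξ ^ (t / 2) = freqNorm ξ ^ (t' / 2) * freqNorm ξ ^ (-((t' - t) / 2)) := by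
        rw [← Real.rpow_add hN]; ring_nf
      rw [e, mul_right_comm]
      gcongr
      exact hA ξ
    calc _ = (freqNorm ξ ^ (t / 2) * ‖fourierMeasure μ ξ‖) * ‖fourierMeasure φ ξ - 1‖ := by ring
      _ ≤ (A * freqNorm ξ ^ (-((t' - t) / 2))) * 2 := by gcongr
      _ ≤ (A * R ^ (-((t' - t) / 2))) * 2 := by
          gcongr ?_ * ?_ * 2
          exact Real.rpow_le_rpow_of_nonpos (by linarith) hξ (by linarith)
      _ ≤ ε := by linarith

/-- Here `x = |ξ|`, `ψ` is the mollifier coefficient and `δ` the sampling error. For `x ≤ r⁻¹` the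
weight `x^(t/2)` costs at most `r^(-t/2)`. For `r⁻¹ < x ≤ r⁻³` the mollifier absorbs the growth of
the weight, since `t / 2 ≤ d`. Beyond `r⁻³` only `δ ≤ 3` is known, and the full decay of the
mollifier is used. -/
theorem weighted_mollifier_mul_le {t l C r δ x ψ : ℝ} {d : ℕ} (hd : 1 ≤ d) (ht : 0 ≤ t)
    (htd : t ≤ d) (hC : 1 ≤ C) (hr : 0 < r) (hr1 : r ≤ 1) (hx : 0 ≤ x) (hψ0 : 0 ≤ ψ) (hψ1 : ψ ≤ 1)
    (hψ : x ≠ 0 → ψ ≤ (C / (r * x)) ^ d) (hδ0 : 0 ≤ δ) (hδ3 : δ ≤ 3)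
    (hδ : x ≤ r⁻¹ ^ 3 → δ ≤ r ^ (l / 2)) :
    x ^ (t / 2) * (ψ * δ) ≤ 3 * C ^ d * r ^ (min ((l - t) / 2) ((d : ℝ) / 2)) := by
  set e := min ((l - t) / 2) ((d : ℝ) / 2)
  have hd' : (1 : ℝ) ≤ d := by exact_mod_cast hd
  have hCd : 1 ≤ C ^ d := one_le_pow₀ hC
  have hrinv : 1 ≤ r⁻¹ := (one_le_inv₀ hr).mpr hr1
  have he1 : r ^ ((l - t) / 2) ≤ r ^ e := Real.rpow_le_rpow_of_exponent_ge hr hr1 (min_le_left _ _)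
  have he2 : r ^ ((d : ℝ) / 2) ≤ r ^ e := Real.rpow_le_rpow_of_exponent_ge hr hr1 (min_le_right _ _)
  have hsplit : r ^ (-(t / 2)) * r ^ (l / 2) = r ^ ((l - t) / 2) := by
    rw [← Real.rpow_add hr]; ring_nf
  have hre : 0 ≤ r ^ e := by positivity
  rcases le_or_gt x r⁻¹ with h1 | h1
  · have hx3 : x ≤ r⁻¹ ^ 3 := h1.trans (le_self_pow₀ hrinv (by norm_num))
    calc _ ≤ r⁻¹ ^ (t / 2) * (1 * r ^ (l / 2)) := by
          gcongr
          exact hδ hx3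
      _ = r ^ ((l - t) / 2) := by rw [one_mul, Real.inv_rpow hr.le, ← Real.rpow_neg hr.le, hsplit]
      _ ≤ r ^ e := he1
      _ ≤ 3 * C ^ d * r ^ e := le_mul_of_one_le_left hre (by linarith)
  · have hx0 : 0 < x := (inv_pos.mpr hr).trans h1
    have hrx : 1 ≤ r * x := by
      rw [inv_eq_one_div, div_lt_iff₀ hr] at h1; linarith
    have hψ' : ψ ≤ C ^ d * (r * x) ^ (-(d : ℝ)) := by
      refine (hψ hx0.ne').trans (le_of_eq ?_)
      rw [div_pow, Real.rpow_neg (by positivity), Real.rpow_natCast, div_eq_mul_inv]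
    rcases le_or_gt x (r⁻¹ ^ 3) with h3 | h3
    · calc _ ≤ x ^ (t / 2) * (C ^ d * (r * x) ^ (-(t / 2)) * r ^ (l / 2)) := by
            gcongr
            · refine hψ'.trans ?_
              gcongr
              linarith
            · exact hδ h3
        _ = C ^ d * r ^ ((l - t) / 2) * (x ^ (t / 2) * x ^ (-(t / 2))) := by
            rw [← hsplit, Real.mul_rpow hr.le hx]; ring
        _ = C ^ d * r ^ ((l - t) / 2) := by
            rw [← Real.rpow_add hx0]; simp
        _ ≤ C ^ d * r ^ e := by gcongr
        _ ≤ _ := by nlinarith [mul_nonneg (by linarith : 0 ≤ C ^ d) hre]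
    -- With `t ≤ d` this is at most a multiple of `r^(-d) x^(-d/2)`. At `x > r⁻³` the loss `r^(-d)`
    -- is beaten by `r^(3d/2)`; any cutoff exponent above `2` would do.
    · calc _ ≤ x ^ (t / 2) * (C ^ d * (r * x) ^ (-(d : ℝ)) * 3) := by gcongr
        _ = 3 * C ^ d * r ^ (-(d : ℝ)) * (x ^ (t / 2) * x ^ (-(d : ℝ))) := by
            rw [Real.mul_rpow hr.le hx]; ring
        _ = 3 * C ^ d * r ^ (-(d : ℝ)) * x ^ (t / 2 - d) := by
            rw [← Real.rpow_add hx0, ← sub_eq_add_neg]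
        _ ≤ 3 * C ^ d * r ^ (-(d : ℝ)) * x ^ (-((d : ℝ) / 2)) := by
            gcongr
            · exact hrinv.trans h1.le
            · linarith
        _ ≤ 3 * C ^ d * r ^ (-(d : ℝ)) * (r⁻¹ ^ 3) ^ (-((d : ℝ) / 2)) := by
            gcongr ?_ * ?_
            exact Real.rpow_le_rpow_of_nonpos (by positivity) h3.le (by linarith)
        _ = 3 * C ^ d * r ^ ((d : ℝ) / 2) := by
            rw [← Real.rpow_natCast r⁻¹ 3, ← Real.rpow_mul (by positivity), Real.inv_rpow hr.le,
              ← Real.rpow_neg hr.le, mul_assoc (3 * C ^ d), ← Real.rpow_add hr]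
            congr 2
            push_cast
            ring
        _ ≤ _ := by gcongr

/-- Smoothing and normalising a measure whose Fourier coefficients are close to those of `μ`. -/
theorem HasFourierDecay.exists_fourierClose_normalized {t t' l C : ℝ} (hd : 1 ≤ d) (ht : 0 ≤ t)
    (htd : t ≤ d) (htt : t < t') (htl : t < l) (hC : 1 ≤ C) {μ : Measure (Torus d)}
    [IsProbabilityMeasure μ] (h' : HasFourierDecay t' μ) (h : HasFourierDecay t μ) {ε : ℝ} (hε : 0 < ε) :
    ∃ r₀ : ℝ, 0 < r₀ ∧ r₀ ≤ 1 / 4 ∧ ∀ r, 0 < r → r ≤ r₀ → ∀ φ : Measure (Torus d), IsProbabilityMeasure φ →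
      φ (Metric.closedBall 0 r)ᶜ = 0 →
      (∀ ξ ≠ 0, ‖fourierMeasure φ ξ‖ ≤ (C / (r * freqNorm ξ)) ^ d) →
      ∀ ν : Measure (Torus d), IsFiniteMeasure ν →
      (∀ ξ, freqNorm ξ ≤ r⁻¹ ^ 3 → ‖fourierMeasure ν ξ - fourierMeasure μ ξ‖ ≤ r ^ (l / 2)) →
      ν univ ≠ 0 ∧ FourierClose t ε ((ν univ)⁻¹ • (ν ∗ φ)) μ := by
  obtain ⟨A, hA0, hA⟩ := h.exists_bound
  obtain ⟨η₀, hη₀, hη⟩ := h'.exists_mollification_le ht htt (ε := ε / 8) (by positivity)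
  set e := min ((l - t) / 2) ((d : ℝ) / 2) with he
  have hd' : (1 : ℝ) ≤ d := by exact_mod_cast hd
  have he0 : 0 < e := lt_min (by linarith) (by linarith)
  have htend : Tendsto (fun r : ℝ => r ^ e * (6 * C ^ d + 2 * A)) (𝓝[>] 0) (𝓝 (0 * (6 * C ^ d + 2 * A))) := by
    refine Tendsto.mul_const _ (tendsto_nhdsWithin_of_tendsto_nhds ?_)
    have := (Real.continuousAt_rpow_const 0 e (Or.inr he0.le)).tendsto
    rwa [Real.zero_rpow he0.ne'] at this
  have htend2 : Tendsto (fun r : ℝ => r ^ (l / 2)) (𝓝[>] 0) (𝓝 0) := by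
    refine tendsto_nhdsWithin_of_tendsto_nhds ?_
    have := (Real.continuousAt_rpow_const 0 (l / 2) (Or.inr (by linarith))).tendsto
    rwa [Real.zero_rpow (by linarith)] at this
  rw [zero_mul] at htend
  have hev := (htend.eventually (ge_mem_nhds (by positivity : 0 < ε / 2))).and
    (htend2.eventually (ge_mem_nhds (by norm_num : (0 : ℝ) < 1 / 2)))
  obtain ⟨r₁, hr₁, hr₁'⟩ := mem_nhdsGT_iff_exists_Ioc_subset.mp hev
  refine ⟨min r₁ (min (1 / 4) η₀), lt_min hr₁ (lt_min (by norm_num) hη₀),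
    (min_le_right _ _).trans (min_le_left _ _), ?_⟩
  intro r hr hrr φ hφp hφ hφd ν hνf hν
  have hr4 : r ≤ 1 / 4 := hrr.trans ((min_le_right _ _).trans (min_le_left _ _))
  obtain ⟨hsmall, hhalf⟩ := hr₁' ⟨hr, hrr.trans (min_le_left _ _)⟩
  -- Frequency zero of the hypothesis says that the total mass of `ν` is within `r^(l/2)` of `1`.
  set c := ν.real univ with hc
  have hc1 : |c - 1| ≤ r ^ (l / 2) := by
    have := hν 0 (by rw [freqNorm_zero]; positivity)
    rw [fourierMeasure_zero_freq, fourierMeasure_zero_freq, probReal_univ (μ := μ), ← Complex.ofReal_sub,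
      Complex.norm_real, Real.norm_eq_abs] at this
    exact this
  have hcabs := abs_le.mp hc1
  have hc0 : 1 / 2 ≤ c := by linarith
  have hc2 : c ≤ 3 / 2 := by linarith
  refine ⟨?_, fun ξ => ?_⟩
  · intro h0
    rw [Measure.real, h0, ENNReal.toReal_zero] at hc
    linarith
  have hcinv : ((ν univ)⁻¹).toReal = c⁻¹ := ENNReal.toReal_inv _
  rw [fourierMeasure_smul, fourierMeasure_conv, hcinv]
  have hN0 := freqNorm_nonneg ξ
  have hw : 0 ≤ freqNorm ξ ^ (t / 2) := Real.rpow_nonneg hN0 _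
  have hB1 : freqNorm ξ ^ (t / 2) * (‖fourierMeasure φ ξ‖ *
      ‖fourierMeasure ν ξ - fourierMeasure μ ξ‖) ≤ 3 * C ^ d * r ^ e := by
    refine weighted_mollifier_mul_le hd ht htd hC hr (by linarith) hN0 (norm_nonneg _)
      (norm_fourierMeasure_le_one _ _) (fun hx => hφd ξ ?_) (norm_nonneg _) ?_ (hν ξ)
    · rintro rfl; exact hx freqNorm_zero
    · have h1 := norm_fourierMeasure_le ν ξ
      have h2 := norm_fourierMeasure_le_one μ ξ
      exact (norm_sub_le _ _).trans (by linarith)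
  have hB2 := hη r hr (hrr.trans ((min_le_right _ _).trans (min_le_right _ _))) φ hφp hφ ξ
  have hB3 := hA ξ
  have hcne : (c : ℂ) ≠ 0 := by exact_mod_cast (by linarith : c ≠ 0)
  -- Three sources of error: sampling damped by the mollifier, mollification of `μ` itself, and
  -- normalisation of the mass.
  have hid : ((c⁻¹ : ℝ) : ℂ) * (fourierMeasure ν ξ * fourierMeasure φ ξ) - fourierMeasure μ ξ =
      ((c⁻¹ : ℝ) : ℂ) * (fourierMeasure φ ξ * (fourierMeasure ν ξ - fourierMeasure μ ξ) +
        fourierMeasure μ ξ * (fourierMeasure φ ξ - 1)) +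
      ((c⁻¹ * (1 - c) : ℝ) : ℂ) * fourierMeasure μ ξ := by
    push_cast
    field_simp
    ring
  have hcinv2 : c⁻¹ ≤ 2 := by rw [inv_le_comm₀ (by linarith) (by norm_num)]; linarith
  have hcinv0 : 0 ≤ c⁻¹ := by positivity
  have hre : r ^ (l / 2) ≤ r ^ e :=
    Real.rpow_le_rpow_of_exponent_ge hr (by linarith) ((min_le_left _ _).trans (by linarith))
  rw [hid]
  calc _ ≤ freqNorm ξ ^ (t / 2) * (c⁻¹ * (‖fourierMeasure φ ξ‖ *
        ‖fourierMeasure ν ξ - fourierMeasure μ ξ‖ + ‖fourierMeasure μ ξ‖ * ‖fourierMeasure φ ξ - 1‖) +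
        c⁻¹ * |1 - c| * ‖fourierMeasure μ ξ‖) := by
        gcongr
        refine (norm_add_le _ _).trans ?_
        rw [norm_mul, norm_mul, Complex.norm_real, Complex.norm_real, Real.norm_of_nonneg hcinv0,
          Real.norm_eq_abs, abs_mul, abs_of_nonneg hcinv0]
        gcongr
        refine (norm_add_le _ _).trans ?_
        rw [norm_mul, norm_mul]
    _ = c⁻¹ * (freqNorm ξ ^ (t / 2) * (‖fourierMeasure φ ξ‖ *
        ‖fourierMeasure ν ξ - fourierMeasure μ ξ‖) + freqNorm ξ ^ (t / 2) * (‖fourierMeasure μ ξ‖ * ‖fourierMeasure φ ξ - 1‖)) +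
        c⁻¹ * |1 - c| * (freqNorm ξ ^ (t / 2) * ‖fourierMeasure μ ξ‖) := by ring
    _ ≤ 2 * (3 * C ^ d * r ^ e + ε / 8) + 2 * r ^ e * A := by
        gcongr
        rw [abs_sub_comm]
        exact hc1.trans hre
    _ = r ^ e * (6 * C ^ d + 2 * A) + ε / 4 := by ring
    _ ≤ ε := by linarith

end FourierClose

/-! ### `𝒳_β` is a Baire space -/

section SupportPairTopology

variable {d : ℕ} {β : ℝ}

theorem SupportPair.tendsto_iff {ι : Type*} {l : Filter ι} {u : ι → SupportPair d β}
    {p : SupportPair d β} :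
    Tendsto u l (𝓝 p) ↔ Tendsto (fun i => (u i).set) l (𝓝 p.set) ∧
      ∀ t : Ico (0 : ℝ) β, TendstoUniformly
        (fun i => weightedFourier (t : ℝ) ((u i).measure : Measure (Torus d)))
        (weightedFourier (t : ℝ) (p.measure : Measure (Torus d))) l := by
  rw [nhds_induced, tendsto_comap_iff, nhds_prod_eq, tendsto_prod_iff', tendsto_pi_nhds]
  refine and_congr Iff.rfl (forall_congr' fun t => ?_)
  rw [UniformFun.tendsto_iff_tendstoUniformly]
  rfl

/-- A sequence in `[0, β)` converging to `β`. -/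
noncomputable def exponentSeq (β : ℝ) (k : ℕ) : ℝ := β - β / (k + 2)

theorem exponentSeq_mem (hβ : 0 < β) (k : ℕ) : exponentSeq β k ∈ Ico (0 : ℝ) β := by
  have hk : (0 : ℝ) < k + 2 := by positivity
  refine ⟨sub_nonneg.mpr (div_le_self hβ.le (by linarith [(Nat.cast_nonneg k : (0 : ℝ) ≤ k)])), ?_⟩
  exact sub_lt_self _ (by positivity)

theorem eventually_le_exponentSeq {t : ℝ} (ht : t < β) : ∀ᶠ k in atTop, t ≤ exponentSeq β k := by
  have h1 : Tendsto (fun k : ℕ => (k : ℝ) + 2) atTop atTop :=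
    tendsto_atTop_add_const_right _ _ tendsto_natCast_atTop_atTop
  have h2 : Tendsto (exponentSeq β) atTop (𝓝 (β - 0)) :=
    tendsto_const_nhds.sub (Tendsto.const_div_atTop h1 β)
  rw [sub_zero] at h2
  exact h2.eventually (le_mem_nhds ht)

/-- Monotonicity of the seminorms on differences of probability measures: frequency zero cancels and
all other frequencies have length at least `1`. This is why a sequence of exponents suffices. -/
theorem norm_weightedFourier_sub_le_of_le {s t : ℝ} (hts : t ≤ s) (μ ν : Measure (Torus d))
    [IsProbabilityMeasure μ] [IsProbabilityMeasure ν] (ξ : Fin d → ℤ) :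
    ‖weightedFourier t μ ξ - weightedFourier t ν ξ‖ ≤
      ‖weightedFourier s μ ξ - weightedFourier s ν ξ‖ := by
  rw [norm_weightedFourier_sub, norm_weightedFourier_sub]
  by_cases hξ : ξ = 0
  · subst hξ
    rw [fourierMeasure_zero_freq, fourierMeasure_zero_freq]
    simp
  · gcongr
    exact one_le_freqNorm hξ

/-- Density in `𝒳_β` can be tested with a single seminorm at a time. -/
theorem SupportPair.dense_of_approx (hβ : 0 < β) {S : Set (SupportPair d β)}
    (h : ∀ p : SupportPair d β, ∀ t ∈ Ico (0 : ℝ) β, ∀ ε > 0, ∃ p' ∈ S, dist p'.set p.set ≤ ε ∧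
      FourierClose t ε (p'.measure : Measure (Torus d)) (p.measure : Measure (Torus d))) :
    Dense S := by
  intro p
  -- Exponents tending to `β` together with errors tending to `0` give convergence in every seminorm
  -- at once.
  choose u huS hud huF using fun k : ℕ => h p (exponentSeq β k) (exponentSeq_mem hβ k)
    (1 / ((k : ℝ) + 1)) (by positivity)
  refine mem_closure_of_tendsto (f := u) (b := atTop) ?_ (Eventually.of_forall huS)
  rw [SupportPair.tendsto_iff]
  have hlim : Tendsto (fun k : ℕ => 1 / ((k : ℝ) + 1)) atTop (𝓝 0) :=
    tendsto_one_div_add_atTop_nhds_zero_nat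
  refine ⟨?_, fun t => ?_⟩
  · rw [tendsto_iff_dist_tendsto_zero]
    exact squeeze_zero (fun _ => dist_nonneg) hud hlim
  · rw [Metric.tendstoUniformly_iff]
    intro ε hε
    filter_upwards [hlim.eventually (gt_mem_nhds hε), eventually_le_exponentSeq t.2.2] with k hk hkt ξ
    rw [dist_comm, dist_eq_norm]
    refine (norm_weightedFourier_sub_le_of_le hkt _ _ ξ).trans_lt ?_
    rw [norm_weightedFourier_sub]
    exact (huF k ξ).trans_lt hk

/-- The sequence of weighted Fourier transforms that determines the topology of `𝒳_β`. -/
noncomputable def SupportPair.toSeq (p : SupportPair d β) :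
    NonemptyCompacts (Torus d) × (ℕ → ((Fin d → ℤ) →ᵤ ℂ)) :=
  (p.set, fun k => UniformFun.ofFun
    (weightedFourier (exponentSeq β k) (p.measure : Measure (Torus d))))

theorem SupportPair.isInducing_toSeq (hβ : 0 < β) :
    IsInducing (SupportPair.toSeq : SupportPair d β → _) := by
  rw [isInducing_iff_nhds]
  intro p
  refine le_antisymm ?_ ?_
  · have hid : Tendsto id (𝓝 p) (𝓝 p) := tendsto_id
    rw [SupportPair.tendsto_iff] at hid
    rw [← tendsto_iff_comap, SupportPair.toSeq, nhds_prod_eq, tendsto_prod_iff', tendsto_pi_nhds]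
    refine ⟨hid.1, fun k => ?_⟩
    rw [UniformFun.tendsto_iff_tendstoUniformly]
    exact hid.2 ⟨_, exponentSeq_mem hβ k⟩
  · have key (F : Filter (SupportPair d β)) (hF : Tendsto SupportPair.toSeq F (𝓝 p.toSeq)) :
        Tendsto id F (𝓝 p) := by
      rw [SupportPair.toSeq, nhds_prod_eq, tendsto_prod_iff', tendsto_pi_nhds] at hF
      rw [SupportPair.tendsto_iff]
      refine ⟨hF.1, fun t => ?_⟩
      obtain ⟨k, hk⟩ := (eventually_le_exponentSeq t.2.2).exists
      have h2 := hF.2 k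
      rw [UniformFun.tendsto_iff_tendstoUniformly, Metric.tendstoUniformly_iff] at h2
      rw [Metric.tendstoUniformly_iff]
      intro ε hε
      filter_upwards [h2 ε hε] with q hq ξ
      have := hq ξ
      rw [dist_eq_norm] at this ⊢
      exact (norm_weightedFourier_sub_le_of_le hk _ _ ξ).trans_lt this
    exact key _ tendsto_comap

theorem fourierMeasure_tendsto {ι : Type*} {l : Filter ι} {μs : ι → ProbabilityMeasure (Torus d)}
    {μ : ProbabilityMeasure (Torus d)} (h : Tendsto μs l (𝓝 μ)) (ξ : Fin d → ℤ) :
    Tendsto (fun i => fourierMeasure (μs i : Measure (Torus d)) ξ) l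
      (𝓝 (fourierMeasure (μ : Measure (Torus d)) ξ)) := by
  have hre := (ProbabilityMeasure.tendsto_iff_forall_integral_tendsto.mp h)
    (BoundedContinuousFunction.mkOfCompact ⟨fun x => (UnitAddTorus.mFourier (-ξ) x).re, by fun_prop⟩)
  have him := (ProbabilityMeasure.tendsto_iff_forall_integral_tendsto.mp h)
    (BoundedContinuousFunction.mkOfCompact ⟨fun x => (UnitAddTorus.mFourier (-ξ) x).im, by fun_prop⟩)
  have key (ν : ProbabilityMeasure (Torus d)) : fourierMeasure (ν : Measure (Torus d)) ξ =
      ((∫ x, (UnitAddTorus.mFourier (-ξ) x).re ∂(ν : Measure (Torus d)) : ℝ) : ℂ) +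
      ((∫ x, (UnitAddTorus.mFourier (-ξ) x).im ∂(ν : Measure (Torus d)) : ℝ) : ℂ) * Complex.I :=
    (integral_re_add_im (𝕜 := ℂ) (integrable_mFourier (-ξ) _)).symm
  simp only [key]
  exact ((Complex.continuous_ofReal.tendsto _).comp hre).add
    (((Complex.continuous_ofReal.tendsto _).comp him).mul_const _)

/-- Compactness of the space of probability measures supplies a weak limit, whose Fourier
coefficients identify the limits of the weighted transforms. Uniform convergence carries the decay
over to it. Weak convergence and Hausdorff convergence together keep its support in the limit set.
-/
theorem SupportPair.isClosed_range_toSeq (hβ : 0 < β) :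
    IsClosed (range (SupportPair.toSeq : SupportPair d β → _)) := by
  refine isSeqClosed_iff_isClosed.mp fun v y hv hy => ?_
  choose u hu using hv
  obtain rfl : (fun n => (u n).toSeq) = v := funext hu
  let 𝒢 : Ultrafilter ℕ := Ultrafilter.of atTop
  obtain ⟨μ, -, hμ⟩ := (isCompact_univ (X := ProbabilityMeasure (Torus d))).ultrafilter_le_nhds
    (𝒢.map fun n => (u n).measure) (by simp)
  have hμ' : Tendsto (fun n => (u n).measure) (𝒢 : Filter ℕ) (𝓝 μ) := hμ
  have hy' : Tendsto (fun n => (u n).toSeq) (𝒢 : Filter ℕ) (𝓝 y) := hy.mono_left (Ultrafilter.of_le _)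
  obtain ⟨E, g⟩ := y
  rw [nhds_prod_eq, tendsto_prod_iff', tendsto_pi_nhds] at hy'
  obtain ⟨hE, hg⟩ := hy'
  have hgk (k : ℕ) : UniformFun.toFun (g k) = weightedFourier (exponentSeq β k) (μ : Measure (Torus d)) := by
    have h1 := hg k
    rw [UniformFun.tendsto_iff_tendstoUniformly] at h1
    ext ξ
    refine tendsto_nhds_unique (h1.tendsto_at ξ) ?_
    exact (fourierMeasure_tendsto hμ' ξ).const_mul _
  have hdecay (k : ℕ) : HasFourierDecay (exponentSeq β k) (μ : Measure (Torus d)) := by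
    have h1 := hg k
    rw [UniformFun.tendsto_iff_tendstoUniformly, hgk, Metric.tendstoUniformly_iff] at h1
    obtain ⟨n, hn⟩ := (h1 1 one_pos).exists
    obtain ⟨A, hA⟩ := (u n).decay _ (exponentSeq_mem hβ k)
    refine ⟨A + 1, ?_⟩
    rintro _ ⟨ξ, rfl⟩
    have h2 := hn ξ
    have h3 := hA ⟨ξ, rfl⟩
    rw [dist_eq_norm] at h2
    have h4 := norm_le_norm_add_norm_sub' (weightedFourier (exponentSeq β k) (μ : Measure (Torus d)) ξ)
      (weightedFourier (exponentSeq β k) ((u n).measure : Measure (Torus d)) ξ)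
    simp only at h3 ⊢
    exact h4.trans (add_le_add h3 h2.le)
  have hsupp : (μ : Measure (Torus d)).support ⊆ (E : Set (Torus d)) := by
    intro x hx
    by_contra hxE
    obtain ⟨δ, hδ, hδE⟩ := Metric.isOpen_iff.mp E.isCompact.isClosed.isOpen_compl x hxE
    have hball : Disjoint (Metric.thickening (δ / 2) (E : Set (Torus d))) (Metric.ball x (δ / 2)) := by
      rw [Set.disjoint_left]
      intro y hy hyx
      obtain ⟨z, hz, hyz⟩ := Metric.mem_thickening_iff.mp hy
      refine hδE (Metric.mem_ball.mpr ?_) hz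
      rw [Metric.mem_ball] at hyx
      calc dist z x ≤ dist y z + dist y x := dist_triangle_left _ _ _
        _ < δ := by linarith
    -- A ball away from the limit set eventually misses the approximating sets, so it is null for
    -- their measures. Lower semicontinuity on open sets makes it null for `μ`.
    have hev : ∀ᶠ n in (𝒢 : Filter ℕ), ((u n).measure : Measure (Torus d)) (Metric.ball x (δ / 2)) = 0 := by
      have hopen := NonemptyCompacts.isOpen_subsets_of_isOpen
        (Metric.isOpen_thickening (δ := δ / 2) (E := (E : Set (Torus d))))
      have := hE.eventually (hopen.mem_nhds (Metric.self_subset_thickening (by linarith) _))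
      filter_upwards [this] with n hn
      refine measure_mono_null ?_ (Measure.measure_compl_support (μ := ((u n).measure : Measure (Torus d))))
      intro y hy hys
      exact Set.disjoint_left.mp hball (hn ((u n).support_subset hys)) hy
    have hle := ProbabilityMeasure.le_liminf_measure_open_of_tendsto hμ' (Metric.isOpen_ball (x := x) (ε := δ / 2))
    rw [liminf_congr hev, liminf_const] at hle
    exact (Measure.mem_support_iff_forall x |>.mp hx _ (Metric.ball_mem_nhds x (by linarith))).not_ge hle
  refine ⟨⟨E, μ, hsupp, fun t ht => ?_⟩, ?_⟩
  · obtain ⟨k, hk⟩ := (eventually_le_exponentSeq ht.2).exists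
    obtain ⟨A, hA0, hA⟩ := (hdecay k).exists_bound
    refine hasFourierDecay_of_le (A := max 1 A) fun ξ => ?_
    by_cases hξ : ξ = 0
    · subst hξ
      refine le_trans ?_ (le_max_left _ _)
      calc _ ≤ (1 : ℝ) * 1 := by
            gcongr
            · rw [freqNorm_zero]; exact Real.rpow_le_one le_rfl (by norm_num) (by linarith [ht.1])
            · exact norm_fourierMeasure_le_one _ _
        _ = 1 := one_mul 1
    · refine le_trans ?_ ((hA ξ).trans (le_max_right _ _))
      gcongr
      exact one_le_freqNorm hξ
  · refine Prod.ext rfl (funext fun k => ?_)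
    exact UniformFun.toFun.injective (hgk k).symm

/-- The uniformity pulled back from the product is complete, because the range is closed, and
countably generated. Baire's theorem applies to it. -/
theorem SupportPair.baireSpace (hβ : 0 < β) : BaireSpace (SupportPair d β) := by
  have hind := SupportPair.isInducing_toSeq (d := d) hβ
  let _ : UniformSpace (SupportPair d β) :=
    (UniformSpace.comap SupportPair.toSeq inferInstance).replaceTopology hind.eq_induced
  have hui : IsUniformInducing (SupportPair.toSeq : SupportPair d β → _) := ⟨rfl⟩
  have : CompleteSpace (SupportPair d β) :=
    hui.completeSpace (SupportPair.isClosed_range_toSeq hβ).isComplete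
  have : IsCountablyGenerated (uniformity (SupportPair d β)) := by
    rw [← hui.comap_uniformity]; infer_instance
  infer_instance

end SupportPairTopology

/-! ### Reduction of density in `𝒳_β` to Fourier approximation -/

section DensityCriterion

variable {d : ℕ} {β : ℝ}

theorem exists_bounded_density {L : ℝ≥0} {μ : Measure (Torus d)} [IsFiniteMeasure μ]
    (h : μ ≤ (L : ℝ≥0∞) • volume) {K : Set (Torus d)} (hK : MeasurableSet K) (hμK : μ Kᶜ = 0) :
    ∃ f : Torus d → ℝ, Measurable f ∧ (∀ x, 0 ≤ f x) ∧ (∀ x, f x ≤ L) ∧ (∀ x ∉ K, f x = 0) ∧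
      volume.withDensity (fun x => ENNReal.ofReal (f x)) = μ := by
  have hac : μ ≪ volume := (Measure.absolutelyContinuous_of_le h).trans
    (Measure.smul_absolutelyContinuous)
  have hd := Measure.withDensity_rnDeriv_eq μ volume hac
  have hle : μ.rnDeriv volume ≤ᵐ[volume] fun _ => (L : ℝ≥0∞) := by
    refine ae_le_of_forall_setLIntegral_le_of_sigmaFinite (Measure.measurable_rnDeriv _ _) fun s hs _ => ?_
    rw [← withDensity_apply _ hs, hd, setLIntegral_const]
    exact h s
  -- Truncating and restricting the Radon–Nikodym derivative makes the almost everywhere bounds hold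
  -- everywhere. Everywhere bounds are needed since `f` will be evaluated at sample points.
  refine ⟨K.indicator fun x => min (μ.rnDeriv volume x).toReal L, ?_, ?_, ?_, ?_, ?_⟩
  · exact ((Measure.measurable_rnDeriv _ _).ennreal_toReal.min measurable_const).indicator hK
  · exact fun x => indicator_nonneg (fun _ _ => le_min ENNReal.toReal_nonneg L.2) x
  · intro x
    by_cases hx : x ∈ K
    · simp [hx]
    · simp [hx]
  · intro x hx; simp [hx]
  · have e1 : (fun x => ENNReal.ofReal (K.indicator (fun x => min (μ.rnDeriv volume x).toReal L) x)) =ᵐ[volume]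
        K.indicator (μ.rnDeriv volume) := by
      filter_upwards [hle] with x hx
      by_cases hxK : x ∈ K
      · have hne : μ.rnDeriv volume x ≠ ∞ := ne_top_of_le_ne_top ENNReal.coe_ne_top hx
        have : (μ.rnDeriv volume x).toReal ≤ L := ENNReal.toReal_mono ENNReal.coe_ne_top hx
        simp only [hxK, indicator_of_mem]
        rw [min_eq_left this, ENNReal.ofReal_toReal hne]
      · simp [hxK]
    rw [withDensity_congr_ae e1, withDensity_indicator hK, ← restrict_withDensity hK, hd]
    exact Measure.restrict_eq_self_of_ae_mem hμK

/-- Every bounded density can be approximated by measures concentrated on sets whose thickening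
belongs to `𝒰`, with Fourier error of order less than `r^{t/2}` at frequencies `|ξ| ≤ r⁻³`. -/
def FourierApproximable (d : ℕ) (β : ℝ) (𝒰 : Set (Set (Torus d))) : Prop :=
  ∀ t, 0 ≤ t → t < β → ∃ l, t < l ∧ ∀ (f : Torus d → ℝ) (L : ℝ), Measurable f → (∀ x, 0 ≤ f x) →
    (∀ x, f x ≤ L) → ∀ (F : Finset (Torus d)) (ρ ε r₀ : ℝ), 0 < ε → 0 < r₀ →
    ∃ r, 0 < r ∧ r ≤ r₀ ∧ ∃ ν : Measure (Torus d), IsFiniteMeasure ν ∧ ν {x | f x = 0} = 0 ∧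
      (∀ ξ, freqNorm ξ ≤ r⁻¹ ^ 3 → ‖fourierMeasure ν ξ -
        fourierMeasure (volume.withDensity fun x => ENNReal.ofReal (f x)) ξ‖ ≤ r ^ (l / 2)) ∧
      (∀ y ∈ F, (volume.withDensity fun x => ENNReal.ofReal (f x)).real (Metric.closedBall y ρ) ≤
        ν.real (Metric.closedBall y ρ) + ε) ∧
      ∃ G, ν Gᶜ = 0 ∧ Metric.thickening (2 * r) G ∈ 𝒰

theorem SupportPair.isOpen_setOf_exists_subset {𝒰 : Set (Set (Torus d))} (h𝒰 : ∀ U ∈ 𝒰, IsOpen U) :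
    IsOpen {p : SupportPair d β | ∃ U ∈ 𝒰, (p.set : Set (Torus d)) ⊆ U} := by
  have hcont : Continuous (SupportPair.set : SupportPair d β → _) :=
    continuous_iff_continuousAt.mpr fun p =>
      (SupportPair.tendsto_iff.mp (tendsto_id (α := SupportPair d β) (x := 𝓝 p))).1
  have : {p : SupportPair d β | ∃ U ∈ 𝒰, (p.set : Set (Torus d)) ⊆ U} =
      ⋃ U ∈ 𝒰, SupportPair.set ⁻¹' {K | (K : Set (Torus d)) ⊆ U} := by
    ext p; simp
  rw [this]
  exact isOpen_biUnion fun U hU => (NonemptyCompacts.isOpen_subsets_of_isOpen (h𝒰 U hU)).preimage hcont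

theorem fourierMeasure_convexCombination {a : ℝ} (ha : 0 ≤ a) (ha1 : a ≤ 1) (μ σ : Measure (Torus d))
    [IsProbabilityMeasure μ] [IsProbabilityMeasure σ] :
    IsProbabilityMeasure (ENNReal.ofReal (1 - a) • μ + ENNReal.ofReal a • σ) ∧
    ∀ ξ, fourierMeasure (ENNReal.ofReal (1 - a) • μ + ENNReal.ofReal a • σ) ξ =
      fourierMeasure μ ξ + a * (fourierMeasure σ ξ - fourierMeasure μ ξ) := by
  constructor
  · constructor
    simp only [Measure.coe_add, Measure.coe_smul, Pi.add_apply, Pi.smul_apply, measure_univ, smul_eq_mul,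
      mul_one]
    rw [← ENNReal.ofReal_add (by linarith) ha]
    simp
  · intro ξ
    have := Measure.smul_finite μ (c := ENNReal.ofReal (1 - a)) ENNReal.ofReal_ne_top
    have := Measure.smul_finite σ (c := ENNReal.ofReal a) ENNReal.ofReal_ne_top
    rw [fourierMeasure_add, fourierMeasure_smul, fourierMeasure_smul, ENNReal.toReal_ofReal (by linarith),
      ENNReal.toReal_ofReal ha]
    push_cast
    ring

/-- Measures with bounded density whose support is all of a neighbourhood of `E` are dense. -/
theorem SupportPair.exists_density_approx (hd : 1 ≤ d) (hβd : β ≤ d) (p : SupportPair d β) {t : ℝ}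
    (ht : t ∈ Ico (0 : ℝ) β) {ε η₁ : ℝ} (hε : 0 < ε) (hη₁ : 0 < η₁) :
    ∃ (η : ℝ) (μ : Measure (Torus d)) (L : ℝ≥0), 0 < η ∧ η ≤ η₁ ∧ IsProbabilityMeasure μ ∧
      μ ≤ (L : ℝ≥0∞) • volume ∧ μ (Metric.cthickening (2 * η) (p.set : Set (Torus d)))ᶜ = 0 ∧
      (∀ y ∈ p.set, 0 < μ (Metric.closedBall y (2 * η))) ∧
      (∀ s : ℝ, 0 ≤ s → s ≤ 2 * d → HasFourierDecay s μ) ∧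
      FourierClose t ε μ (p.measure : Measure (Torus d)) := by
  obtain ⟨C, hC0, hC⟩ := exists_mollifier hd
  obtain ⟨t', ht1, ht2⟩ := exists_between ht.2
  obtain ⟨η₀, hη₀, hmoll⟩ := (p.decay t' ⟨ht.1.trans ht1.le, ht2⟩).exists_mollification_le ht.1 ht1
    (ε := ε / 2) (by positivity)
  set η := min η₁ (min η₀ (1 / 4)) with hηdef
  have hη : 0 < η := lt_min hη₁ (lt_min hη₀ (by norm_num))
  have hη4 : η ≤ 1 / 4 := (min_le_right _ _).trans (min_le_right _ _)
  obtain ⟨φ, hφ, ⟨L, hL⟩, hφd⟩ := hC η hη hη4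
  set E : Set (Torus d) := (p.set : Set (Torus d)) with hE
  set μ₀ : Measure (Torus d) := (p.measure : Measure (Torus d)) with hμ₀
  have hEne : E.Nonempty := p.set.nonempty
  have hTne : volume (Metric.thickening η E) ≠ 0 := by
    obtain ⟨y, hy⟩ := hEne
    exact (Metric.isOpen_thickening.measure_pos volume ⟨y, Metric.self_subset_thickening hη E hy⟩).ne'
  -- The support of `μ₀` may be smaller than `E`. A small multiple of the uniform measure on a
  -- neighbourhood puts mass near every point of `E`, so that the new set can be Hausdorff close to
  -- `E`.
  set ρ : Measure (Torus d) := ProbabilityTheory.cond volume (Metric.thickening η E) with hρ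
  have hρp : IsProbabilityMeasure ρ := ProbabilityTheory.cond_isProbabilityMeasure hTne
  have hρc : ρ (Metric.thickening η E)ᶜ = 0 := by
    rw [hρ, ProbabilityTheory.cond_apply Metric.isOpen_thickening.measurableSet]
    simp
  have hμ₀c : μ₀ Eᶜ = 0 :=
    measure_mono_null (compl_subset_compl.mpr p.support_subset) Measure.measure_compl_support
  set μ₁ := μ₀ ∗ (φ : Measure (Torus d))
  set σ := ρ ∗ (φ : Measure (Torus d))
  have hbound (κ : Measure (Torus d)) [IsProbabilityMeasure κ] (ξ : Fin d → ℤ) (hξ : ξ ≠ 0) :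
      ‖fourierMeasure (κ ∗ (φ : Measure (Torus d))) ξ‖ ≤ (C / η / freqNorm ξ) ^ d := by
    rw [fourierMeasure_conv, norm_mul, div_div]
    calc _ ≤ 1 * (C / (η * freqNorm ξ)) ^ d := by
          gcongr
          · exact norm_fourierMeasure_le_one _ _
          · exact hφd ξ hξ
      _ = _ := one_mul _
  have hdec (κ : Measure (Torus d)) [IsProbabilityMeasure κ] (s : ℝ) (hs : 0 ≤ s) (hsd : s ≤ 2 * d) :
      HasFourierDecay s (κ ∗ (φ : Measure (Torus d))) :=
    hasFourierDecay_of_norm_le_pow hs hsd (K := C / η) (hbound κ)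
  have htd : t ≤ 2 * d := by linarith [ht.2, (Nat.cast_nonneg d : (0 : ℝ) ≤ d)]
  obtain ⟨A, hA0, hA⟩ := (hdec μ₀ t ht.1 htd).exists_bound
  obtain ⟨B, hB0, hB⟩ := (hdec ρ t ht.1 htd).exists_bound
  -- The admixture moves the `M(t)` seminorm by at most `a (A + B) ≤ ε / 2`.
  set a := min 1 (ε / (2 * (A + B + 1)))
  have ha0 : 0 < a := lt_min one_pos (by positivity)
  have ha1 : a ≤ 1 := min_le_left _ _
  have ha2 : a * (A + B) ≤ ε / 2 := by
    have h1 : a ≤ ε / (2 * (A + B + 1)) := min_le_right _ _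
    rw [le_div_iff₀ (by positivity)] at h1
    nlinarith
  obtain ⟨hprob, hfour⟩ := fourierMeasure_convexCombination ha0.le ha1 μ₁ σ
  refine ⟨η, ENNReal.ofReal (1 - a) • μ₁ + ENNReal.ofReal a • σ, L, hη, min_le_left _ _, hprob, ?_, ?_, ?_, ?_, ?_⟩
  · have h1 : μ₁ ≤ (L : ℝ≥0∞) • volume := conv_le_smul_volume _ _ hL
    have h2 : σ ≤ (L : ℝ≥0∞) • volume := conv_le_smul_volume _ _ hL
    calc _ ≤ ENNReal.ofReal (1 - a) • ((L : ℝ≥0∞) • (volume : Measure (Torus d))) +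
          ENNReal.ofReal a • ((L : ℝ≥0∞) • volume) := by gcongr
      _ = _ := by
          rw [← add_smul, ← ENNReal.ofReal_add (by linarith) ha0.le]
          simp
  · have hm : MeasurableSet (Metric.cthickening (2 * η) E) := Metric.isClosed_cthickening.measurableSet
    have h1 : μ₁ (Metric.cthickening (2 * η) E)ᶜ = 0 := by
      refine conv_apply_compl_eq_zero hm hμ₀c hφ fun x hx y hy => ?_
      refine Metric.mem_cthickening_of_dist_le _ x _ _ hx ?_
      rw [dist_eq_norm, add_sub_cancel_left]
      rw [mem_closedBall_zero_iff] at hy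
      linarith
    have h2 : σ (Metric.cthickening (2 * η) E)ᶜ = 0 := by
      refine conv_apply_compl_eq_zero hm hρc hφ fun x hx y hy => ?_
      obtain ⟨z, hz, hxz⟩ := Metric.mem_thickening_iff.mp hx
      refine Metric.mem_cthickening_of_dist_le _ z _ _ hz ?_
      rw [mem_closedBall_zero_iff] at hy
      calc dist (x + y) z ≤ dist (x + y) x + dist x z := dist_triangle _ _ _
        _ ≤ η + η := by
            gcongr
            rw [dist_eq_norm, add_sub_cancel_left]; exact hy
        _ = 2 * η := by ring
    simp [h1, h2]
  · intro y hy
    have h1 : 0 < ρ (Metric.closedBall y η) := by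
      rw [hρ, ProbabilityTheory.cond_apply Metric.isOpen_thickening.measurableSet]
      refine ENNReal.mul_pos (ENNReal.inv_ne_zero.mpr (measure_ne_top _ _)) ?_
      refine (lt_of_lt_of_le (Metric.measure_ball_pos volume y hη) (measure_mono ?_)).ne'
      intro z hz
      exact ⟨Metric.mem_thickening_iff.mpr ⟨y, hy, hz⟩, Metric.ball_subset_closedBall hz⟩
    have h2 : ρ (Metric.closedBall y η) ≤ σ (Metric.closedBall y (2 * η)) := by
      refine le_conv_apply Metric.isClosed_closedBall.measurableSet
        Metric.isClosed_closedBall.measurableSet hφ fun x hx z hz => ?_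
      rw [mem_closedBall_zero_iff] at hz
      rw [Metric.mem_closedBall] at hx ⊢
      calc dist (x + z) y ≤ dist (x + z) x + dist x y := dist_triangle _ _ _
        _ ≤ η + η := by
            gcongr
            rw [dist_eq_norm, add_sub_cancel_left]; exact hz
        _ = 2 * η := by ring
    have h3 : 0 < ENNReal.ofReal a * σ (Metric.closedBall y (2 * η)) :=
      ENNReal.mul_pos (by simpa using ha0) (h1.trans_le h2).ne'
    simp only [Measure.coe_add, Measure.coe_smul, Pi.add_apply, Pi.smul_apply, smul_eq_mul]
    exact h3.trans_le le_add_self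
  · intro s hs hsd
    refine hasFourierDecay_of_norm_le_pow hs hsd (K := C / η) fun ξ hξ => ?_
    have h1 := hbound μ₀ ξ hξ
    have h2 := hbound ρ ξ hξ
    rw [hfour]
    have e : fourierMeasure μ₁ ξ + a * (fourierMeasure σ ξ - fourierMeasure μ₁ ξ) =
        ((1 - a : ℝ) : ℂ) * fourierMeasure μ₁ ξ + (a : ℂ) * fourierMeasure σ ξ := by push_cast; ring
    rw [e]
    refine (norm_add_le _ _).trans ?_
    rw [norm_mul, norm_mul, Complex.norm_real, Complex.norm_real, Real.norm_of_nonneg (by linarith),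
      Real.norm_of_nonneg ha0.le]
    nlinarith
  · have hc1 : FourierClose t (ε / 2) μ₁ μ₀ := by
      intro ξ
      have := hmoll η hη ((min_le_right _ _).trans (min_le_left _ _)) φ inferInstance hφ ξ
      rw [fourierMeasure_conv, ← mul_sub_one, norm_mul]
      exact this
    have hc2 : FourierClose t (ε / 2) (ENNReal.ofReal (1 - a) • μ₁ + ENNReal.ofReal a • σ) μ₁ := by
      intro ξ
      have hw := Real.rpow_nonneg (freqNorm_nonneg ξ) (t / 2)
      rw [hfour, add_sub_cancel_left, norm_mul, Complex.norm_real, Real.norm_of_nonneg ha0.le]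
      calc _ ≤ freqNorm ξ ^ (t / 2) * (a * (‖fourierMeasure σ ξ‖ + ‖fourierMeasure μ₁ ξ‖)) := by
            gcongr
            exact norm_sub_le _ _
        _ = a * (freqNorm ξ ^ (t / 2) * ‖fourierMeasure μ₁ ξ‖ + freqNorm ξ ^ (t / 2) * ‖fourierMeasure σ ξ‖) := by ring
        _ ≤ a * (A + B) := by gcongr <;> [exact hA ξ; exact hB ξ]
        _ ≤ _ := ha2
    have := hc2.trans hc1
    rwa [add_halves] at this

/-- The new measure is the normalised mollification of the approximant `ν`, and the new set is its
support. This support lies in the `r`-neighbourhood of the carrier of `ν`, hence in a member of `𝒰`.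
-/
theorem SupportPair.dense_of_fourierApproximable (hd : 1 ≤ d) (hβ : 0 < β) (hβd : β ≤ d)
    {𝒰 : Set (Set (Torus d))} (h𝒰 : FourierApproximable d β 𝒰) :
    Dense {p : SupportPair d β | ∃ U ∈ 𝒰, (p.set : Set (Torus d)) ⊆ U} := by
  refine SupportPair.dense_of_approx hβ fun p t ht ε hε => ?_
  obtain ⟨C, hC0, hC⟩ := exists_mollifier hd
  have htd : t ≤ d := ht.2.le.trans hβd
  have hd' : (1 : ℝ) ≤ d := by exact_mod_cast hd
  obtain ⟨l, htl, happ⟩ := h𝒰 t ht.1 ht.2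
  -- The Hausdorff distance will be at most `r + 3η`, so `η` and `r` are both kept below `ε / 4`.
  obtain ⟨η, μ, L, hη, hηε, hμp, hμL, hμc, hμpos, hμd, hμclose⟩ :=
    p.exists_density_approx hd hβd ht (half_pos hε) (by positivity : 0 < ε / 4)
  set E : Set (Torus d) := (p.set : Set (Torus d)) with hE
  have hKm : MeasurableSet (Metric.cthickening (2 * η) E) := Metric.isClosed_cthickening.measurableSet
  obtain ⟨f, hfm, hf0, hfL, hfK, hfμ⟩ := exists_bounded_density hμL hKm hμc
  obtain ⟨F, hFE, hFcov⟩ := p.set.isCompact.elim_finite_subcover_image (b := E) (c := fun y => Metric.ball y η)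
    (fun _ _ => Metric.isOpen_ball) (fun y hy => mem_iUnion₂.mpr ⟨y, hy, Metric.mem_ball_self hη⟩)
  obtain ⟨hFfin, hFcov⟩ := hFcov
  lift F to Finset (Torus d) using hFfin
  have hFne : F.Nonempty := by
    obtain ⟨y, hy⟩ := p.set.nonempty
    obtain ⟨z, hz, -⟩ := mem_iUnion₂.mp (hFcov hy)
    exact ⟨z, hz⟩
  -- The least mass `κ` of `μ` over the balls around the finite net. An error of `κ / 2` on these
  -- balls leaves them with positive `ν`-mass, so the new support comes close to every point of `E`.
  obtain ⟨y₀, hy₀, hmin⟩ := F.exists_min_image (fun y => μ.real (Metric.closedBall y (2 * η))) hFne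
  set κ := μ.real (Metric.closedBall y₀ (2 * η))
  have hκ : 0 < κ := ENNReal.toReal_pos (hμpos y₀ (hFE hy₀)).ne' (measure_ne_top _ _)
  have hC' : 1 ≤ max 1 C := le_max_left _ _
  obtain ⟨r₀, hr₀, hr₀4, hnorm⟩ := (hμd (t + d) (by linarith [ht.1]) (by linarith)).exists_fourierClose_normalized
    hd ht.1 htd (by linarith) htl hC' (hμd t ht.1 (by linarith)) (half_pos hε)
  obtain ⟨r, hr, hrr, ν, hνf, hν0, hνd, hνF, G, hG, hGU⟩ := happ f L hfm hf0 hfL F (2 * η) (κ / 2)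
    (min r₀ (ε / 4)) (by positivity) (lt_min hr₀ (by positivity))
  rw [hfμ] at hνd hνF
  have hr4 : r ≤ 1 / 4 := (hrr.trans (min_le_left _ _)).trans hr₀4
  obtain ⟨φ, hφ, -, hφd⟩ := hC r hr hr4
  have hφd' : ∀ ξ ≠ 0, ‖fourierMeasure (φ : Measure (Torus d)) ξ‖ ≤ (max 1 C / (r * freqNorm ξ)) ^ d := by
    intro ξ hξ
    refine (hφd ξ hξ).trans ?_
    have := one_le_freqNorm hξ
    gcongr
    exact le_max_right _ _
  obtain ⟨hν1, hclose⟩ := hnorm r hr (hrr.trans (min_le_left _ _)) φ inferInstance hφ hφd' ν hνf hνd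
  set μ' : Measure (Torus d) := (ν univ)⁻¹ • (ν ∗ (φ : Measure (Torus d)))
  have hμ'p : IsProbabilityMeasure μ' := by
    constructor
    rw [Measure.smul_apply, conv_apply_eq_lintegral _ _ MeasurableSet.univ]
    simp only [mem_univ, ofPred_true, measure_univ, lintegral_const, one_mul, smul_eq_mul]
    exact ENNReal.inv_mul_cancel hν1 (measure_ne_top _ _)
  have hinvtop : (ν univ)⁻¹ ≠ 0 := ENNReal.inv_ne_zero.mpr (measure_ne_top _ _)
  have hdecay : ∀ s ∈ Ico (0 : ℝ) β, HasFourierDecay s μ' := by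
    intro s hs
    refine hasFourierDecay_of_norm_le_pow hs.1 (by linarith [hs.2]) (K := C / r) fun ξ hξ => ?_
    rw [fourierMeasure_smul, fourierMeasure_conv, norm_mul, norm_mul, Complex.norm_real,
      Real.norm_of_nonneg ENNReal.toReal_nonneg, ← mul_assoc, div_div]
    have h1 := norm_fourierMeasure_le ν ξ
    have h2 : ((ν univ)⁻¹).toReal * ‖fourierMeasure ν ξ‖ ≤ 1 := by
      calc _ ≤ ((ν univ)⁻¹).toReal * ν.real univ := by gcongr
        _ = 1 := by
          rw [Measure.real, ← ENNReal.toReal_mul, ENNReal.inv_mul_cancel hν1 (measure_ne_top _ _)]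
          simp
    calc _ ≤ 1 * (C / (r * freqNorm ξ)) ^ d := by gcongr; exact hφd ξ hξ
      _ = _ := one_mul _
  have hnull (Z : Set (Torus d)) (hZ : (ν ∗ (φ : Measure (Torus d))) Z = 0) : μ' Z = 0 := by
    rw [Measure.smul_apply, hZ, smul_zero]
  have hsub1 : μ'.support ⊆ Metric.cthickening r G := by
    refine Measure.support_subset_of_isClosed Metric.isClosed_cthickening (hnull _ ?_)
    refine conv_apply_compl_eq_zero Metric.isClosed_cthickening.measurableSet hG hφ fun x hx y hy => ?_
    refine Metric.mem_cthickening_of_dist_le _ x _ _ hx ?_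
    rw [dist_eq_norm, add_sub_cancel_left]
    exact mem_closedBall_zero_iff.mp hy
  have hν0' : ν (Metric.cthickening (2 * η) E)ᶜ = 0 :=
    measure_mono_null (fun x hx => hfK x hx) hν0
  have hsub2 : μ'.support ⊆ Metric.cthickening (r + 2 * η) E := by
    refine Measure.support_subset_of_isClosed Metric.isClosed_cthickening (hnull _ ?_)
    refine conv_apply_compl_eq_zero Metric.isClosed_cthickening.measurableSet hν0' hφ fun x hx y hy => ?_
    refine Metric.cthickening_cthickening_subset hr.le (by positivity) _ ?_
    refine Metric.mem_cthickening_of_dist_le _ x _ _ hx ?_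
    rw [dist_eq_norm, add_sub_cancel_left]
    exact mem_closedBall_zero_iff.mp hy
  let E' : NonemptyCompacts (Torus d) :=
    ⟨⟨μ'.support, Measure.isClosed_support.isCompact⟩, Measure.nonempty_support hμ'p.ne_zero⟩
  refine ⟨⟨E', ⟨μ', hμ'p⟩, subset_rfl, hdecay⟩, ⟨_, hGU, ?_⟩, ?_, ?_⟩
  · exact hsub1.trans (Metric.cthickening_subset_thickening' (by linarith) (by linarith) G)
  · rw [Metric.NonemptyCompacts.dist_eq]
    have hrε : r ≤ ε / 4 := hrr.trans (min_le_right _ _)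
    refine Metric.hausdorffDist_le_of_mem_dist hε.le ?_ ?_
    · intro x hx
      have hx' := hsub2 hx
      rw [p.set.isCompact.cthickening_eq_biUnion_closedBall (by positivity)] at hx'
      obtain ⟨y, hy, hxy⟩ := mem_iUnion₂.mp hx'
      exact ⟨y, hy, (Metric.mem_closedBall.mp hxy).trans (by linarith)⟩
    · intro x hx
      obtain ⟨y, hyF, hxy⟩ := mem_iUnion₂.mp (hFcov hx)
      have h1 : 0 < ν (Metric.closedBall y (2 * η)) := by
        have h2 := hνF y hyF
        have h3 := hmin y hyF
        have h4 : 0 < ν.real (Metric.closedBall y (2 * η)) := by linarith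
        exact (ENNReal.toReal_pos_iff.mp h4).1
      have h2 : ν (Metric.closedBall y (2 * η)) ≤
          (ν ∗ (φ : Measure (Torus d))) (Metric.closedBall y (r + 2 * η)) := by
        refine le_conv_apply Metric.isClosed_closedBall.measurableSet
          Metric.isClosed_closedBall.measurableSet hφ fun z hz w hw => ?_
        rw [mem_closedBall_zero_iff] at hw
        rw [Metric.mem_closedBall] at hz ⊢
        calc dist (z + w) y ≤ dist (z + w) z + dist z y := dist_triangle _ _ _
          _ ≤ r + 2 * η := by
              gcongr
              rw [dist_eq_norm, add_sub_cancel_left]; exact hw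
      have h3 : 0 < μ' (Metric.closedBall y (r + 2 * η)) := by
        rw [Measure.smul_apply, smul_eq_mul]
        exact ENNReal.mul_pos hinvtop (h1.trans_le h2).ne'
      obtain ⟨z, hz, hzs⟩ := Measure.nonempty_inter_support_of_pos h3
      refine ⟨z, hzs, ?_⟩
      rw [Metric.mem_ball] at hxy
      rw [Metric.mem_closedBall] at hz
      calc dist x z ≤ dist x y + dist z y := dist_triangle_right _ _ _
        _ ≤ ε := by linarith
  · have := hclose.trans hμclose
    rwa [add_halves] at this

end DensityCriterion

/-! ### Thickenings of sets of lower Minkowski dimension zero -/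

section Minkowski

variable {d : ℕ}

/-- A lower limit controls only arbitrarily small scales, not all small ones. That is enough, since
`FourierApproximable` asks for a single `r` below each threshold. -/
theorem frequently_volume_thickening_le {K : Set (Torus d)} (hK : lowerMinkowskiDim K = 0) {ε : ℝ}
    (hε : 0 < ε) :
    ∃ᶠ R : ℝ in 𝓝[>] 0, (volume (Metric.thickening R K)).toReal ≤ R ^ ((d : ℝ) - ε) := by
  have h1 : liminf (fun r : ℝ => (d : EReal) -
      ENNReal.log (volume (Metric.thickening r K)) / ((Real.log r : ℝ) : EReal)) (𝓝[>] (0 : ℝ)) <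
      (ε : EReal) := by
    have : lowerMinkowskiDim K < (ε : EReal) := by rw [hK]; exact_mod_cast hε
    exact this
  have h2 := frequently_lt_of_liminf_lt (by isBoundedDefault) h1
  have h3 : ∀ᶠ R : ℝ in 𝓝[>] 0, R ∈ Ioo (0 : ℝ) 1 := Ioo_mem_nhdsGT one_pos
  refine (h2.and_eventually h3).mono fun R ⟨hR, hR0, hR1⟩ => ?_
  set V := volume (Metric.thickening R K) with hV
  by_cases hV0 : V = 0
  · rw [hV0]; simp only [ENNReal.toReal_zero]; positivity
  have hVtop : V ≠ ∞ := measure_ne_top _ _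
  rw [ENNReal.log_pos_real hV0 hVtop] at hR
  have hR' : (d : ℝ) - Real.log V.toReal / Real.log R < ε := by
    have hcast : ((d : ℝ) : EReal) = (d : EReal) := rfl
    rw [← hcast, ← EReal.coe_div, ← EReal.coe_sub] at hR
    exact_mod_cast hR
  have hlog : Real.log R < 0 := Real.log_neg hR0 hR1
  have hVpos : 0 < V.toReal := ENNReal.toReal_pos hV0 hVtop
  have h4 : Real.log V.toReal < ((d : ℝ) - ε) * Real.log R := by
    have : (d : ℝ) - ε < Real.log V.toReal / Real.log R := by linarith
    rwa [lt_div_iff_of_neg hlog] at this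
  rw [← Real.exp_log hVpos, Real.rpow_def_of_pos hR0]
  exact Real.exp_le_exp.mpr (by linarith)

end Minkowski

/-! ### Size, stability and unbiased removal of the bad set -/

section BadSet

variable {d N M : ℕ}

/-- The points `x` with `a x + ∑ⱼ wⱼ X_{κ j} ∈ W` for some choice `κ` of indices. -/
def badSet (a : ℤ) (w : Fin N → ℤ) (W : Set (Torus d)) (X : Fin M → Torus d) : Set (Torus d) :=
  {x | ∃ κ : Fin N → Fin M, a • x + ∑ j, w j • X (κ j) ∈ W}

variable {a : ℤ} {w : Fin N → ℤ} {W : Set (Torus d)}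

theorem isOpen_setOf_mem_badSet (hW : IsOpen W) :
    IsOpen {p : (Fin M → Torus d) × Torus d | p.2 ∈ badSet a w W p.1} := by
  have : {p : (Fin M → Torus d) × Torus d | p.2 ∈ badSet a w W p.1} =
      ⋃ κ : Fin N → Fin M, (fun p : (Fin M → Torus d) × Torus d =>
        a • p.2 + ∑ j, w j • p.1 (κ j)) ⁻¹' W := by
    ext p; simp [badSet]
  rw [this]
  refine isOpen_iUnion fun κ => hW.preimage ?_
  fun_prop

theorem isOpen_badSet (hW : IsOpen W) (X : Fin M → Torus d) : IsOpen (badSet a w W X) :=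
  (isOpen_setOf_mem_badSet hW).preimage (Continuous.prodMk_right X)

theorem volume_setOf_zsmul_add_mem (ha : a ≠ 0) (hW : MeasurableSet W) (y : Torus d) :
    volume {x : Torus d | a • x + y ∈ W} = volume W := by
  have h1 : MeasurePreserving (fun x : Torus d => a • x) volume volume :=
    MeasureTheory.Measure.measurePreserving_zsmul volume ha
  have h2 : MeasurePreserving (fun x : Torus d => x + y) volume volume :=
    measurePreserving_add_right volume y
  exact (h2.comp h1).measure_preimage hW.nullMeasurableSet

theorem measureReal_badSet_le (ha : a ≠ 0) (hW : IsOpen W) (X : Fin M → Torus d) :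
    volume.real (badSet a w W X) ≤ (M : ℝ) ^ N * volume.real W := by
  have : badSet a w W X = ⋃ κ : Fin N → Fin M, {x | a • x + ∑ j, w j • X (κ j) ∈ W} := by
    ext x; simp [badSet]
  rw [this]
  refine (measureReal_iUnion_fintype_le _).trans (le_of_eq ?_)
  simp only [Measure.real, volume_setOf_zsmul_add_mem ha hW.measurableSet]
  simp

/-- At most `N M^(N-1)` index maps use the value `k`; multiplying by `M` avoids the exponent `N -
1`. -/
theorem card_filter_exists_eq_mul_le (k : Fin M) :
    ((Finset.univ.filter fun κ : Fin N → Fin M => ∃ j, κ j = k).card : ℝ) * M ≤ N * (M : ℝ) ^ N := by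
  classical
  have h1 (j : Fin N) : (Finset.univ.filter fun κ : Fin N → Fin M => κ j = k).card * M = M ^ N := by
    have : (Finset.univ.filter fun κ : Fin N → Fin M => κ j = k) =
        Fintype.piFinset (fun l => if l = j then {k} else Finset.univ) := by
      ext κ
      simp only [Finset.mem_filter, Finset.mem_univ, true_and, Fintype.mem_piFinset]
      constructor
      · intro h l
        by_cases hl : l = j
        · subst hl; simp [h]
        · simp [hl]
      · intro h
        simpa using h j
    rw [this, Fintype.card_piFinset, ← Finset.mul_prod_erase _ _ (Finset.mem_univ j)]
    have h2 : ∏ l ∈ Finset.univ.erase j, (if l = j then {k} else (Finset.univ : Finset (Fin M))).card =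
        M ^ (N - 1) := by
      rw [Finset.prod_congr rfl (g := fun _ => M)]
      · simp
      · intro l hl
        simp [Finset.ne_of_mem_erase hl]
    rw [h2]
    have hN : N - 1 + 1 = N := by have := j.pos; omega
    simp only [if_true, Finset.card_singleton, one_mul]
    rw [← pow_succ, hN]
  have h3 : (Finset.univ.filter fun κ : Fin N → Fin M => ∃ j, κ j = k) ⊆
      Finset.univ.biUnion fun j => Finset.univ.filter fun κ : Fin N → Fin M => κ j = k := by
    intro κ hκ
    simpa using hκ
  have h4 : (Finset.univ.filter fun κ : Fin N → Fin M => ∃ j, κ j = k).card * M ≤ N * M ^ N := by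
    calc _ ≤ (∑ j, (Finset.univ.filter fun κ : Fin N → Fin M => κ j = k).card) * M :=
          Nat.mul_le_mul_right _ ((Finset.card_le_card h3).trans Finset.card_biUnion_le)
      _ = _ := by rw [Finset.sum_mul, Finset.sum_congr rfl fun j _ => h1 j]; simp
  exact_mod_cast h4

/-- A point that leaves the bad set when the `k`-th sample point moves was bad through an index map
using `k`, and each index map contributes volume `|W|`. -/
theorem measureReal_badSet_diff_mul_le (ha : a ≠ 0) (hW : IsOpen W) {X X' : Fin M → Torus d}
    {k : Fin M} (h : ∀ j, j ≠ k → X j = X' j) :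
    volume.real (badSet a w W X \ badSet a w W X') * M ≤ N * (M : ℝ) ^ N * volume.real W := by
  classical
  have hsub : badSet a w W X \ badSet a w W X' ⊆
      ⋃ κ ∈ Finset.univ.filter fun κ : Fin N → Fin M => ∃ j, κ j = k,
        {x | a • x + ∑ j, w j • X (κ j) ∈ W} := by
    rintro x ⟨⟨κ, hκ⟩, hx'⟩
    refine mem_iUnion₂.mpr ⟨κ, ?_, hκ⟩
    simp only [Finset.mem_filter, Finset.mem_univ, true_and]
    by_contra! hcon
    refine hx' ⟨κ, ?_⟩
    rwa [Finset.sum_congr rfl fun j _ => by rw [← h (κ j) (hcon j)]]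
  calc _ ≤ ((Finset.univ.filter fun κ : Fin N → Fin M => ∃ j, κ j = k).card * volume.real W) * M := by
        gcongr
        refine (measureReal_mono hsub (measure_ne_top _ _)).trans ((measureReal_biUnion_finset_le _ _).trans (le_of_eq ?_))
        simp only [Measure.real, volume_setOf_zsmul_add_mem ha hW.measurableSet]
        simp
    _ = ((Finset.univ.filter fun κ : Fin N → Fin M => ∃ j, κ j = k).card * M) * volume.real W := by ring
    _ ≤ _ := mul_le_mul_of_nonneg_right (card_filter_exists_eq_mul_le k) measureReal_nonneg

/-- By divisibility of the torus there is `v` with `(∑ wⱼ) v = a (x - x')`. Shifting all sample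
points by `v` preserves their law and exchanges the two events. -/
theorem volume_setOf_mem_badSet_eq (hw : ∑ j, w j ≠ 0) (x x' : Torus d) :
    volume {X : Fin M → Torus d | x ∈ badSet a w W X} =
      volume {X : Fin M → Torus d | x' ∈ badSet a w W X} := by
  set v : Torus d := DivisibleBy.div (a • (x - x')) (∑ j, w j)
  have hv : (∑ j, w j) • v = a • (x - x') := DivisibleBy.div_cancel _ hw
  have hset : {X : Fin M → Torus d | x ∈ badSet a w W X} =
      (fun X => X + fun _ => v) ⁻¹' {X : Fin M → Torus d | x' ∈ badSet a w W X} := by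
    ext X
    simp only [badSet, Set.mem_ofPred_eq, mem_preimage, Pi.add_apply]
    refine exists_congr fun κ => ?_
    have : a • x' + ∑ j, w j • (X (κ j) + v) = a • x + ∑ j, w j • X (κ j) := by
      simp only [smul_add, Finset.sum_add_distrib]
      rw [← Finset.sum_smul, hv, smul_sub]
      abel
    rw [this]
  have : (volume : Measure (Fin M → Torus d)).IsAddRightInvariant :=
    Measure.pi.isAddRightInvariant fun _ : Fin M => (volume : Measure (Torus d))
  rw [hset]
  exact measure_preimage_add_right volume (fun _ => v) _

theorem integral_badSet_indicator_compl_const {c : ℝ} (hW : IsOpen W) (x : Torus d) :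
    ∫ X : Fin M → Torus d, (badSet a w W X)ᶜ.indicator (fun _ => c) x =
      c * (1 - volume.real {X : Fin M → Torus d | x ∈ badSet a w W X}) := by
  have hm : MeasurableSet {X : Fin M → Torus d | x ∈ badSet a w W X} :=
    ((isOpen_setOf_mem_badSet hW).preimage (Continuous.prodMk_left x)).measurableSet
  have : (fun X : Fin M → Torus d => (badSet a w W X)ᶜ.indicator (fun _ => c) x) =
      {X : Fin M → Torus d | x ∈ badSet a w W X}ᶜ.indicator fun _ => c := by
    ext X
    by_cases h : x ∈ badSet a w W X <;> simp [h]
  rw [this, integral_indicator hm.compl, setIntegral_const, smul_eq_mul, probReal_compl_eq_one_sub hm,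
    mul_comm]

/-- The weight used to remove the bad set. Either its mean over the sample is constant by translation
invariance, or the bad set is deterministic and small. -/
theorem exists_weight (hM : 1 ≤ M) (ha : a ≠ 0) (hW : IsOpen W) (hw : ∑ j, w j ≠ 0 ∨ w = 0)
    (hsmall : (M : ℝ) ^ N * volume.real W ≤ 1 / 2) :
    ∃ q : (Fin M → Torus d) → Torus d → ℝ, Measurable (Function.uncurry q) ∧ (∀ X x, 0 ≤ q X x) ∧
      (∀ X x, q X x ≤ 2) ∧
      (∀ (X X' : Fin M → Torus d) (k : Fin M), (∀ j, j ≠ k → X j = X' j) →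
        ∫ x, |q X x - q X' x| ≤ (2 * N : ℝ) / M) ∧
      (∫ x, |∫ X, q X x ∂(Measure.pi fun _ => volume) - 1| ≤ volume.real W) ∧
      ∀ X x, q X x ≠ 0 → x ∉ badSet a w W X := by
  have hM0 : (0 : ℝ) < M := by exact_mod_cast hM
  have hVM : volume.real W ≤ (M : ℝ) ^ N * volume.real W :=
    le_mul_of_one_le_left measureReal_nonneg (one_le_pow₀ (by exact_mod_cast hM))
  -- The weight is `c` off the bad set and `0` on it. Its pointwise bias is bounded by the indicator
  -- of `a x ∈ W`, whose integral is `|W|`; when `∑ wⱼ ≠ 0` the bias is in fact zero.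
  suffices hc : ∃ c : ℝ, 1 ≤ c ∧ c ≤ 2 ∧ ∀ x : Torus d,
      |c * (1 - volume.real {X : Fin M → Torus d | x ∈ badSet a w W X}) - 1| ≤
        {x : Torus d | a • x ∈ W}.indicator 1 x by
    obtain ⟨c, hc1, hc2, hc⟩ := hc
    refine ⟨fun X x => (badSet a w W X)ᶜ.indicator (fun _ => c) x, ?_, ?_, ?_, ?_, ?_, ?_⟩
    · have : (Function.uncurry fun (X : Fin M → Torus d) x => (badSet a w W X)ᶜ.indicator (fun _ => c) x) =
          {p : (Fin M → Torus d) × Torus d | p.2 ∈ badSet a w W p.1}ᶜ.indicator fun _ => c := by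
        ext p
        by_cases h : p.2 ∈ badSet a w W p.1 <;> simp [Function.uncurry, h]
      rw [this]
      exact measurable_const.indicator (isOpen_setOf_mem_badSet hW).measurableSet.compl
    · exact fun X x => indicator_nonneg (fun _ _ => by linarith) x
    · intro X x
      by_cases h : x ∈ badSet a w W X <;> simp [h, hc2]
    · intro X X' k hk
      have hle (x : Torus d) : |(badSet a w W X)ᶜ.indicator (fun _ => c) x -
          (badSet a w W X')ᶜ.indicator (fun _ => c) x| ≤
          2 * ((badSet a w W X \ badSet a w W X').indicator 1 x +
            (badSet a w W X' \ badSet a w W X).indicator 1 x) := by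
        by_cases h1 : x ∈ badSet a w W X <;> by_cases h2 : x ∈ badSet a w W X' <;>
          simp [h1, h2, abs_of_nonneg (by linarith : 0 ≤ c), hc2]
      have hm1 : MeasurableSet (badSet a w W X) := (isOpen_badSet hW X).measurableSet
      have hm2 : MeasurableSet (badSet a w W X') := (isOpen_badSet hW X').measurableSet
      have hi1 : Integrable ((badSet a w W X \ badSet a w W X').indicator (1 : Torus d → ℝ)) volume :=
        (integrable_const 1).indicator (hm1.diff hm2)
      have hi2 : Integrable ((badSet a w W X' \ badSet a w W X).indicator (1 : Torus d → ℝ)) volume :=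
        (integrable_const 1).indicator (hm2.diff hm1)
      have h1 := measureReal_badSet_diff_mul_le (w := w) ha hW hk
      have h2 := measureReal_badSet_diff_mul_le (w := w) ha hW fun j hj => (hk j hj).symm
      calc _ ≤ ∫ x, 2 * ((badSet a w W X \ badSet a w W X').indicator (1 : Torus d → ℝ) x +
            (badSet a w W X' \ badSet a w W X).indicator (1 : Torus d → ℝ) x) := by
            refine integral_mono_of_nonneg (ae_of_all _ fun x => abs_nonneg _)
              ((hi1.add hi2).const_mul 2) (ae_of_all _ hle)
        _ = 2 * (volume.real (badSet a w W X \ badSet a w W X') +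
            volume.real (badSet a w W X' \ badSet a w W X)) := by
            rw [integral_const_mul, integral_add hi1 hi2, integral_indicator_one (hm1.diff hm2),
              integral_indicator_one (hm2.diff hm1)]
        _ ≤ (2 * N : ℝ) / M := by
            rw [le_div_iff₀ hM0]
            have : (N : ℝ) * ((M : ℝ) ^ N * volume.real W) ≤ N * (1 / 2) := by gcongr
            nlinarith
    · have hm : MeasurableSet {x : Torus d | a • x ∈ W} := by
        have : Continuous fun x : Torus d => a • x := by fun_prop
        exact (hW.preimage this).measurableSet
      have hV : volume.real {x : Torus d | a • x ∈ W} = volume.real W := by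
        have := volume_setOf_zsmul_add_mem ha hW.measurableSet (0 : Torus d)
        simp only [add_zero] at this
        rw [Measure.real, this]
        rfl
      rw [← hV, ← integral_indicator_one hm]
      refine integral_mono_of_nonneg (ae_of_all _ fun x => abs_nonneg _)
        ((integrable_const 1).indicator hm) (ae_of_all _ fun x => ?_)
      have e := integral_badSet_indicator_compl_const (M := M) (a := a) (w := w) (c := c) hW x
      rw [volume_pi] at e
      simp only
      rw [e, ← volume_pi]
      exact hc x
    · intro X x hx hbad
      exact hx (by simp [hbad])
  rcases hw with hw | hw
  · set p := volume.real {X : Fin M → Torus d | (0 : Torus d) ∈ badSet a w W X} with hp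
    have hpx (x : Torus d) : volume.real {X : Fin M → Torus d | x ∈ badSet a w W X} = p := by
      rw [hp, Measure.real, Measure.real, volume_setOf_mem_badSet_eq hw]
    -- By Fubini the common probability `p` is the expected volume of the bad set, so `c = (1 -
    -- p)⁻¹` is at most `2`.
    have hp2 : p ≤ 1 / 2 := by
      have hm := (isOpen_setOf_mem_badSet (M := M) (a := a) (w := w) hW).measurableSet
      have h1 : ∫⁻ x : Torus d, volume {X : Fin M → Torus d | x ∈ badSet a w W X} =
          ∫⁻ X : Fin M → Torus d, volume (badSet a w W X) := by
        have e1 := Measure.prod_apply (μ := (volume : Measure (Fin M → Torus d)))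
          (ν := (volume : Measure (Torus d))) hm
        have e2 := Measure.prod_apply_symm (μ := (volume : Measure (Fin M → Torus d)))
          (ν := (volume : Measure (Torus d))) hm
        rw [e1] at e2
        exact e2.symm
      have h2 : ∫⁻ X : Fin M → Torus d, volume (badSet a w W X) ≤ ENNReal.ofReal (1 / 2) := by
        calc _ ≤ ∫⁻ _X : Fin M → Torus d, ENNReal.ofReal (1 / 2) := by
              refine lintegral_mono fun X => ?_
              rw [← ofReal_measureReal]
              exact ENNReal.ofReal_le_ofReal ((measureReal_badSet_le ha hW X).trans hsmall)
          _ = _ := by simp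
      have h3 : ∫⁻ x : Torus d, volume {X : Fin M → Torus d | x ∈ badSet a w W X} = ENNReal.ofReal p := by
        calc _ = ∫⁻ _x : Torus d, ENNReal.ofReal p := by
              refine lintegral_congr fun x => ?_
              rw [← hpx x, ofReal_measureReal]
          _ = _ := by simp
      rw [← h1, h3] at h2
      exact (ENNReal.ofReal_le_ofReal_iff (by norm_num)).mp h2
    have hp0 : 0 ≤ p := measureReal_nonneg
    refine ⟨(1 - p)⁻¹, (one_le_inv₀ (by linarith)).mpr (by linarith), ?_, fun x => ?_⟩
    · rw [inv_le_comm₀ (by linarith) (by norm_num)]; linarith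
    · rw [hpx, inv_mul_cancel₀ (by linarith), sub_self, abs_zero]
      exact indicator_nonneg (fun _ _ => zero_le_one) x
  -- For `w = 0` the bad set is `{x | a • x ∈ W}` whatever the sample, and no rescaling is needed.
  · refine ⟨1, le_rfl, by norm_num, fun x => ?_⟩
    have hb (X : Fin M → Torus d) : x ∈ badSet a w W X ↔ a • x ∈ W := by
      subst hw
      simp only [badSet, Set.mem_ofPred_eq, Pi.zero_apply, zero_smul, Finset.sum_const_zero, add_zero]
      exact ⟨fun ⟨_, h⟩ => h, fun h => ⟨fun _ => ⟨0, hM⟩, h⟩⟩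
    simp only [hb]
    by_cases h : a • x ∈ W
    · simp [h]
    · simp [h]

end BadSet

/-! ### Random samples yield Fourier approximations -/

section SampleCriterion

variable {d : ℕ}

/-- The number of test functions grows like `r^(-3d)`, while the exponent on the right is at least a
quarter of `r^(-(t-l)/2)`, so the exponential wins. -/
theorem eventually_card_mul_le_exp {l t : ℝ} (h : l < t) (d n : ℕ) {K : ℝ} (hK : 0 ≤ K) :
    ∀ᶠ r : ℝ in 𝓝[>] 0, ∀ M : ℕ, r ^ (-t) ≤ M →
      2 * (2 * (2 * (⌈r⁻¹ ^ 3⌉₊ : ℝ) + 1) ^ d + n) * K ≤ Real.exp (Real.sqrt M * (r ^ (l / 2) / 4)) := by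
  set δ := (t - l) / 2 with hδ
  have hδ0 : 0 < δ := by rw [hδ]; linarith
  set C : ℝ := 2 * (2 * 5 ^ d + n) * K
  have h1 := (isLittleO_rpow_exp_pos_mul_atTop (3 * d / δ) (b := 1 / 4) (by norm_num)).const_mul_left C
  have h2 := h1.bound one_pos
  have h3 : Tendsto (fun r : ℝ => r ^ (-δ)) (𝓝[>] 0) atTop := tendsto_rpow_neg_nhdsGT_zero (by linarith)
  have h4 : ∀ᶠ r : ℝ in 𝓝[>] 0, r ∈ Ioo (0 : ℝ) 1 := Ioo_mem_nhdsGT one_pos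
  filter_upwards [h3.eventually h2, h4] with r hr ⟨hr0, hr1⟩ M hM
  have hx : 1 ≤ r⁻¹ := (one_le_inv₀ hr0).mpr hr1.le
  have hx3 : 1 ≤ r⁻¹ ^ 3 := one_le_pow₀ hx
  have hceil : (⌈r⁻¹ ^ 3⌉₊ : ℝ) ≤ r⁻¹ ^ 3 + 1 := (Nat.ceil_lt_add_one (by positivity)).le
  have hpow : (r ^ (-δ)) ^ (3 * d / δ) = (r⁻¹ ^ 3) ^ d := by
    rw [← Real.rpow_mul hr0.le, ← pow_mul, ← Real.rpow_natCast, Real.inv_rpow hr0.le,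
      ← Real.rpow_neg hr0.le]
    congr 1
    field_simp
    push_cast
    ring
  rw [hpow, one_mul, Real.norm_eq_abs, Real.norm_eq_abs, Real.abs_exp] at hr
  have hle : 2 * (2 * (2 * (⌈r⁻¹ ^ 3⌉₊ : ℝ) + 1) ^ d + n) * K ≤ C * (r⁻¹ ^ 3) ^ d := by
    have e1 : (2 * (⌈r⁻¹ ^ 3⌉₊ : ℝ) + 1) ^ d ≤ (5 * r⁻¹ ^ 3) ^ d := by
      gcongr
      linarith
    have e2 : (n : ℝ) ≤ n * (r⁻¹ ^ 3) ^ d := le_mul_of_one_le_right (by positivity) (one_le_pow₀ hx3)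
    calc _ ≤ 2 * (2 * (5 * r⁻¹ ^ 3) ^ d + n * (r⁻¹ ^ 3) ^ d) * K := by gcongr
      _ = _ := by rw [mul_pow]; ring
  refine hle.trans ((le_abs_self _).trans (hr.trans (Real.exp_le_exp.mpr ?_)))
  have hsq : r ^ (-t / 2) ≤ Real.sqrt M := by
    refine Real.le_sqrt_of_sq_le (le_trans (le_of_eq ?_) hM)
    rw [← Real.rpow_natCast, ← Real.rpow_mul hr0.le]
    congr 1
    push_cast
    ring
  calc 1 / 4 * r ^ (-δ) = r ^ (-t / 2) * (r ^ (l / 2) / 4) := by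
        rw [← mul_div_assoc, ← Real.rpow_add hr0, hδ]
        ring_nf
    _ ≤ _ := by gcongr

variable {M : ℕ} {f : Torus d → ℝ} {Q : Set (Torus d)} {q : (Fin M → Torus d) → Torus d → ℝ} {L : ℝ}

theorem fourierMeasure_eq_re_im (μ : Measure (Torus d)) [IsFiniteMeasure μ] (ξ : Fin d → ℤ) :
    fourierMeasure μ ξ = ((∫ x, (UnitAddTorus.mFourier (-ξ) x).re ∂μ : ℝ) : ℂ) +
      ((∫ x, (UnitAddTorus.mFourier (-ξ) x).im ∂μ : ℝ) : ℂ) * Complex.I := by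
  rw [fourierMeasure]
  exact (integral_re_add_im (𝕜 := ℂ) (integrable_mFourier (-ξ) μ)).symm

theorem withDensity_ofReal_isFiniteMeasure (hL : ∀ x, f x ≤ L) :
    IsFiniteMeasure (volume.withDensity fun x => ENNReal.ofReal (f x)) := by
  refine isFiniteMeasure_withDensity (ne_top_of_le_ne_top ?_
    (lintegral_mono (g := fun _ => ENNReal.ofReal L) fun x => ENNReal.ofReal_le_ofReal (hL x)))
  simp

theorem integral_withDensity_ofReal (hf : Measurable f) (h0 : ∀ x, 0 ≤ f x) (h : Torus d → ℝ) :
    ∫ x, h x ∂(volume.withDensity fun x => ENNReal.ofReal (f x)) = ∫ x, f x * h x := by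
  rw [integral_withDensity_eq_integral_toReal_smul]
  · refine integral_congr_ae (ae_of_all _ fun x => ?_)
    simp only
    rw [ENNReal.toReal_ofReal (h0 x), smul_eq_mul]
  · exact ENNReal.measurable_ofReal.comp hf
  · exact ae_of_all _ fun x => ENNReal.ofReal_lt_top

/-- The test functions are the real and imaginary parts of the characters in a frequency box and the
indicators of the balls. Adding the real and imaginary errors gives the factor `2`. -/
theorem exists_sampleMeasure_close (hM : 1 ≤ M) (hf : Measurable f) (h0 : ∀ x, 0 ≤ f x)
    (hL : ∀ x, f x ≤ L) (hQ : MeasurableSet Q) (hq : Measurable (Function.uncurry q))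
    (hq0 : ∀ X x, 0 ≤ q X x) (hq2 : ∀ X x, q X x ≤ 2) {D b : ℝ}
    (hD : ∀ (X X' : Fin M → Torus d) (k : Fin M), (∀ j, j ≠ k → X j = X' j) →
      ∫ x, |q X x - q X' x| ≤ D / M)
    (hb : ∫ x, |∫ X, q X x ∂(Measure.pi fun _ => volume) - 1| ≤ b)
    (F : Finset (Torus d)) (ρ : ℝ) {N : ℕ} {a : ℝ}
    (ha : 2 * (2 * (2 * (N : ℝ) + 1) ^ d + F.card) * Real.exp ((L * (2 + D)) ^ 2 / 2) ≤
      Real.exp (Real.sqrt M * a)) :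
    ∃ X : Fin M → Torus d,
      (∀ ξ, freqNorm ξ ≤ N → ‖fourierMeasure (sampleMeasure f Q q X) ξ -
        fourierMeasure (volume.withDensity fun x => ENNReal.ofReal (f x)) ξ‖ ≤ 2 * (a + L * b)) ∧
      ∀ y ∈ F, (volume.withDensity fun x => ENNReal.ofReal (f x)).real (Metric.closedBall y ρ) ≤
        (sampleMeasure f Q q X).real (Metric.closedBall y ρ) + (a + L * b) := by
  classical
  set h : (freqBox d N ⊕ freqBox d N) ⊕ F → Torus d → ℝ := Sum.elim
    (Sum.elim (fun ξ x => (UnitAddTorus.mFourier (-ξ.1) x).re)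
      (fun ξ x => (UnitAddTorus.mFourier (-ξ.1) x).im))
    (fun y => (Metric.closedBall y.1 ρ).indicator 1) with hh
  have hmeas : ∀ i, Measurable (h i) := by
    rintro ((ξ | ξ) | y)
    · exact Complex.measurable_re.comp (UnitAddTorus.mFourier (-ξ.1)).continuous.measurable
    · exact Complex.measurable_im.comp (UnitAddTorus.mFourier (-ξ.1)).continuous.measurable
    · exact measurable_one.indicator Metric.isClosed_closedBall.measurableSet
  have hbd : ∀ i x, |h i x| ≤ 1 := by
    rintro ((ξ | ξ) | y) x
    · exact (Complex.abs_re_le_norm _).trans (norm_mFourier_apply _ _).le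
    · exact (Complex.abs_im_le_norm _).trans (norm_mFourier_apply _ _).le
    · by_cases hx : x ∈ Metric.closedBall y.1 ρ
      · simp only [hh, Sum.elim_inr, indicator_of_mem hx]; simp
      · simp only [hh, Sum.elim_inr, indicator_of_notMem hx]; simp
  have hcard : (Fintype.card ((freqBox d N ⊕ freqBox d N) ⊕ F) : ℝ) = 2 * (2 * (N : ℝ) + 1) ^ d + F.card := by
    simp only [Fintype.card_sum, Fintype.card_coe, card_freqBox]
    push_cast
    ring
  obtain ⟨X, hX⟩ := exists_sample hM hf h0 hL hQ hq hq0 hq2 hD hb h hmeas hbd (a := a) (by rwa [hcard])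
  have hfin := sampleMeasure_isFiniteMeasure (Q := Q) h0 hL hq0 hq2 X
  have hfin' := withDensity_ofReal_isFiniteMeasure hL
  have hX' (i) : |∫ x, h i x ∂(sampleMeasure f Q q X) -
      ∫ x, h i x ∂(volume.withDensity fun x => ENNReal.ofReal (f x))| ≤ a + L * b := by
    rw [integral_sampleMeasure hf h0 hL hQ hq hq0 hq2 (hmeas i) (hbd i), integral_withDensity_ofReal hf h0]
    exact hX i
  refine ⟨X, fun ξ hξ => ?_, fun y hy => ?_⟩
  · have hξ' := mem_freqBox hξ
    have h1 := hX' (Sum.inl (Sum.inl ⟨ξ, hξ'⟩))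
    have h2 := hX' (Sum.inl (Sum.inr ⟨ξ, hξ'⟩))
    simp only [hh, Sum.elim_inl, Sum.elim_inr] at h1 h2
    rw [fourierMeasure_eq_re_im, fourierMeasure_eq_re_im]
    refine (Complex.norm_le_abs_re_add_abs_im _).trans ?_
    simp only [Complex.sub_re, Complex.add_re, Complex.ofReal_re, Complex.mul_re, Complex.I_re, mul_zero,
      Complex.ofReal_im, Complex.I_im, mul_one, sub_self, add_zero, Complex.sub_im, Complex.add_im,
      Complex.mul_im, zero_add]
    linarith
  · have h1 := hX' (Sum.inr ⟨y, hy⟩)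
    simp only [hh, Sum.elim_inr] at h1
    rw [integral_indicator_one Metric.isClosed_closedBall.measurableSet,
      integral_indicator_one Metric.isClosed_closedBall.measurableSet] at h1
    linarith [(abs_le.mp h1).1]

theorem sampleMeasure_compl_eq_zero (hf : Measurable f) (hQ : MeasurableSet Q)
    (hq : Measurable (Function.uncurry q)) {X : Fin M → Torus d} {G : Set (Torus d)}
    (h1 : ∀ k, X k ∉ Q → f (X k) ≠ 0 → X k ∈ G) (h2 : ∀ x ∈ Q, f x ≠ 0 → q X x ≠ 0 → x ∈ G) :
    sampleMeasure f Q q X Gᶜ = 0 := by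
  have hqX : Measurable (q X) := hq.comp measurable_prodMk_left
  rw [sampleMeasure, Measure.add_apply, add_eq_zero]
  constructor
  · rw [Measure.finsetSum_apply, Finset.sum_eq_zero_iff]
    intro k _
    rw [Measure.smul_apply, smul_eq_mul, mul_eq_zero]
    by_cases hk : X k ∉ Q ∧ f (X k) ≠ 0
    · right
      have hG := h1 k hk.1 hk.2
      have hs : Gᶜ ⊆ ({X k} : Set (Torus d))ᶜ := fun x hx hxk => hx (by rw [mem_singleton_iff.mp hxk]; exact hG)
      exact measure_mono_null hs (by simp)
    · left
      have : Qᶜ.indicator f (X k) = 0 := by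
        by_cases hkQ : X k ∈ Q
        · simp [hkQ]
        · have : f (X k) = 0 := by by_contra h; exact hk ⟨hkQ, h⟩
          simp [hkQ, this]
      simp [this]
  · have hm : Measurable fun x => ENNReal.ofReal (Q.indicator f x * q X x) :=
      ENNReal.measurable_ofReal.comp ((hf.indicator hQ).mul hqX)
    rw [withDensity_apply_eq_zero hm]
    convert measure_empty (μ := (volume : Measure (Torus d)))
    refine eq_empty_of_forall_notMem fun x ⟨hx, hxG⟩ => hxG ?_
    have hne : Q.indicator f x * q X x ≠ 0 := fun h => hx (by simp [h])
    have hxQ : x ∈ Q := by by_contra h; exact hne (by simp [h])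
    rw [indicator_of_mem hxQ] at hne
    exact h2 x hxQ (left_ne_zero_of_mul hne) (right_ne_zero_of_mul hne)

/-- Random discretisation outside `Q`, combined with a weight on `Q`, yields Fourier approximations. -/
theorem fourierApproximable_of_weight {β : ℝ} {𝒰 : Set (Set (Torus d))} (hQ : MeasurableSet Q) {D : ℝ}
    (H : ∀ u, 0 < u → u < β → ∀ l < u, ∀ L : ℝ, 0 ≤ L → ∃ᶠ r : ℝ in 𝓝[>] 0, ∃ M : ℕ, r ^ (-u) ≤ M ∧
      ∃ q : (Fin M → Torus d) → Torus d → ℝ, Measurable (Function.uncurry q) ∧ (∀ X x, 0 ≤ q X x) ∧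
      (∀ X x, q X x ≤ 2) ∧
      (∀ (X X' : Fin M → Torus d) (k : Fin M), (∀ j, j ≠ k → X j = X' j) →
        ∫ x, |q X x - q X' x| ≤ D / M) ∧
      ∃ b, (∫ x, |∫ X, q X x ∂(Measure.pi fun _ => volume) - 1| ≤ b) ∧ L * b ≤ r ^ (l / 2) / 4 ∧
      ∀ X, Metric.thickening (2 * r) ({x | ∃ k, X k = x ∧ x ∉ Q} ∪ {x | x ∈ Q ∧ q X x ≠ 0}) ∈ 𝒰) :
    FourierApproximable d β 𝒰 := by
  intro t ht htβ
  obtain ⟨u, htu, huβ⟩ := exists_between htβ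
  obtain ⟨l, htl, hlu⟩ := exists_between htu
  refine ⟨l, htl, fun f L hf h0 hL F ρ ε r₀ hε hr₀ => ?_⟩
  have hL0 : 0 ≤ L := (h0 0).trans (hL 0)
  have e1 := eventually_card_mul_le_exp hlu d F.card (K := Real.exp ((L * (2 + D)) ^ 2 / 2))
    (Real.exp_nonneg _)
  have e2 : ∀ᶠ r : ℝ in 𝓝[>] 0, r ∈ Ioc (0 : ℝ) r₀ := Ioc_mem_nhdsGT hr₀
  have e3 : ∀ᶠ r : ℝ in 𝓝[>] 0, r ^ (l / 2) < ε := by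
    have h1 : Tendsto (fun r : ℝ => r ^ (l / 2)) (𝓝 0) (𝓝 ((0 : ℝ) ^ (l / 2))) :=
      (Real.continuousAt_rpow_const 0 (l / 2) (Or.inr (by linarith))).tendsto
    rw [Real.zero_rpow (by linarith)] at h1
    exact (h1.mono_left nhdsWithin_le_nhds).eventually (gt_mem_nhds hε)
  obtain ⟨r, ⟨⟨⟨M, hMr, q, hq, hq0, hq2, hD, b, hb, hbl, hG⟩, hr1⟩, hr0, hrr⟩, hrε⟩ :=
    (((H u (by linarith) huβ l hlu L hL0).and_eventually e1).and_eventually e2).and_eventually e3 |>.exists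
  have hM : 1 ≤ M := by
    have : (0 : ℝ) < M := (Real.rpow_pos_of_pos hr0 _).trans_le hMr
    exact_mod_cast this
  -- Fluctuation and bias are each at most `r^(l/2) / 4`, so twice their sum is the permitted
  -- `r^(l/2)`.
  obtain ⟨X, hX1, hX2⟩ := exists_sampleMeasure_close hM hf h0 hL hQ hq hq0 hq2 hD hb F ρ (hr1 M hMr)
  have hpos : 0 < r ^ (l / 2) := Real.rpow_pos_of_pos hr0 _
  refine ⟨r, hr0, hrr, sampleMeasure f Q q X, sampleMeasure_isFiniteMeasure h0 hL hq0 hq2 X, ?_, ?_, ?_,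
    _, ?_, hG X⟩
  · have : {x | f x = 0} = {x | f x ≠ 0}ᶜ := by ext x; simp
    rw [this]
    exact sampleMeasure_compl_eq_zero hf hQ hq (fun _ _ h => h) fun _ _ h _ => h
  · intro ξ hξ
    refine (hX1 ξ (hξ.trans (Nat.le_ceil _))).trans ?_
    linarith
  · intro y hy
    refine (hX2 y hy).trans ?_
    linarith
  · exact sampleMeasure_compl_eq_zero hf hQ hq (fun k hk _ => Or.inl ⟨k, rfl, hk⟩)
      fun x hx _ hqx => Or.inr ⟨hx, hqx⟩

end SampleCriterion

/-! ### Generic coverings and generic avoidance -/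

section Applications

variable {d : ℕ} {β : ℝ}

theorem tendsto_const_mul_rpow_nhdsGT_zero (C : ℝ) {e : ℝ} (he : 0 < e) :
    Tendsto (fun r : ℝ => C * r ^ e) (𝓝[>] 0) (𝓝 0) := by
  have h1 : Tendsto (fun r : ℝ => r ^ e) (𝓝 0) (𝓝 ((0 : ℝ) ^ e)) :=
    (Real.continuousAt_rpow_const 0 e (Or.inr he.le)).tendsto
  rw [Real.zero_rpow he.ne'] at h1
  simpa using (h1.mono_left nhdsWithin_le_nhds).const_mul C

theorem natCeil_rpow_neg_le {r u : ℝ} (hr : 0 < r) (hr1 : r ≤ 1) (hu : 0 ≤ u) :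
    (⌈r ^ (-u)⌉₊ : ℝ) ≤ 2 * r ^ (-u) := by
  have h1 : 1 ≤ r ^ (-u) := Real.one_le_rpow_of_pos_of_le_one_of_nonpos hr hr1 (by linarith)
  linarith [(Nat.ceil_lt_add_one (zero_le_one.trans h1)).le]

/-- Open sets covered by few closed balls of a small radius. -/
def efficientlyCovered (d : ℕ) (s δ : ℝ) : Set (Set (Torus d)) :=
  {U | IsOpen U ∧ ∃ (F : Finset (Torus d)) (r : ℝ), 0 < r ∧ r < δ ∧
    U ⊆ ⋃ x ∈ F, Metric.closedBall x r ∧ F.card * r ^ s < δ}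

/-- Nothing has to be avoided, so `Q` is empty and the weight is trivial. About `r^(-u)` balls of
radius `2r` cover the thickened sample, and `u < β < s` makes `r^(s-u)` tend to zero. -/
theorem fourierApproximable_efficientlyCovered {s δ : ℝ} (hs : β < s) (hδ : 0 < δ) :
    FourierApproximable d β (efficientlyCovered d s δ) := by
  refine fourierApproximable_of_weight (Q := ∅) MeasurableSet.empty (D := 0) ?_
  intro u hu huβ l hl L hL
  have hus : 0 < s - u := by linarith
  have e1 := (tendsto_const_mul_rpow_nhdsGT_zero (2 * 2 ^ s) hus).eventually (gt_mem_nhds hδ)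
  have e2 : ∀ᶠ r : ℝ in 𝓝[>] 0, r ∈ Ioo (0 : ℝ) (min 1 (δ / 2)) :=
    Ioo_mem_nhdsGT (lt_min one_pos (by positivity))
  refine (e1.and e2).frequently.mono fun r ⟨hr, hr0, hr1⟩ => ?_
  have hr1' : r ≤ 1 := hr1.le.trans (min_le_left _ _)
  have hrδ : r < δ / 2 := hr1.trans_le (min_le_right _ _)
  refine ⟨⌈r ^ (-u)⌉₊, Nat.le_ceil _, fun _ _ => 1, measurable_const, fun _ _ => zero_le_one,
    fun _ _ => one_le_two, fun _ _ _ _ => by simp, 0, by simp, by rw [mul_zero]; positivity, fun X => ?_⟩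
  classical
  refine ⟨Metric.isOpen_thickening, Finset.univ.image X, 2 * r, by positivity, by linarith, ?_, ?_⟩
  · intro x hx
    obtain ⟨z, hz, hxz⟩ := Metric.mem_thickening_iff.mp hx
    rcases hz with ⟨k, rfl, -⟩ | ⟨hz, -⟩
    · exact mem_iUnion₂.mpr ⟨X k, by simp, hxz.le⟩
    · exact hz.elim
  · have hcard : ((Finset.univ.image X).card : ℝ) ≤ 2 * r ^ (-u) := by
      refine le_trans ?_ (natCeil_rpow_neg_le hr0 hr1' hu.le)
      exact_mod_cast Finset.card_image_le.trans (by simp)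
    calc _ ≤ 2 * r ^ (-u) * (2 * r) ^ s := by gcongr
      _ = 2 * 2 ^ s * r ^ (s - u) := by
        rw [Real.mul_rpow (by norm_num) hr0.le, sub_eq_add_neg, Real.rpow_add hr0]
        ring
      _ < δ := hr

theorem hausdorffMeasure_le_of_efficientlyCovered {E : Set (Torus d)} {s : ℝ} (hs : 0 < s)
    (h : ∀ k : ℕ, ∃ U ∈ efficientlyCovered d s (1 / (k + 1 : ℝ)), E ⊆ U) :
    Measure.hausdorffMeasure s E ≤ ENNReal.ofReal (2 ^ s) := by
  choose U hU hEU using h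
  choose hUo F r hr0 hr hcov hcard using hU
  have hdiam (k : ℕ) (x : Torus d) : Metric.ediam (Metric.closedBall x (r k)) ≤ ENNReal.ofReal (2 * r k) := by
    refine Metric.ediam_le_of_forall_dist_le fun y hy z hz => ?_
    rw [Metric.mem_closedBall] at hy hz
    linarith [dist_triangle_right y z x]
  have hlim : Tendsto (fun k : ℕ => ENNReal.ofReal (2 * (1 / (k + 1 : ℝ)))) atTop (𝓝 0) := by
    have := (tendsto_one_div_add_atTop_nhds_zero_nat (𝕜 := ℝ)).const_mul 2
    rw [mul_zero] at this
    simpa using ENNReal.tendsto_ofReal this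
  have := Measure.hausdorffMeasure_le_liminf_sum (X := Torus d) (ι := fun k => F k) s E
    (fun k : ℕ => ENNReal.ofReal (2 * (1 / (k + 1 : ℝ)))) hlim
    (fun k x => Metric.closedBall x.1 (r k))
    (Eventually.of_forall fun k x => (hdiam k x).trans (ENNReal.ofReal_le_ofReal (by linarith [hr k])))
    (Eventually.of_forall fun k => (hEU k).trans ((hcov k).trans (by
      intro x hx
      obtain ⟨y, hy, hxy⟩ := mem_iUnion₂.mp hx
      exact mem_iUnion.mpr ⟨⟨y, hy⟩, hxy⟩)))
  refine this.trans ?_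
  refine (liminf_le_liminf (v := fun _ => ENNReal.ofReal (2 ^ s)) (Eventually.of_forall fun k => ?_)).trans
    (by simp)
  calc _ ≤ ∑ _x : F k, ENNReal.ofReal (2 * r k) ^ s := by
        refine Finset.sum_le_sum fun x _ => ?_
        gcongr
        exact hdiam k x
    _ = ENNReal.ofReal (2 ^ s * ((F k).card * r k ^ s)) := by
        rw [ENNReal.ofReal_rpow_of_nonneg (by linarith [hr0 k]) hs.le, Finset.sum_const, Finset.card_univ,
          Fintype.card_coe, nsmul_eq_mul, ← ENNReal.ofReal_natCast, ← ENNReal.ofReal_mul (by positivity),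
          Real.mul_rpow (by norm_num) (hr0 k).le]
        ring_nf
    _ ≤ _ := by
        refine ENNReal.ofReal_le_ofReal ?_
        have h1 : (1 : ℝ) / (k + 1) ≤ 1 := by
          rw [div_le_one (by positivity)]
          linarith [(Nat.cast_nonneg k : (0 : ℝ) ≤ k)]
        have := (hcard k).le.trans h1
        have h2 : (0 : ℝ) < 2 ^ s := by positivity
        nlinarith

theorem dimH_le_of_efficientlyCovered (hβ : 0 < β) {E : Set (Torus d)}
    (h : ∀ j k : ℕ, ∃ U ∈ efficientlyCovered d (β + 1 / (j + 1 : ℝ)) (1 / (k + 1 : ℝ)), E ⊆ U) :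
    dimH E ≤ ENNReal.ofReal β := by
  have hle (j : ℕ) : dimH E ≤ ENNReal.ofReal (β + 1 / (j + 1 : ℝ)) := by
    have hs : 0 < β + 1 / (j + 1 : ℝ) := by positivity
    have h1 := hausdorffMeasure_le_of_efficientlyCovered hs (h j)
    refine dimH_le_of_hausdorffMeasure_ne_top (d := Real.toNNReal (β + 1 / (j + 1 : ℝ))) ?_
    rw [Real.coe_toNNReal _ hs.le]
    exact ne_top_of_le_ne_top ENNReal.ofReal_ne_top h1
  have hlim : Tendsto (fun j : ℕ => ENNReal.ofReal (β + 1 / (j + 1 : ℝ))) atTop (𝓝 (ENNReal.ofReal β)) := by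
    have := (tendsto_one_div_add_atTop_nhds_zero_nat (𝕜 := ℝ)).const_add β
    rw [add_zero] at this
    exact ENNReal.tendsto_ofReal this
  exact ge_of_tendsto' hlim hle

/-- Open sets without solutions of `a x + ∑ⱼ wⱼ yⱼ ∈ K` such that `x` is close to `c` and all `yⱼ` are far
from `c`. -/
def separatedSolutionFree {N : ℕ} (K : Set (Torus d)) (a : ℤ) (w : Fin N → ℤ) (c : Torus d) (ρ : ℝ) :
    Set (Set (Torus d)) :=
  {U | IsOpen U ∧ ∀ x ∈ U, ∀ y : Fin N → Torus d, (∀ j, y j ∈ U) → x ∈ Metric.closedBall c ρ →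
    (∀ j, y j ∉ Metric.ball c (3 * ρ)) → a • x + ∑ j, w j • y j ∉ K}

theorem dist_zsmul_add_sum_le {N : ℕ} (a : ℤ) (w : Fin N → ℤ) {x x' : Torus d} {y y' : Fin N → Torus d}
    {η : ℝ} (hx : dist x x' ≤ η) (hy : ∀ j, dist (y j) (y' j) ≤ η) :
    dist (a • x + ∑ j, w j • y j) (a • x' + ∑ j, w j • y' j) ≤ (|(a : ℝ)| + ∑ j, |(w j : ℝ)|) * η := by
  have h1 (m : ℤ) {z z' : Torus d} (hz : dist z z' ≤ η) : dist (m • z) (m • z') ≤ |(m : ℝ)| * η := by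
    rw [dist_eq_norm, ← smul_sub]
    refine (norm_zsmul_le m _).trans ?_
    rw [← dist_eq_norm, Int.norm_eq_abs]
    gcongr
  refine (dist_add_add_le _ _ _ _).trans ?_
  rw [add_mul, Finset.sum_mul]
  exact add_le_add (h1 a hx) (dist_sum_sum_le_of_le _ fun j _ => h1 (w j) (hy j))

/-- The variable near `c` ranges over the density part in `Q` and the others over sample points
outside `Q`. Deleting the bad set of a thickening of `K` therefore rules out solutions even after
thickening by `2r`. -/
theorem fourierApproximable_separatedSolutionFree {N : ℕ} (hN : 1 ≤ N) (hNβ : N * β ≤ d) {K : Set (Torus d)}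
    (hK : lowerMinkowskiDim K = 0) {a : ℤ} (ha : a ≠ 0) {w : Fin N → ℤ} (hw : ∑ j, w j ≠ 0 ∨ w = 0)
    (c : Torus d) {ρ : ℝ} (hρ : 0 < ρ) :
    FourierApproximable d β (separatedSolutionFree K a w c ρ) := by
  refine fourierApproximable_of_weight (Q := Metric.closedBall c (2 * ρ))
    Metric.isClosed_closedBall.measurableSet (D := 2 * N) ?_
  intro u hu huβ l hl L hL
  have hN1 : (1 : ℝ) ≤ N := by exact_mod_cast hN
  have hNu : N * u < d := (mul_lt_mul_of_pos_left huβ (by linarith)).trans_le hNβ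
  -- Half of the room in `N u < d` goes to the thickening of `K`; the other half leaves `M^N |W|` of
  -- order `r^ε`.
  set ε := (d - N * u) / 2 with hε
  have hε0 : 0 < ε := by rw [hε]; linarith
  -- Moving every variable by at most `2r` moves the linear combination by less than `A r`.
  set A : ℝ := 2 * (|(a : ℝ)| + ∑ j, |(w j : ℝ)| + 1)
  have hA : 0 < A := by positivity
  have hscale : Tendsto (fun R : ℝ => R / A) (𝓝[>] 0) (𝓝[>] 0) := by
    refine tendsto_nhdsWithin_iff.mpr ⟨?_, ?_⟩
    · have : Tendsto (fun R : ℝ => R / A) (𝓝 0) (𝓝 (0 / A)) := (continuous_id.div_const A).tendsto 0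
      rw [zero_div] at this
      exact this.mono_left nhdsWithin_le_nhds
    · filter_upwards [self_mem_nhdsWithin] with R hR
      exact div_pos hR hA
  have hfreq : ∃ᶠ r : ℝ in 𝓝[>] 0,
      (volume (Metric.thickening (A * r) K)).toReal ≤ (A * r) ^ ((d : ℝ) - ε) := by
    refine hscale.frequently ((frequently_volume_thickening_le hK hε0).mono fun R hR => ?_)
    rwa [mul_div_cancel₀ _ hA.ne']
  have hdl : 0 < d - ε - l / 2 := by
    have : u ≤ N * u := le_mul_of_one_le_left hu.le hN1
    rw [hε]; linarith
  have e1 := (tendsto_const_mul_rpow_nhdsGT_zero (2 ^ N * A ^ ((d : ℝ) - ε)) hε0).eventually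
    (gt_mem_nhds (by norm_num : (0 : ℝ) < 1 / 2))
  have e2 := (tendsto_const_mul_rpow_nhdsGT_zero (L * A ^ ((d : ℝ) - ε)) hdl).eventually
    (gt_mem_nhds (by norm_num : (0 : ℝ) < 1 / 4))
  have e3 : ∀ᶠ r : ℝ in 𝓝[>] 0, r ∈ Ioo (0 : ℝ) (min 1 (ρ / 2)) :=
    Ioo_mem_nhdsGT (lt_min one_pos (by positivity))
  refine (((hfreq.and_eventually e1).and_eventually e2).and_eventually e3).mono
    fun r ⟨⟨⟨hV, hr1⟩, hr2⟩, hr0, hr3⟩ => ?_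
  have hrle1 : r ≤ 1 := hr3.le.trans (min_le_left _ _)
  have hrρ : 2 * r < ρ := by linarith [hr3.trans_le (min_le_right _ _)]
  set W := Metric.thickening (A * r) K with hWdef
  have hW : IsOpen W := Metric.isOpen_thickening
  set M := ⌈r ^ (-u)⌉₊
  have hMr : r ^ (-u) ≤ M := Nat.le_ceil _
  have hM2 : (M : ℝ) ≤ 2 * r ^ (-u) := natCeil_rpow_neg_le hr0 hrle1 hu.le
  have hM : 1 ≤ M := by
    have : (0 : ℝ) < M := (Real.rpow_pos_of_pos hr0 _).trans_le hMr
    exact_mod_cast this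
  have hVr : volume.real W ≤ A ^ ((d : ℝ) - ε) * r ^ ((d : ℝ) - ε) := by
    rw [← Real.mul_rpow hA.le hr0.le]
    exact hV
  have hsmall : (M : ℝ) ^ N * volume.real W ≤ 1 / 2 := by
    calc _ ≤ (2 * r ^ (-u)) ^ N * (A ^ ((d : ℝ) - ε) * r ^ ((d : ℝ) - ε)) := by gcongr
      _ = 2 ^ N * A ^ ((d : ℝ) - ε) * r ^ ε := by
        rw [mul_pow, ← Real.rpow_natCast (r ^ (-u)), ← Real.rpow_mul hr0.le]
        have : r ^ ε = r ^ (-u * N) * r ^ ((d : ℝ) - ε) := by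
          rw [← Real.rpow_add hr0]
          congr 1
          rw [hε]; ring
        rw [this]
        ring
      _ ≤ _ := hr1.le
  obtain ⟨q, hq, hq0, hq2, hD, hb, hbad⟩ := exists_weight hM ha hW hw hsmall
  refine ⟨M, hMr, q, hq, hq0, hq2, hD, _, hb, ?_, fun X => ⟨Metric.isOpen_thickening, ?_⟩⟩
  · calc _ ≤ L * (A ^ ((d : ℝ) - ε) * r ^ ((d : ℝ) - ε)) := by gcongr
      _ = L * A ^ ((d : ℝ) - ε) * r ^ ((d : ℝ) - ε - l / 2) * r ^ (l / 2) := by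
        rw [mul_assoc _ (r ^ _) (r ^ _), ← Real.rpow_add hr0]
        ring_nf
      _ ≤ 1 / 4 * r ^ (l / 2) := by gcongr
      _ = _ := by ring
  · intro x hx y hy hxc hyc hmem
    obtain ⟨g, hg, hxg⟩ := Metric.mem_thickening_iff.mp hx
    -- Since `2r < ρ`, the point `g` near `x` lies within `2ρ` of `c`, hence in `Q`. So it belongs
    -- to the weighted part, where bad points have weight zero.
    have hgb : g ∉ badSet a w W X := by
      rcases hg with ⟨k, -, hgQ⟩ | ⟨-, hgq⟩
      · refine absurd ?_ hgQ
        rw [Metric.mem_closedBall] at hxc ⊢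
        linarith [dist_triangle_left g c x]
      · exact hbad X g hgq
    -- A point outside the `3ρ`-ball cannot be `2r`-close to `Q`, so it is close to a sample point.
    have hκ (j : Fin N) : ∃ k, dist (y j) (X k) < 2 * r := by
      obtain ⟨z, hz, hyz⟩ := Metric.mem_thickening_iff.mp (hy j)
      rcases hz with ⟨k, rfl, -⟩ | ⟨hzQ, -⟩
      · exact ⟨k, hyz⟩
      · refine absurd ?_ (hyc j)
        rw [Metric.mem_closedBall] at hzQ
        rw [Metric.mem_ball]
        linarith [dist_triangle (y j) z c]
    choose κ hκ using hκ
    refine hgb ⟨κ, Metric.mem_thickening_iff.mpr ⟨_, hmem, ?_⟩⟩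
    refine (dist_zsmul_add_sum_le a w (η := 2 * r) (by rw [dist_comm]; exact hxg.le)
      fun j => by rw [dist_comm]; exact (hκ j).le).trans_lt ?_
    calc _ < (|(a : ℝ)| + ∑ j, |(w j : ℝ)| + 1) * (2 * r) :=
          mul_lt_mul_of_pos_right (lt_add_one _) (by positivity)
      _ = A * r := by ring

/-- Otherwise every nonzero coefficient equals the total sum, so all nonzero coefficients are equal.
Those other than `m i` then cannot add up to zero unless they are all absent. -/
theorem exists_ne_zero_sum_succAbove {N : ℕ} {m : Fin (N + 1) → ℤ} (hm : m ≠ 0) :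
    ∃ i, m i ≠ 0 ∧ (∑ j, m (i.succAbove j) ≠ 0 ∨ (fun j => m (i.succAbove j)) = 0) := by
  by_contra! hcon
  obtain ⟨i, hi⟩ := Function.ne_iff.mp hm
  have hall (k : Fin (N + 1)) (hk : m k ≠ 0) : m k = ∑ j, m j := by
    rw [Fin.sum_univ_succAbove m k, (hcon k hk).1, add_zero]
  have hi' := hall i hi
  refine (hcon i hi).2 (funext fun j => ?_)
  have hnn : ∀ j ∈ Finset.univ, 0 ≤ m (i.succAbove j) * m i := by
    intro j _
    by_cases hj : m (i.succAbove j) = 0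
    · simp [hj]
    · rw [hall _ hj, hi']
      exact mul_self_nonneg _
  have hz := (Finset.sum_eq_zero_iff_of_nonneg hnn).mp
    (by rw [← Finset.sum_mul, (hcon i hi).1, zero_mul]) j (Finset.mem_univ j)
  exact (mul_eq_zero.mp hz).resolve_right hi

theorem sum_zsmul_notMem_of_separatedSolutionFree {N : ℕ} {K E D : Set (Torus d)} (hD : Dense D)
    (h : ∀ (m : Fin (N + 1) → ℤ) (i : Fin (N + 1)), m i ≠ 0 →
      (∑ j, m (i.succAbove j) ≠ 0 ∨ (fun j => m (i.succAbove j)) = 0) → ∀ c ∈ D, ∀ k : ℕ,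
      ∃ U ∈ separatedSolutionFree K (m i) (fun j => m (i.succAbove j)) c (1 / (k + 1 : ℝ)), E ⊆ U)
    {x : Fin (N + 1) → Torus d} (hx : Function.Injective x) (hxE : ∀ i, x i ∈ E)
    {m : Fin (N + 1) → ℤ} (hm : m ≠ 0) : ∑ i, m i • x i ∉ K := by
  obtain ⟨i, hi, hw⟩ := exists_ne_zero_sum_succAbove hm
  have hsep : ∃ δ > 0, ∀ j, δ ≤ dist (x (i.succAbove j)) (x i) := by
    have hpos (j) : 0 < dist (x (i.succAbove j)) (x i) := dist_pos.mpr (hx.ne (Fin.succAbove_ne i j))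
    rcases isEmpty_or_nonempty (Fin N) with h | h
    · exact ⟨1, one_pos, fun j => h.elim j⟩
    · obtain ⟨j₀, hj₀⟩ := Finite.exists_min fun j => dist (x (i.succAbove j)) (x i)
      exact ⟨_, hpos j₀, hj₀⟩
  obtain ⟨δ, hδ, hsep⟩ := hsep
  -- With `ρ < δ / 4`, a point within `3ρ` of `c` would be within `4ρ < δ` of `x i`, contradicting
  -- the separation of the points.
  obtain ⟨k, hk⟩ := exists_nat_one_div_lt (by positivity : 0 < δ / 4)
  have hk0 : (0 : ℝ) < 1 / (k + 1) := by positivity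
  obtain ⟨c, hcD, hc⟩ := hD.exists_dist_lt (x i) hk0
  obtain ⟨U, ⟨-, hU⟩, hEU⟩ := h m i hi hw c hcD k
  rw [Fin.sum_univ_succAbove _ i]
  refine hU _ (hEU (hxE i)) _ (fun j => hEU (hxE _)) hc.le fun j hj => ?_
  rw [Metric.mem_ball] at hj
  have := hsep j
  linarith [dist_triangle_right (x (i.succAbove j)) (x i) c]

end Applications

/-! ### Generic properties and conclusion -/

section Generic

variable {d : ℕ} {β : ℝ}

theorem SupportPair.eventually_residual_of_fourierApproximable (hd : 1 ≤ d) (hβ : 0 < β) (hβd : β ≤ d)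
    {𝒰 : Set (Set (Torus d))} (ho : ∀ U ∈ 𝒰, IsOpen U) (h : FourierApproximable d β 𝒰) :
    ∀ᶠ p in residual (SupportPair d β), ∃ U ∈ 𝒰, (p.set : Set (Torus d)) ⊆ U :=
  residual_of_dense_open (SupportPair.isOpen_setOf_exists_subset ho)
    (SupportPair.dense_of_fourierApproximable hd hβ hβd h)

/-- The decay of the accompanying measure closes the chain `β ≤ dim_F ≤ dim_H ≤ β`. -/
theorem SupportPair.isSalem_of_dimH_le (hβd : β ≤ d) (p : SupportPair d β)
    (h : dimH (p.set : Set (Torus d)) ≤ ENNReal.ofReal β) :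
    IsSalem (p.set : Set (Torus d)) ∧ dimH (p.set : Set (Torus d)) = ENNReal.ofReal β := by
  have h1 := fourierDim_le_dimH (p.set : Set (Torus d))
  have h2 := le_fourierDim hβd p.measure p.support_subset p.decay
  exact ⟨le_antisymm h1 (h.trans h2), le_antisymm h (h2.trans h1)⟩

theorem SupportPair.eventually_residual_isSalem (hd : 1 ≤ d) (hβ : 0 < β) (hβd : β ≤ d) :
    ∀ᶠ p in residual (SupportPair d β), IsSalem (p.set : Set (Torus d)) ∧
      dimH (p.set : Set (Torus d)) = ENNReal.ofReal β := by
  have h : ∀ᶠ p in residual (SupportPair d β), ∀ j k : ℕ,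
      ∃ U ∈ efficientlyCovered d (β + 1 / (j + 1 : ℝ)) (1 / (k + 1 : ℝ)), (p.set : Set (Torus d)) ⊆ U :=
    eventually_countable_forall.mpr fun j => eventually_countable_forall.mpr fun k =>
      SupportPair.eventually_residual_of_fourierApproximable hd hβ hβd (fun U hU => hU.1)
        (fourierApproximable_efficientlyCovered (lt_add_of_pos_right _ (by positivity)) (by positivity))
  exact h.mono fun p hp => p.isSalem_of_dimH_le hβd (dimH_le_of_efficientlyCovered hβ hp)

/-- The conditions are indexed by the compact pieces, the integer vectors, the distinguished index,
a countable dense set of centres and the radii `1/(k+1)`, so countably many suffice. -/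
theorem SupportPair.eventually_residual_avoidsLinear {N : ℕ} (hd : 1 ≤ d) (hN : 1 ≤ N) (hβ : 0 < β)
    (hβd : β ≤ d) (hNβ : N * β ≤ d) {C : Set (Set (Torus d))} (hC : C.Countable)
    (hC0 : ∀ K ∈ C, lowerMinkowskiDim K = 0) :
    ∀ᶠ p in residual (SupportPair d β), AvoidsLinear (N + 1) (⋃₀ C) (p.set : Set (Torus d)) := by
  obtain ⟨D, hDc, hD⟩ := exists_countable_dense (Torus d)
  have : Countable C := hC.to_subtype
  have : Countable D := hDc.to_subtype
  have h : ∀ᶠ p in residual (SupportPair d β), ∀ (K : C) (m : Fin (N + 1) → ℤ) (i : Fin (N + 1)),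
      m i ≠ 0 → (∑ j, m (i.succAbove j) ≠ 0 ∨ (fun j => m (i.succAbove j)) = 0) → ∀ (c : D) (k : ℕ),
      ∃ U ∈ separatedSolutionFree (K : Set (Torus d)) (m i) (fun j => m (i.succAbove j)) c (1 / (k + 1 : ℝ)),
        (p.set : Set (Torus d)) ⊆ U := by
    refine eventually_countable_forall.mpr fun K => eventually_countable_forall.mpr fun m =>
      eventually_countable_forall.mpr fun i => eventually_countable_forall.mpr fun hi =>
      eventually_countable_forall.mpr fun hw => eventually_countable_forall.mpr fun c =>
      eventually_countable_forall.mpr fun k => ?_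
    exact SupportPair.eventually_residual_of_fourierApproximable hd hβ hβd (fun U hU => hU.1)
      (fourierApproximable_separatedSolutionFree hN hNβ (hC0 K K.2) hi hw c (by positivity))
  refine h.mono fun p hp => ?_
  rintro s ⟨K, hK, hsK⟩ x hx hxE m hm rfl
  exact sum_zsmul_notMem_of_separatedSolutionFree hD
    (fun m i hi hw c hc k => hp ⟨K, hK⟩ m i hi hw ⟨c, hc⟩ k) hx hxE hm hsK

theorem SupportPair.nonempty (hd : 1 ≤ d) (hβd : β ≤ d) : Nonempty (SupportPair d β) := by
  obtain ⟨C, hC0, hC⟩ := exists_mollifier hd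
  obtain ⟨φ, hφ, -, hφd⟩ := hC (1 / 4) (by norm_num) le_rfl
  refine ⟨⟨⟨⊤, univ_nonempty⟩, φ, subset_univ _, fun t ht => ?_⟩⟩
  have hd0 : (0 : ℝ) ≤ d := Nat.cast_nonneg d
  refine hasFourierDecay_of_norm_le_pow ht.1 (by linarith [ht.2]) (K := C / (1 / 4)) fun ξ hξ => ?_
  rw [div_div]
  exact hφd ξ hξ

end Generic

theorem mainTheorem4 (d n : ℕ) (hd : 1 ≤ d) (hn : 2 ≤ n) (S : Set (Torus d))
    (hS : ∃ C : Set (Set (Torus d)), C.Countable ∧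
      (∀ K ∈ C, IsCompact K ∧ lowerMinkowskiDim K = 0) ∧ S = ⋃₀ C) :
    (∃ E : Set (Torus d), IsCompact E ∧ IsSalem E ∧
      dimH E = ENNReal.ofReal ((d : ℝ) / ((n : ℝ) - 1)) ∧ AvoidsLinear n S E) ∧
    ∀ β : ℝ, 0 < β → β ≤ (d : ℝ) / ((n : ℝ) - 1) →
      ∀ᶠ p in residual (SupportPair d β),
        IsSalem (p.set : Set (Torus d)) ∧
        dimH (p.set : Set (Torus d)) = ENNReal.ofReal β ∧
        AvoidsLinear n S (p.set : Set (Torus d)) := by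
  obtain ⟨C, hC, hCK, rfl⟩ := hS
  obtain ⟨N, rfl⟩ : ∃ N, n = N + 1 := ⟨n - 1, by omega⟩
  have hN : 1 ≤ N := by omega
  have hN1 : (1 : ℝ) ≤ N := by exact_mod_cast hN
  have hd0 : (0 : ℝ) < d := by exact_mod_cast hd
  have hcast : ((N + 1 : ℕ) : ℝ) - 1 = N := by push_cast; ring
  rw [hcast]
  have hle {β : ℝ} (hβ : β ≤ d / N) : β ≤ d := hβ.trans (div_le_self hd0.le hN1)
  have main : ∀ β : ℝ, 0 < β → β ≤ (d : ℝ) / N → ∀ᶠ p in residual (SupportPair d β),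
      IsSalem (p.set : Set (Torus d)) ∧ dimH (p.set : Set (Torus d)) = ENNReal.ofReal β ∧
        AvoidsLinear (N + 1) (⋃₀ C) (p.set : Set (Torus d)) := by
    intro β hβ hβN
    have hNβ : N * β ≤ d := by rwa [le_div_iff₀' (by linarith)] at hβN
    filter_upwards [SupportPair.eventually_residual_isSalem hd hβ (hle hβN),
      SupportPair.eventually_residual_avoidsLinear hd hN hβ (hle hβN) hNβ hC fun K hK => (hCK K hK).2]
      with p h1 h2
    exact ⟨h1.1, h1.2, h2⟩
  refine ⟨?_, main⟩
  have hβ : 0 < (d : ℝ) / N := by positivity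
  have := SupportPair.baireSpace (d := d) hβ
  have := SupportPair.nonempty hd (hle le_rfl : (d : ℝ) / N ≤ d)
  -- In a nonempty Baire space a residual set is nonempty, so the critical exponent `β = d / N`
  -- gives the single set `E`.
  obtain ⟨p, hp⟩ := (dense_of_mem_residual (main _ hβ le_rfl)).nonempty
  exact ⟨p.set, p.set.isCompact, hp⟩
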